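/- Let $(\mathcal C,d,m,\pi)$ be a finite-dimensional, non-negatively graded real dg Frobenius algebra (a unital graded-commutative dg algebra with a non-degenerate graded-symmetric pairing $\pi$ of degree $-3$ such that $\pi(da,b)+(-1)^{|a|}\pi(a,db)=0$ and $\pi(a,bc)=\pi(ab,c)$), and let $\mathfrak g$ be a finite-dimensional real Lie algebra with a non-degenerate ad-invariant symmetric form $\pi_{\mathfrak g}$. Put $\mathcal F=\mathfrak g\otimes\mathcal C[1]$, with canonical element $\omega$, and let $$S=S_0+\tfrac16\pi(\omega,l(\omega,\omega)),\qquad S_0=\tfrac12\pi(\omega,d\omega),\qquad l(X\otimes a,Y\otimes b)=[X,Y]\otimes ab,$$ be the abstract Chern--Simons action. Let $\iota:H^\bullet(\mathcal C)\to\mathcal C^\bullet$ be a linear map of degree $0$ with $\iota([a])\in a+\operatorname{im}d$ for every cocycle $a$, and let $\mathcal P'$ be the $\pi$-orthogonal projection of $\mathcal C$ onto $\operatorname{im}\iota$. The space $\mathcal F'=H^\bullet(\mathcal C)\otimes\mathfrak g[1]$, with canonical element $\alpha$, carries the BV Laplacian $\Delta'$ and the anti-bracket $\{\cdot,\cdot\}'$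 defined by the pairing $\pi_{\mathfrak g}\otimes\pi(\iota\cdot,\iota\cdot)$; in coordinates $\alpha^x$ of ghost number $\mathrm{gh}(x)$, with inverse pairing matrix $B$, these are $\Delta'f=\frac12\sum B^{xy}\partial_x\partial_yf$ and $\{f,g\}'=\sum(-1)^{\mathrm{gh}(x)}B^{xy}(f\overleftarrow\partial_x)(\overrightarrow\partial_yg)$. Here $\mathrm{Fun}(\mathcal F')$ denotes formal power series functions on the graded space $\mathcal F'$. For a linear map $K:\mathcal C^\bullet\to\mathcal C^{\bullet-1}$ consider the conditions $$dK+Kd=\mathrm{id}-\mathcal P',\qquad \pi(Ka,b)=(-1)^{|a|}\pi(a,Kb),\qquad K\circ\iota=0.\tag{$*$}$$ For $K$ satisfying $(*)$ let $\mathrm{Ind}_{\iota,K}(S)\in\mathrm{Fun}(\mathcal F')[[\hbar]]$ be the perturbative effective action $$\mathrm{Ind}_{\iota,K}(S)(\alpha)=\hbar\log\Big(e^{-\frac{\hbar}{2}\pi^{-1}(\frac{\partial}{\partial\omega''},K\frac{\partial}{\partial\omega''})}\Big|_{\omega''=0}\;e^{(S(\iota(\alpha)+\omega'')-S_0(\omega''))/\hbar}\Big),$$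 where $\omega''$ runs over the orthogonal complement of $\iota(\mathcal F')$ in $\mathcal F$. Let $\hat K:\mathcal C^\bullet\to\mathcal C^{\bullet-1}$ satisfy $(*)$, where $\hat K^2=0$ is not required, and put $K=\hat K d\hat K$. Then $K$ satisfies $(*)$ and $K^2=0$, and the relaxed effective action $\mathrm{Ind}_{\iota,\hat K}(S)$ is connected to the strict effective action $\mathrm{Ind}_{\iota,K}(S)$ by a canonical transformation. That is, there are $W(t),R(t)\in\mathrm{Fun}(\mathcal F')[[\hbar]]$, depending smoothly on $t\in[0,1]$ and of ghost numbers $0$ and $-1$, with $W(0)=\mathrm{Ind}_{\iota,K}(S)$, $W(1)=\mathrm{Ind}_{\iota,\hat K}(S)$, such that for all $t\in[0,1]$ $$\tfrac12\{W(t),W(t)\}'+\hbar\Delta'W(t)=0,\qquad \frac{d}{dt}W(t)=\{W(t),R(t)\}'+\hbar\Delta'R(t).$$ -/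

import Mathlib

open scoped TensorProduct ContDiff

noncomputable section

namespace CSEffective

/-! ### dg Frobenius algebras, cohomology, chain homotopies -/

/-- A dg Frobenius algebra structure on a unital, non-negatively graded associative real algebra:
a differential and a non-degenerate pairing of degree `-k`. -/
structure DGFrobenius {C : Type*} [Ring C] [Algebra ℝ C] (𝒞 : ℕ → Submodule ℝ C)
    [GradedAlgebra 𝒞] (k : ℕ) where
  /-- the differential -/
  d : C →ₗ[ℝ] C
  /-- the pairing -/
  pair : LinearMap.BilinForm ℝ C
  mul_comm_graded : ∀ i j : ℕ, ∀ a ∈ 𝒞 i, ∀ b ∈ 𝒞 j, a * b = (-1 : ℝ) ^ (i * j) • (b * a)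
  d_degree : ∀ i : ℕ, ∀ a ∈ 𝒞 i, d a ∈ 𝒞 (i + 1)
  d_d : ∀ a : C, d (d a) = 0
  leibniz : ∀ i : ℕ, ∀ a ∈ 𝒞 i, ∀ b : C, d (a * b) = d a * b + (-1 : ℝ) ^ i • (a * d b)
  pair_degree : ∀ i j : ℕ, ∀ a ∈ 𝒞 i, ∀ b ∈ 𝒞 j, i + j ≠ k → pair a b = 0
  pair_symm : ∀ i j : ℕ, ∀ a ∈ 𝒞 i, ∀ b ∈ 𝒞 j, pair a b = (-1 : ℝ) ^ (i * j) * pair b a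
  pair_nondegenerate : pair.Nondegenerate
  pair_d : ∀ i : ℕ, ∀ a ∈ 𝒞 i, ∀ b : C, pair (d a) b + (-1 : ℝ) ^ i * pair a (d b) = 0
  pair_cyclic : ∀ a b c : C, pair a (b * c) = pair (a * b) c

namespace DGFrobenius

variable {C : Type*} [Ring C] [Algebra ℝ C] {𝒞 : ℕ → Submodule ℝ C} [GradedAlgebra 𝒞] {k : ℕ}

/-- The cohomology `ker d / im d`. -/
abbrev Cohomology (A : DGFrobenius 𝒞 k) : Type _ :=
  LinearMap.ker A.d ⧸ (LinearMap.range A.d).submoduleOf (LinearMap.ker A.d)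

/-- The cohomology class of a cocycle. -/
def cls (A : DGFrobenius 𝒞 k) : LinearMap.ker A.d →ₗ[ℝ] A.Cohomology :=
  ((LinearMap.range A.d).submoduleOf (LinearMap.ker A.d)).mkQ

/-- The degree `i` part of the cohomology: classes of cocycles of degree `i`. -/
def cohomologyDeg (A : DGFrobenius 𝒞 k) (i : ℕ) : Submodule ℝ A.Cohomology :=
  ((𝒞 i).submoduleOf (LinearMap.ker A.d)).map A.cls

/-- `ι` is a degree 0 embedding of cohomology by representatives: `ι [a] = a + d (…)`. -/
structure IsEmbedding (A : DGFrobenius 𝒞 k) (ι : A.Cohomology →ₗ[ℝ] C) : Prop where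
  degree : ∀ i : ℕ, ∀ x ∈ A.cohomologyDeg i, ι x ∈ 𝒞 i
  represents : ∀ a : LinearMap.ker A.d, ∃ b : C, ι (A.cls a) = (a : C) + A.d b

/-- `Q` is the orthogonal projection, with respect to the pairing, onto the image of `ι`. -/
def IsOrthogonalProjection (A : DGFrobenius 𝒞 k) (ι : A.Cohomology →ₗ[ℝ] C)
    (Q : C →ₗ[ℝ] C) : Prop :=
  ∀ a : C, Q a ∈ LinearMap.range ι ∧ ∀ x : A.Cohomology, A.pair (Q a) (ι x) = A.pair a (ι x)

/-- A symmetric chain homotopy of degree `-1` retracting the algebra to the representatives of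
cohomology; the square of `K` is not required to vanish. -/
structure IsChainHomotopy (A : DGFrobenius 𝒞 k) (ι : A.Cohomology →ₗ[ℝ] C)
    (K : C →ₗ[ℝ] C) : Prop where
  degree : ∀ i : ℕ, ∀ a ∈ 𝒞 (i + 1), K a ∈ 𝒞 i
  degree_zero : ∀ a ∈ 𝒞 0, K a = 0
  homotopy : ∃ Q : C →ₗ[ℝ] C, A.IsOrthogonalProjection ι Q ∧
    ∀ a : C, A.d (K a) + K (A.d a) = a - Q a
  symmetric : ∀ i : ℕ, ∀ a ∈ 𝒞 i, ∀ b : C, A.pair (K a) b = (-1 : ℝ) ^ i * A.pair a (K b)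
  comp_embedding : ∀ x : A.Cohomology, K (ι x) = 0

end DGFrobenius

/-- A non-degenerate ad-invariant symmetric bilinear form: the datum of a quadratic Lie algebra. -/
structure IsQuadratic {𝔤 : Type*} [LieRing 𝔤] [LieAlgebra ℝ 𝔤]
    (κ : LinearMap.BilinForm ℝ 𝔤) : Prop where
  symm : κ.IsSymm
  nondegenerate : κ.Nondegenerate
  invariant : ∀ x y z : 𝔤, κ ⁅x, y⁆ z = κ x ⁅y, z⁆

/-- A basis of a vector space that consists of homogeneous elements, with their degrees. -/
structure HomBasis (I : Type*) {M : Type*} [AddCommGroup M] [Module ℝ M]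
    (𝒱 : ℕ → Submodule ℝ M) where
  basis : Module.Basis I ℝ M
  deg : I → ℕ
  mem : ∀ i : I, basis i ∈ 𝒱 (deg i)

/-! ### Polynomial functions on a graded vector space

A finite-dimensional graded vector space is given through linear coordinates indexed by `X`, with
ghost numbers `gh : X → ℤ`; coordinates of even ghost number commute, those of odd ghost number
anticommute with each other. -/

section SuperFunctions

variable {X Y : Type*}

/-- Indices of the even coordinates. -/
abbrev EvenIdx (gh : X → ℤ) : Type _ := {x : X // Even (gh x)}

/-- Indices of the odd coordinates. -/
abbrev OddIdx (gh : X → ℤ) : Type _ := {x : X // ¬ Even (gh x)}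

/-- Polynomial functions `Fun(F) = S^• F^*`: polynomials in the even coordinates tensored with the
exterior algebra on the odd ones. -/
abbrev SFun (gh : X → ℤ) : Type _ :=
  MvPolynomial (EvenIdx gh) ℝ ⊗[ℝ] ExteriorAlgebra ℝ (OddIdx gh → ℝ)

/-- The coordinate function with index `x`. -/
def coord [DecidableEq X] (gh : X → ℤ) (x : X) : SFun gh :=
  if h : Even (gh x) then MvPolynomial.X ⟨x, h⟩ ⊗ₜ[ℝ] 1
  else 1 ⊗ₜ[ℝ] ExteriorAlgebra.ι ℝ (Pi.single (⟨x, h⟩ : OddIdx gh) (1 : ℝ))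

/-- The left partial derivative in the coordinate `x`. -/
def leftDeriv (gh : X → ℤ) (x : X) : SFun gh →ₗ[ℝ] SFun gh :=
  if h : Even (gh x) then
    LinearMap.rTensor _ (MvPolynomial.pderiv (R := ℝ) (⟨x, h⟩ : EvenIdx gh)).toLinearMap
  else
    LinearMap.lTensor _ (CliffordAlgebra.contractLeft
      (LinearMap.proj (⟨x, h⟩ : OddIdx gh) : (OddIdx gh → ℝ) →ₗ[ℝ] ℝ))

/-- The right partial derivative in the coordinate `x`. -/
def rightDeriv (gh : X → ℤ) (x : X) : SFun gh →ₗ[ℝ] SFun gh :=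
  if h : Even (gh x) then
    LinearMap.rTensor _ (MvPolynomial.pderiv (R := ℝ) (⟨x, h⟩ : EvenIdx gh)).toLinearMap
  else
    LinearMap.lTensor _ (CliffordAlgebra.contractRight.flip
      (LinearMap.proj (⟨x, h⟩ : OddIdx gh) : (OddIdx gh → ℝ) →ₗ[ℝ] ℝ))

/-- The functions that are homogeneous of polynomial degree `n` and of ghost number `g`. -/
def homogeneous [DecidableEq X] (gh : X → ℤ) (n : ℕ) (g : ℤ) : Submodule ℝ (SFun gh) :=
  Submodule.span ℝ {f | ∃ L : List X, L.length = n ∧ (L.map gh).sum = g ∧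
    f = (L.map (coord gh)).prod}

/-- Pull-back along the degree 0 linear map that expresses the coordinate `x` of the target as
`∑ y, J x y • (coordinate y of the source)`. As the map has degree 0, `J x y = 0` unless `x` and
`y` have the same ghost number. -/
def pullback [Fintype X] [Fintype Y] (ghX : X → ℤ) (ghY : Y → ℤ) (J : Matrix X Y ℝ) :
    SFun ghX →ₐ[ℝ] SFun ghY :=
  Algebra.TensorProduct.map
    (MvPolynomial.aeval fun x : EvenIdx ghX =>
      ∑ y : EvenIdx ghY, J x.1 y.1 • (MvPolynomial.X y : MvPolynomial (EvenIdx ghY) ℝ))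
    (ExteriorAlgebra.map (Matrix.vecMulLinear
      (Matrix.of fun (x : OddIdx ghX) (y : OddIdx ghY) => J x.1 y.1)))

variable [Fintype X]

/-- The constant coefficient second order operator `∑ x y, B x y ∂_x ∂_y` (left derivatives). -/
def secondOrder (gh : X → ℤ) (B : Matrix X X ℝ) : Module.End ℝ (SFun gh) :=
  ∑ x : X, ∑ y : X, B x y • (leftDeriv gh x ∘ₗ leftDeriv gh y)

/-- The BV Laplacian `½ ∑ (π⁻¹)^{xy} ∂_x ∂_y`. -/
def bvLaplacian (gh : X → ℤ) (B : Matrix X X ℝ) : Module.End ℝ (SFun gh) :=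
  (1 / 2 : ℝ) • secondOrder gh B

/-- The anti-bracket `∑ (-1)^{gh x} (π⁻¹)^{xy} (f ∂⃖_x) (∂⃗_y g)`. -/
def antiBracket (gh : X → ℤ) (B : Matrix X X ℝ) (f g : SFun gh) : SFun gh :=
  ∑ x : X, ∑ y : X, ((-1 : ℝ) ^ (gh x) * B x y) • (rightDeriv gh x f * leftDeriv gh y g)

/-! ### Formal functions with values in power series of `ħ`, and canonical transformations -/

/-- A candidate element `∑ ħ^l f l n` of `Fun(F)[[ħ]]`, where `Fun(F)` is completed to formal
power series: `f l n` is the part of order `ħ^l` and of polynomial degree `n`. -/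
abbrev FormalFun (gh : X → ℤ) : Type _ := ℕ → ℕ → SFun gh

/-- `f l n` really is of polynomial degree `n`, and of ghost number `g`, for all `l`, `n`. -/
def IsOfGhost [DecidableEq X] (gh : X → ℤ) (g : ℤ) (f : FormalFun gh) : Prop :=
  ∀ l n : ℕ, f l n ∈ homogeneous gh n g

/-- The anti-bracket of formal functions. -/
def formalBracket (gh : X → ℤ) (B : Matrix X X ℝ) (f g : FormalFun gh) : FormalFun gh :=
  fun l n => ∑ p ∈ Finset.HasAntidiagonal.antidiagonal l, ∑ q ∈ Finset.HasAntidiagonal.antidiagonal (n + 2),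
    antiBracket gh B (f p.1 q.1) (g p.2 q.2)

/-- `ħ Δ f` for a formal function `f`. -/
def hbarLaplacian (gh : X → ℤ) (B : Matrix X X ℝ) (f : FormalFun gh) : FormalFun gh
  | 0, _ => 0
  | l + 1, n => bvLaplacian gh B (f l (n + 2))

/-- The quantum master equation `½ {f, f} + ħ Δ f = 0`. -/
def QME (gh : X → ℤ) (B : Matrix X X ℝ) (f : FormalFun gh) : Prop :=
  ∀ l n : ℕ, (1 / 2 : ℝ) • formalBracket gh B f f l n + hbarLaplacian gh B f l n = 0

/-- A path of formal functions over `[0, 1]` is smooth: each homogeneous part (which stays in a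
finite-dimensional space) has smooth coefficients. -/
def SmoothPath (gh : X → ℤ) (f : ℝ → FormalFun gh) : Prop :=
  ∀ l n : ℕ, ∀ φ : SFun gh →ₗ[ℝ] ℝ, ContDiffOn ℝ ∞ (fun t => φ (f t l n)) (Set.Icc 0 1)

/-- A homotopy `W(t) + dt R(t)`, with `W` of ghost number `0` and `R` of ghost number `-1`, that
solves the quantum master equation extended by `[0, 1]`: every `W(t)` solves the quantum master
equation, and `dW/dt = {W, R} + ħ Δ R`, so that `W(t + δt)` arises from `W(t)` by the
infinitesimal canonical transformation with generator `δt R(t)`. -/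
structure IsHomotopy [DecidableEq X] (gh : X → ℤ) (B : Matrix X X ℝ)
    (W R : ℝ → FormalFun gh) : Prop where
  smooth_action : SmoothPath gh W
  smooth_generator : SmoothPath gh R
  ghost_action : ∀ t ∈ Set.Icc (0 : ℝ) 1, IsOfGhost gh 0 (W t)
  ghost_generator : ∀ t ∈ Set.Icc (0 : ℝ) 1, IsOfGhost gh (-1) (R t)
  qme : ∀ t ∈ Set.Icc (0 : ℝ) 1, QME gh B (W t)
  flow : ∀ t ∈ Set.Icc (0 : ℝ) 1, ∀ l n : ℕ, ∀ φ : SFun gh →ₗ[ℝ] ℝ,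
    HasDerivWithinAt (fun s => φ (W s l n))
      (φ (formalBracket gh B (W t) (R t) l n + hbarLaplacian gh B (R t) l n))
      (Set.Icc 0 1) t

/-- Two actions are connected by a (finite) canonical transformation. -/
def CanonicallyEquivalent [DecidableEq X] (gh : X → ℤ) (B : Matrix X X ℝ)
    (W₀ W₁ : FormalFun gh) : Prop :=
  ∃ W R : ℝ → FormalFun gh, IsHomotopy gh B W R ∧ W 0 = W₀ ∧ W 1 = W₁

end SuperFunctions

/-- The logarithm `∑_{j ≥ 1} (-1)^{j+1} (Z - 1)^j / j` of a power series in `λ` with constant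
term `1`; only `j ≤ k` contribute to the coefficient of `λ^k`. -/
def logSeries {R : Type*} [Ring R] [Module ℝ R] (Z : PowerSeries R) : PowerSeries R :=
  PowerSeries.mk fun k => ∑ j ∈ Finset.Icc 1 k,
    ((-1 : ℝ) ^ (j + 1) / (j : ℝ)) • PowerSeries.coeff k ((Z - 1) ^ j)

/-! ### The abstract Chern-Simons action and its effective action on cohomology -/

section ChernSimons

variable {C : Type*} [Ring C] [Algebra ℝ C] {𝒞 : ℕ → Submodule ℝ C} [GradedAlgebra 𝒞]
  {𝔤 : Type*} [LieRing 𝔤] [LieAlgebra ℝ 𝔤]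
  {I J P : Type*}

/-- Ghost numbers of the coordinates on `𝔤 ⊗ V[1]`: `gh = 1 - |e_i|`. -/
def ghost {M : Type*} [AddCommGroup M] [Module ℝ M] {𝒱 : ℕ → Submodule ℝ M}
    (e : HomBasis I 𝒱) (J : Type*) : I × J → ℤ :=
  fun x => 1 - (e.deg x.1 : ℤ)

variable [Fintype I] [DecidableEq I] [Fintype J] [DecidableEq J] [Fintype P] [DecidableEq P]

/-- The free part
`S₀ = ½ π(ω, dω) = ½ ∑ (-1)^{|i|+1} π(e_i, d e_j) κ(T_a, T_b) ω^{ia} ω^{jb}`. -/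
def freeAction (A : DGFrobenius 𝒞 3) (κ : LinearMap.BilinForm ℝ 𝔤) (e : HomBasis I 𝒞)
    (T : Module.Basis J ℝ 𝔤) : SFun (ghost e J) :=
  (1 / 2 : ℝ) • ∑ x : I × J, ∑ y : I × J,
    ((-1 : ℝ) ^ (e.deg x.1 + 1) * A.pair (e.basis x.1) (A.d (e.basis y.1)) *
      κ (T x.2) (T y.2)) • (coord (ghost e J) x * coord (ghost e J) y)

/-- The abstract Chern-Simons action `S = ½ π(ω, dω) + ⅙ π(ω, l(ω, ω))`, where the cubic term is
`⅙ ∑ (-1)^{|j|(|k|+1)} κ(T_a, [T_b, T_c]) π(e_i, e_j e_k) ω^{ia} ω^{jb} ω^{kc}`. -/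
def csAction (A : DGFrobenius 𝒞 3) (κ : LinearMap.BilinForm ℝ 𝔤) (e : HomBasis I 𝒞)
    (T : Module.Basis J ℝ 𝔤) : SFun (ghost e J) :=
  freeAction A κ e T +
  (1 / 6 : ℝ) • ∑ x : I × J, ∑ y : I × J, ∑ z : I × J,
    ((-1 : ℝ) ^ (e.deg y.1 * (e.deg z.1 + 1)) * κ (T x.2) ⁅T y.2, T z.2⁆ *
      A.pair (e.basis x.1) (e.basis y.1 * e.basis z.1)) •
      (coord (ghost e J) x * coord (ghost e J) y * coord (ghost e J) z)

/-- The propagator `π⁻¹(·, K ·)`: the matrix `δ^{ab} K^{ij}`, `K^{ij} = ∑_m K^i_m (π⁻¹)^{mj}`, where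
`K e_m = ∑_i K^i_m e_i`; for a basis `T` that is not orthonormal, `δ^{ab}` is the inverse Gram
matrix. -/
def propagator (A : DGFrobenius 𝒞 3) (κ : LinearMap.BilinForm ℝ 𝔤) (e : HomBasis I 𝒞)
    (T : Module.Basis J ℝ 𝔤) (K : C →ₗ[ℝ] C) : Matrix (I × J) (I × J) ℝ :=
  Matrix.of fun x y =>
    (LinearMap.toMatrix e.basis e.basis K *
      (Matrix.of fun i j => A.pair (e.basis i) (e.basis j))⁻¹) x.1 y.1 *
    (Matrix.of fun a b => κ (T a) (T b))⁻¹ x.2 y.2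

/-- The inverse of the pairing that `ι` induces on the cohomology with coefficients in `𝔤`. -/
def cohomologyPoisson (A : DGFrobenius 𝒞 3) (κ : LinearMap.BilinForm ℝ 𝔤)
    (T : Module.Basis J ℝ 𝔤) (h : HomBasis P A.cohomologyDeg) (ι : A.Cohomology →ₗ[ℝ] C) :
    Matrix (P × J) (P × J) ℝ :=
  Matrix.of fun x y =>
    (Matrix.of fun p q => A.pair (ι (h.basis p)) (ι (h.basis q)))⁻¹ x.1 y.1 *
    (Matrix.of fun a b => κ (T a) (T b))⁻¹ x.2 y.2

/-- Restriction of a function on `𝔤 ⊗ C[1]` to the zero-modes `ω = ι(α)`, that is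
`ω^{ia} = ∑_p ι^i_p α^{pa}`. -/
def restrictZeroModes (A : DGFrobenius 𝒞 3) (e : HomBasis I 𝒞) (J : Type*) [Fintype J]
    [DecidableEq J] (h : HomBasis P A.cohomologyDeg) (ι : A.Cohomology →ₗ[ℝ] C) :
    SFun (ghost e J) →ₐ[ℝ] SFun (ghost h J) :=
  pullback (ghost e J) (ghost h J) (Matrix.of fun x y =>
    if x.2 = y.2 then e.basis.repr (ι (h.basis y.1)) x.1 else 0)

/-- The series
`Z = exp(-ħ ½ π⁻¹(∂/∂ω'', K ∂/∂ω'')) |_{ω''=0} exp(λ (S(ι(α) + ω'') - S₀(ω'')) / ħ)`,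
with a formal parameter `λ` that counts vertices, and Laurent series in `ħ` as coefficients.

The fluctuation `ω''` runs over the orthogonal complement of `im ι`. As the image of `K` lies in
that complement, the operator differentiates only in its directions, so that differentiating in
`ω''` and setting `ω'' = 0` is the same as differentiating in `ω` and restricting to `ω = ι(α)`; and
`S₀(ω'') = S₀(ι(α) + ω'')` because `d ι = 0`. -/
def partitionSeries (A : DGFrobenius 𝒞 3) (κ : LinearMap.BilinForm ℝ 𝔤) (e : HomBasis I 𝒞)
    (T : Module.Basis J ℝ 𝔤) (h : HomBasis P A.cohomologyDeg) (ι : A.Cohomology →ₗ[ℝ] C)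
    (K : C →ₗ[ℝ] C) : PowerSeries (LaurentSeries (SFun (ghost h J))) :=
  PowerSeries.mk fun k =>
    HahnSeries.single (-(k : ℤ)) (1 : SFun (ghost h J)) *
    HahnSeries.ofPowerSeries ℤ (SFun (ghost h J)) (PowerSeries.mk fun j =>
      ((-1 / 2 : ℝ) ^ j / ((j.factorial : ℝ) * (k.factorial : ℝ))) •
        restrictZeroModes A e J h ι
          ((secondOrder (ghost e J) (propagator A κ e T K) ^ j)
            ((csAction A κ e T - freeAction A κ e T) ^ k)))

/-- The effective action `Ind_{ι,K}(S) = ħ log Z |_{λ=1}`, an element of `Fun(F')[[ħ]]`. By the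
Euler characteristic, a connected graph with trivalent vertices, `l` loops and `n` leaves has
exactly `n + 2l - 2` vertices; so the part of order `ħ^l` and degree `n` of `ħ log Z |_{λ=1}` is the
coefficient of `ħ^{l-1}` in the coefficient of `λ^{n+2l-2}` of `log Z`. (Where `n + 2l < 2` the
truncated subtraction gives the coefficient of `λ^0`, which is `0`, as it should be.) -/
def effectiveAction (A : DGFrobenius 𝒞 3) (κ : LinearMap.BilinForm ℝ 𝔤) (e : HomBasis I 𝒞)
    (T : Module.Basis J ℝ 𝔤) (h : HomBasis P A.cohomologyDeg) (ι : A.Cohomology →ₗ[ℝ] C)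
    (K : C →ₗ[ℝ] C) : FormalFun (ghost h J) :=
  fun l n => HahnSeries.coeff
    (PowerSeries.coeff (n + 2 * l - 2) (logSeries (partitionSeries A κ e T h ι K))) ((l : ℤ) - 1)

end ChernSimons

end CSEffective

end

/-!
Two chain homotopies `K̂` and `K = K̂ d K̂` differ by the exact term `[d, Λ]` with `Λ = K̂³ d`
(`HomotopyIdentities.sub_eq`); the projection `Q = id - d K̂ - K̂ d` that kills `d` and `K̂` from
both sides also makes `K` a strict homotopy. The effective actions of the propagators
`K_t = K + t (K̂ - K)` are the required homotopy. They are `ħ log Z_t` with `Z_t = r V_t` and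
`V_t = exp (ħ P_t) exp (u / ħ)`, where `u` is the cubic term of the Chern-Simons action, `P_t` is the
second order operator of `-½ K_t`, and `r` is the restriction to the zero-modes.

The cubic `u` is annihilated by the vector field `D` of `d`, because `d` is a derivation compatible
with the pairing (`linVec_csTensor`); by the Laplacian of the full pairing, because
`κ(x, [y, z])` is antisymmetric (`sec_csTensor`); and by its own anti-bracket, because of
the Jacobi identity, associativity and cyclicity (`bracket_csTensor`). Hence `D` and the Laplacian
kill all powers of `u`. Since `d K_t + K_t d = id - Q`, the commutator of `D` with `P_t` is a multiple
of the difference of the Laplacian of the full pairing and the one of `Q` (`linVec_sec_propagator`).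
On zero-modes `D` vanishes, and the Laplacian of `Q` becomes the Laplacian `Δ'` of the cohomology. So
`Δ' Z_t = 0`. In the same way the anticommutator of `D` with the operator of `Λ` is that of
`K̂ - K` (`linVec_sec_generator`), so that the derivative of `Z_t` is a multiple of `Δ' (r Λ V_t)`.
These two facts, for each number of vertices and edges, are `effectiveFlow`.

They are equations between linear expressions in `Z`; dividing by `Z = exp w` turns them into the
quantum master equation for `w` and the flow equation with the generator
`½ h r (∑ Λ^{xy} (∂_x ∂_y w̃ + ∂_x w̃ ∂_y w̃))`, `w̃ = log V_t` (`EffectiveFlow.quantum_master`,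
`EffectiveFlow.deriv_log_series`). Instead of Laurent series in `ħ`, these calculations use power
series in a variable `μ` that counts vertices and a variable `h` that counts edges. The logarithm of
such a series satisfies a differential equation in `h` from which it follows that it consists of
connected diagrams, with at least `k - 1` edges on `k` vertices
(`TwistedDerivations.coeff_log_expSeries_eq_zero`). A connected diagram with `l` loops and `n` legs has
`n + 2 l - 2` vertices, so `ħ`-order and degree recover `μ` and `h`; the passage back to formal
functions is therefore compatible with the anti-bracket and the Laplacian (`formalBracket_toFormal`,
`hbarLaplacian_toFormal`), and identifies the logarithm with the effective action
(`effectiveAction_eq`). All coefficients are polynomials in `t`, which gives smoothness.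

The ring `SFun` of functions enters through its generators, their exchange relations and the left
derivatives only, which are collected in `SuperCalculus`. The logarithm and the second order operators
are also needed on power series over it, where derivatives act on coefficients: this is the purpose of
`TwistedDerivations`.
-/

noncomputable section

namespace CSEffective

/-! ### Calculus on a graded vector space -/

/-- The Koszul sign for the exchange of the coordinates `x` and `y`. -/
def koszul {X : Type*} (gh : X → ℤ) (x y : X) : ℝ := if Even (gh x) ∨ Even (gh y) then 1 else -1

section Koszul

variable {X : Type*} (gh : X → ℤ)

theorem koszul_symm (x y : X) : koszul gh x y = koszul gh y x := by
  simp [koszul, or_comm]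

theorem koszul_mul_self (x y : X) : koszul gh x y * koszul gh x y = 1 := by
  unfold koszul; split_ifs <;> norm_num

theorem koszul_eq_one {x y : X} (h : Odd (gh x + gh y)) : koszul gh x y = 1 := by
  rw [koszul, if_pos]
  by_contra hc
  rw [not_or, Int.not_even_iff_odd, Int.not_even_iff_odd] at hc
  exact Int.not_even_iff_odd.2 h (hc.1.add_odd hc.2)

end Koszul

/-- A ring with twisted derivations: `∂ x (a b) = ∂ x a * b + tw x a * ∂ x b`, where elements fixed
by all the twists are central. Unlike the ring of functions itself, this notion passes to power
series with operators acting on coefficients. -/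
structure TwistedDerivations (X S : Type*) [Ring S] [Algebra ℝ S] where
  /-- the derivations -/
  der : X → S →ₗ[ℝ] S
  /-- the twists -/
  tw : X → S →ₗ[ℝ] S
  leibniz : ∀ x a b, der x (a * b) = der x a * b + tw x a * der x b
  central : ∀ a, (∀ x, tw x a = a) → ∀ b, a * b = b * a

/-- The functions on a graded vector space with coordinates of ghost numbers `gh`, given by
generators, the exchange of generators, and the left derivatives. Working with these rules keeps
the tensor product that realises `SFun` out of the calculations. -/
structure SuperCalculus {X : Type*} [DecidableEq X] (gh : X → ℤ) (S : Type*) [Ring S]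
    [Algebra ℝ S] where
  /-- the coordinates -/
  co : X → S
  /-- the left derivatives -/
  der : X → S →ₗ[ℝ] S
  /-- the parity automorphism for odd `x`, the identity for even `x` -/
  tw : X → S →ₐ[ℝ] S
  co_mul_co : ∀ x y, co x * co y = koszul gh x y • (co y * co x)
  tw_co : ∀ x y, tw x (co y) = koszul gh x y • co y
  adjoin_co : Algebra.adjoin ℝ (Set.range co) = ⊤
  der_one : ∀ x, der x 1 = 0
  der_co_mul : ∀ x y f, der x (co y * f) = (if x = y then f else 0) +
    koszul gh x y • (co y * der x f)

namespace SuperCalculus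

variable {X : Type*} [DecidableEq X] {gh : X → ℤ} {S : Type*} [Ring S] [Algebra ℝ S]
  (c : SuperCalculus gh S)

/-- To prove a linear statement about functions it suffices to pass from `f` to `ω^x f`. -/
theorem induction_co {p : S → Prop} (one : p 1)
    (add : ∀ f g, p f → p g → p (f + g)) (smul : ∀ (r : ℝ) f, p f → p (r • f))
    (mul : ∀ x f, p f → p (c.co x * f)) (f : S) : p f := by
  let N : Submodule ℝ S :=
    { carrier := {f | p f}
      add_mem' := fun {a b} => add a b
      zero_mem' := by simpa using smul 0 1 one
      smul_mem' := fun c a => smul c a }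
  have key : ∀ a : S, ∀ b ∈ N, a * b ∈ N := by
    intro a
    have ha : a ∈ Algebra.adjoin ℝ (Set.range c.co) := by
      rw [c.adjoin_co]; exact Algebra.mem_top
    induction ha using Algebra.adjoin_induction with
    | mem a ha => obtain ⟨x, rfl⟩ := ha; exact fun b hb => mul x b hb
    | algebraMap r => intro b hb; rw [← Algebra.smul_def]; exact N.smul_mem _ hb
    | add a b _ _ ha hb => intro c hc; rw [add_mul]; exact N.add_mem (ha c hc) (hb c hc)
    | mul a b _ _ ha hb => intro c hc; rw [mul_assoc]; exact ha _ (hb c hc)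
  have := key f 1 one
  rw [mul_one] at this
  exact this

theorem linearMap_ext {M : Type*} [AddCommGroup M] [Module ℝ M]
    {A B : S →ₗ[ℝ] M} (one : A 1 = B 1)
    (mul : ∀ x f, A f = B f → A (c.co x * f) = B (c.co x * f)) : A = B := by
  refine LinearMap.ext fun f => ?_
  refine c.induction_co (p := fun f => A f = B f) one ?_ ?_ mul f
  · intro f g hf hg; simp [hf, hg]
  · intro c f hf; simp [hf]

theorem co_mul (x : X) (f : S) : c.co x * f = c.tw x f * c.co x := by
  refine c.induction_co (p := fun f => c.co x * f = c.tw x f * c.co x) ?_ ?_ ?_ ?_ f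
  · simp
  · intro f g hf hg; simp [mul_add, add_mul, hf, hg]
  · intro c f hf; simp [hf]
  · intro y f hf
    rw [← mul_assoc, co_mul_co, smul_mul_assoc, mul_assoc, hf, map_mul, tw_co,
      smul_mul_assoc, smul_mul_assoc, mul_assoc]

theorem commute_of_tw_eq {a : S} (ha : ∀ x, c.tw x a = a) (b : S) : a * b = b * a := by
  refine c.induction_co (p := fun b => a * b = b * a) ?_ ?_ ?_ ?_ b
  · simp
  · intro f g hf hg; simp [mul_add, add_mul, hf, hg]
  · intro c f hf; simp [hf]
  · intro y f hf
    have := c.co_mul y a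
    rw [ha] at this
    rw [← mul_assoc, ← this, mul_assoc, hf, mul_assoc]

theorem der_mul (x : X) (a b : S) : c.der x (a * b) = c.der x a * b + c.tw x a * c.der x b := by
  refine c.induction_co
    (p := fun a => c.der x (a * b) = c.der x a * b + c.tw x a * c.der x b) ?_ ?_ ?_ ?_ a
  · simp [c.der_one]
  · intro f g hf hg; simp [add_mul, hf, hg]; abel
  · intro c f hf; simp [hf]
  · intro y f hf
    rw [mul_assoc, der_co_mul, der_co_mul, hf, map_mul, tw_co]
    split_ifs <;> simp [mul_add, add_mul, mul_assoc, add_assoc]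

/-- The twisted derivations given by the left derivatives. -/
def toTwisted : TwistedDerivations X S where
  der := c.der
  tw x := (c.tw x).toLinearMap
  leibniz := c.der_mul
  central _ ha b := c.commute_of_tw_eq ha b

theorem der_co (x y : X) : c.der x (c.co y) = if x = y then 1 else 0 := by
  have := c.der_co_mul x y 1
  simpa [c.der_one] using this

theorem der_der (x y : X) (f : S) :
    c.der x (c.der y f) = koszul gh x y • c.der y (c.der x f) := by
  have : c.der x ∘ₗ c.der y = koszul gh x y • (c.der y ∘ₗ c.der x) := by
    refine c.linearMap_ext (by simp [c.der_one]) fun z f hf => ?_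
    simp only [LinearMap.comp_apply, LinearMap.smul_apply] at hf ⊢
    rw [c.der_co_mul y, c.der_co_mul x, map_add, map_add, map_smul, map_smul, c.der_co_mul,
      c.der_co_mul, hf]
    have h1 : koszul gh x y • (c.der y) (if x = z then f else 0) =
        koszul gh y z • (if x = z then c.der y f else 0) := by
      by_cases h : x = z
      · subst h; simp [koszul_symm gh x y]
      · simp [h]
    have h2 : koszul gh x y • koszul gh x z • (if y = z then c.der x f else 0) =
        c.der x (if y = z then f else 0) := by
      by_cases h : y = z
      · subst h; simp [smul_smul, koszul_mul_self]
      · simp [h]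
    simp only [smul_add, h1, h2, mul_smul_comm, smul_smul]
    have h3 : koszul gh y z * (koszul gh x z * koszul gh x y) =
      koszul gh x y * (koszul gh x z * koszul gh y z) := by ring
    rw [h3]; abel
  exact LinearMap.congr_fun this f

theorem tw_der (x y : X) (f : S) : c.tw x (c.der y f) = koszul gh x y • c.der y (c.tw x f) := by
  have : (c.tw x).toLinearMap ∘ₗ c.der y = koszul gh x y • (c.der y ∘ₗ (c.tw x).toLinearMap) := by
    refine c.linearMap_ext (by simp [c.der_one]) fun z f hf => ?_
    simp only [LinearMap.comp_apply, LinearMap.smul_apply, AlgHom.toLinearMap_apply] at hf ⊢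
    rw [c.der_co_mul, map_add, map_smul, map_mul, map_mul, hf, c.tw_co, smul_mul_assoc,
      smul_mul_assoc, LinearMap.map_smul, c.der_co_mul]
    by_cases h : y = z
    · subst h
      simp only [if_true, smul_add, smul_smul, koszul_mul_self, one_smul,
        mul_smul_comm]
      congr 2; linear_combination -(koszul gh y y) * koszul_mul_self gh x y
    · simp only [if_neg h, map_zero, zero_add, smul_smul, mul_smul_comm]
      congr 1; ring
  exact LinearMap.congr_fun this f

end SuperCalculus

section SFunCalculus

variable {X : Type*} (gh : X → ℤ)

/-- The parity automorphism of the algebra of functions: `-1` on odd coordinates. -/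
def parity : SFun gh →ₐ[ℝ] SFun gh :=
  Algebra.TensorProduct.map (AlgHom.id ℝ _) CliffordAlgebra.involute

/-- The automorphism by which the derivative in the coordinate `x` is twisted: the identity
for even `x`, the parity automorphism for odd `x`. -/
def twist (x : X) : SFun gh →ₐ[ℝ] SFun gh :=
  if Even (gh x) then AlgHom.id ℝ _ else parity gh

theorem neg_one_smul_sfun (f : SFun gh) : (-1 : ℝ) • f = -f := neg_one_smul ℝ f

theorem leftDeriv_one (x : X) : leftDeriv gh x 1 = 0 := by
  unfold leftDeriv
  split_ifs with hx
  · rw [Algebra.TensorProduct.one_def, LinearMap.rTensor_tmul]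
    simp
  · rw [Algebra.TensorProduct.one_def, LinearMap.lTensor_tmul]
    erw [CliffordAlgebra.contractLeft_one]
    simp

theorem contractRight_eq_involute {V : Type*} [AddCommGroup V] [Module ℝ V]
    (d : Module.Dual ℝ V) (a : ExteriorAlgebra ℝ V) :
    CliffordAlgebra.contractRight a d =
      CliffordAlgebra.involute (CliffordAlgebra.contractLeft d a) := by
  have hl : ∀ (a : ExteriorAlgebra ℝ V) (m : V),
      CliffordAlgebra.contractLeft d (a * CliffordAlgebra.ι 0 m) =
        CliffordAlgebra.contractLeft d a * CliffordAlgebra.ι 0 m +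
          d m • CliffordAlgebra.involute a := by
    intro a m
    induction a using CliffordAlgebra.left_induction with
    | algebraMap r =>
      rw [CliffordAlgebra.contractLeft_algebraMap_mul, CliffordAlgebra.contractLeft_algebraMap,
        CliffordAlgebra.contractLeft_ι, AlgHom.commutes, zero_mul, zero_add, ← Algebra.commutes,
        ← Algebra.smul_def]
    | add x y hx hy =>
      rw [add_mul, map_add, hx, hy, map_add, map_add, add_mul, smul_add]; abel
    | ι_mul x m' hx =>
      rw [mul_assoc, CliffordAlgebra.contractLeft_ι_mul, hx, CliffordAlgebra.contractLeft_ι_mul,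
        map_mul, CliffordAlgebra.involute_ι, sub_mul, smul_mul_assoc, mul_add, ← mul_assoc,
        Algebra.mul_smul_comm, neg_mul, smul_neg]
      abel
  induction a using CliffordAlgebra.right_induction with
  | algebraMap r =>
    rw [CliffordAlgebra.contractRight_algebraMap, CliffordAlgebra.contractLeft_algebraMap, map_zero]
  | add x y hx hy => rw [map_add, LinearMap.add_apply, hx, hy, map_add, map_add]
  | mul_ι m x hx =>
    rw [CliffordAlgebra.contractRight_mul_ι, hx, hl, map_add, map_mul, map_smul,
      CliffordAlgebra.involute_involute, CliffordAlgebra.involute_ι, mul_neg]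
    abel

theorem rightDeriv_eq (x : X) (f : SFun gh) :
    rightDeriv gh x f = twist gh x (leftDeriv gh x f) := by
  unfold rightDeriv twist leftDeriv
  split_ifs with hx
  · rfl
  · refine TensorProduct.induction_on f (by simp only [map_zero]) ?_ ?_
    · intro p q
      rw [LinearMap.lTensor_tmul, LinearMap.lTensor_tmul, parity, Algebra.TensorProduct.map_tmul]
      congr 1
      exact contractRight_eq_involute _ q
    · intro a b ha hb
      rw [map_add, map_add, map_add, ha, hb]

variable [DecidableEq X]

theorem coord_of_even {x : X} (h : Even (gh x)) :
    coord gh x = MvPolynomial.X ⟨x, h⟩ ⊗ₜ[ℝ] 1 := dif_pos h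

theorem coord_of_odd {x : X} (h : ¬ Even (gh x)) :
    coord gh x = 1 ⊗ₜ[ℝ] ExteriorAlgebra.ι ℝ (Pi.single (⟨x, h⟩ : OddIdx gh) (1 : ℝ)) := dif_neg h

theorem coord_mul_coord (x y : X) :
    coord gh x * coord gh y = koszul gh x y • (coord gh y * coord gh x) := by
  unfold koszul
  by_cases hx : Even (gh x) <;> by_cases hy : Even (gh y) <;>
    simp only [hx, hy, coord_of_even, coord_of_odd, Algebra.TensorProduct.tmul_mul_tmul,
      one_mul, mul_one, or_true, true_or, if_true, one_smul, not_false_eq_true, or_self, if_false]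
  · rw [mul_comm]
  · have := ExteriorAlgebra.ι_add_mul_swap (R := ℝ)
      (Pi.single (⟨x, hx⟩ : OddIdx gh) (1 : ℝ) : OddIdx gh → ℝ)
      (Pi.single (⟨y, hy⟩ : OddIdx gh) (1 : ℝ))
    rw [eq_neg_of_add_eq_zero_left this, TensorProduct.tmul_neg, neg_one_smul_sfun]

theorem parity_coord (y : X) :
    parity gh (coord gh y) = (if Even (gh y) then (1 : ℝ) else -1) • coord gh y := by
  unfold parity
  by_cases hy : Even (gh y)
  · simp [hy, coord_of_even]
  · simp only [hy, coord_of_odd, not_false_eq_true, if_false]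
    rw [Algebra.TensorProduct.map_tmul]
    erw [CliffordAlgebra.involute_ι]
    rw [TensorProduct.tmul_neg, neg_one_smul_sfun, map_one]

theorem twist_coord (x y : X) : twist gh x (coord gh y) = koszul gh x y • coord gh y := by
  unfold twist koszul
  by_cases hx : Even (gh x)
  · simp [hx]
  · simp [hx, parity_coord]

theorem adjoin_coord [Fintype X] : Algebra.adjoin ℝ (Set.range (coord gh)) = ⊤ := by
  rw [eq_top_iff]
  rintro f -
  set S := Algebra.adjoin ℝ (Set.range (coord gh)) with hS
  have hmem : ∀ x, coord gh x ∈ S := fun x => Algebra.subset_adjoin ⟨x, rfl⟩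
  have hl : ∀ p : MvPolynomial (EvenIdx gh) ℝ, p ⊗ₜ[ℝ] (1 : ExteriorAlgebra ℝ (OddIdx gh → ℝ)) ∈ S := by
    intro p
    have : S.comap (Algebra.TensorProduct.includeLeft :
        MvPolynomial (EvenIdx gh) ℝ →ₐ[ℝ] SFun gh) = ⊤ := by
      rw [eq_top_iff, ← MvPolynomial.adjoin_range_X, Algebra.adjoin_le_iff]
      rintro _ ⟨x, rfl⟩
      have := hmem x.1
      rwa [coord_of_even gh x.2] at this
    exact (this ▸ Algebra.mem_top : p ∈ S.comap (Algebra.TensorProduct.includeLeft :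
        MvPolynomial (EvenIdx gh) ℝ →ₐ[ℝ] SFun gh))
  have hr : ∀ q : ExteriorAlgebra ℝ (OddIdx gh → ℝ), (1 : MvPolynomial (EvenIdx gh) ℝ) ⊗ₜ[ℝ] q ∈ S := by
    intro q
    have : S.comap (Algebra.TensorProduct.includeRight :
        ExteriorAlgebra ℝ (OddIdx gh → ℝ) →ₐ[ℝ] SFun gh) = ⊤ := by
      rw [eq_top_iff, ← CliffordAlgebra.adjoin_range_ι, Algebra.adjoin_le_iff]
      rintro _ ⟨v, rfl⟩
      have hv : v = ∑ x : OddIdx gh, v x • Pi.single x (1 : ℝ) := by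
        ext y; simp [Finset.sum_apply, Pi.single_apply]
      rw [SetLike.mem_coe, hv, map_sum]
      refine Subalgebra.sum_mem _ fun x _ => ?_
      rw [map_smul]
      refine Subalgebra.smul_mem _ ?_ _
      have := hmem x.1
      rwa [coord_of_odd gh x.2] at this
    exact (this ▸ Algebra.mem_top : q ∈ S.comap (Algebra.TensorProduct.includeRight :
        ExteriorAlgebra ℝ (OddIdx gh → ℝ) →ₐ[ℝ] SFun gh))
  refine TensorProduct.induction_on f S.zero_mem ?_ fun a b ha hb => S.add_mem ha hb
  intro p q
  have := S.mul_mem (hl p) (hr q)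
  rwa [Algebra.TensorProduct.tmul_mul_tmul, one_mul, mul_one] at this

theorem leftDeriv_coord_mul (x y : X) (f : SFun gh) :
    leftDeriv gh x (coord gh y * f) =
      (if x = y then f else 0) + koszul gh x y • (coord gh y * leftDeriv gh x f) := by
  refine TensorProduct.induction_on f (by simp) ?_ ?_
  · intro p q
    unfold leftDeriv koszul
    by_cases hx : Even (gh x) <;> by_cases hy : Even (gh y) <;>
      simp only [hx, hy, coord_of_even, coord_of_odd, Algebra.TensorProduct.tmul_mul_tmul,
        one_mul, or_true, true_or, if_true, one_smul, not_false_eq_true, or_self, if_false,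
        dif_pos, dif_neg, LinearMap.rTensor_tmul, LinearMap.lTensor_tmul]
    · simp only [Derivation.coeFn_coe, Derivation.leibniz,
        MvPolynomial.pderiv_X, smul_eq_mul, TensorProduct.add_tmul]
      by_cases h : x = y
      · subst h; simp [add_comm]
      · rw [Pi.single_eq_of_ne (by simpa [Subtype.ext_iff] using Ne.symm h)]; simp [h]
    · rw [if_neg (by rintro rfl; exact hy hx), zero_add]
    · rw [if_neg (by rintro rfl; exact hx hy), zero_add]
    · have key : (LinearMap.proj (⟨x, hx⟩ : OddIdx gh) : (OddIdx gh → ℝ) →ₗ[ℝ] ℝ)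
          (Pi.single (⟨y, hy⟩ : OddIdx gh) (1 : ℝ)) = if x = y then 1 else 0 := by
        by_cases h : x = y
        · subst h; simp
        · rw [if_neg h]
          exact Pi.single_eq_of_ne (by simpa [Subtype.ext_iff] using h) _
      erw [CliffordAlgebra.contractLeft_ι_mul]
      rw [key, neg_one_smul_sfun, ← sub_eq_add_neg]
      by_cases h : x = y
      · rw [if_pos h, if_pos h, one_smul]
        exact TensorProduct.tmul_sub p q _
      · rw [if_neg h, if_neg h, zero_smul]
        exact (TensorProduct.tmul_sub p 0 _).trans (by rw [TensorProduct.tmul_zero])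
  · intro a b ha hb
    rw [mul_add, map_add, ha, hb, map_add, mul_add, smul_add]
    split_ifs <;> abel

/-- Polynomial functions on a graded vector space obey the rules of the calculus. -/
def sfunCalculus [Fintype X] : SuperCalculus gh (SFun gh) where
  co := coord gh
  der := leftDeriv gh
  tw := twist gh
  co_mul_co := coord_mul_coord gh
  tw_co := twist_coord gh
  adjoin_co := adjoin_coord gh
  der_one := leftDeriv_one gh
  der_co_mul := leftDeriv_coord_mul gh

end SFunCalculus

/-! ### Homogeneous functions, second order operators and linear vector fields -/

/-- The sign `(-1)^{gh x}`. -/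
def ghSign {X : Type*} (gh : X → ℤ) (x : X) : ℝ := if Even (gh x) then 1 else -1

section Signs

variable {X : Type*} (gh : X → ℤ)

theorem ghSign_mul_of_even {x y : X} (h : Even (gh x + gh y)) : ghSign gh x * ghSign gh y = 1 := by
  unfold ghSign
  rw [Int.even_add] at h
  split_ifs <;> simp_all

theorem ghSign_mul_of_odd {x y : X} (h : Odd (gh x + gh y)) : ghSign gh x * ghSign gh y = -1 := by
  unfold ghSign
  rw [← Int.not_even_iff_odd, Int.even_add] at h
  split_ifs <;> simp_all

theorem koszul_mul_of_even (x : X) {y z : X} (h : Even (gh y + gh z)) :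
    koszul gh x y * koszul gh x z = 1 := by
  rw [Int.even_add] at h
  have : koszul gh x y = koszul gh x z := by simp only [koszul, h]
  rw [this, koszul_mul_self]

theorem koszul_mul_of_odd (x : X) {y z : X} (h : Odd (gh y + gh z)) :
    koszul gh x y * koszul gh x z = ghSign gh x := by
  rw [← Int.not_even_iff_odd, Int.even_add] at h
  unfold koszul ghSign
  by_cases hx : Even (gh x) <;> by_cases hy : Even (gh y) <;> by_cases hz : Even (gh z) <;>
    simp only [hx, hy, hz, not_true, iff_true, iff_false, true_or, or_true, or_self, if_true,
      if_false, not_false_eq_true] at h ⊢ <;> norm_num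

end Signs

namespace SuperCalculus

variable {X : Type*} [DecidableEq X] {gh : X → ℤ} {S : Type*} [Ring S] [Algebra ℝ S]
  (c : SuperCalculus gh S)

/-- Functions of polynomial degree `n` and ghost number `g`; the degree is an integer, so that
`hom n g` is zero for negative `n`. -/
def hom (n g : ℤ) : Submodule ℝ S :=
  Submodule.span ℝ {f | ∃ L : List X, (L.length : ℤ) = n ∧ (L.map gh).sum = g ∧
    f = (L.map c.co).prod}

theorem prod_mem_hom (L : List X) : (L.map c.co).prod ∈ c.hom L.length (L.map gh).sum :=
  Submodule.subset_span ⟨L, rfl, rfl, rfl⟩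

theorem one_mem_hom : (1 : S) ∈ c.hom 0 0 := c.prod_mem_hom []

theorem co_mem_hom (x : X) : c.co x ∈ c.hom 1 (gh x) := by
  simpa using c.prod_mem_hom [x]

theorem hom_eq_zero {n g : ℤ} (hn : n < 0) {f : S} (hf : f ∈ c.hom n g) : f = 0 := by
  have : c.hom n g = ⊥ := by
    rw [hom, Submodule.span_eq_bot]
    rintro _ ⟨L, hL, -⟩
    omega
  simpa [this] using hf

theorem mul_mem_hom {n g m k : ℤ} {a b : S} (ha : a ∈ c.hom n g) (hb : b ∈ c.hom m k) :
    a * b ∈ c.hom (n + m) (g + k) := by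
  unfold hom at ha hb
  induction ha using Submodule.span_induction with
  | mem a ha =>
    obtain ⟨L, rfl, rfl, rfl⟩ := ha
    induction hb using Submodule.span_induction with
    | mem b hb =>
      obtain ⟨L', rfl, rfl, rfl⟩ := hb
      simpa using c.prod_mem_hom (L ++ L')
    | zero => simp
    | add x y _ _ hx hy => rw [mul_add]; exact add_mem hx hy
    | smul r x _ hx => rw [mul_smul_comm]; exact Submodule.smul_mem _ _ hx
  | zero => simp
  | add x y _ _ hx hy => rw [add_mul]; exact add_mem hx hy
  | smul r x _ hx => rw [smul_mul_assoc]; exact Submodule.smul_mem _ _ hx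

theorem pow_mem_hom {n : ℤ} {a : S} (ha : a ∈ c.hom n 0) (k : ℕ) : a ^ k ∈ c.hom (k * n) 0 := by
  induction k with
  | zero => simpa using c.one_mem_hom
  | succ k ih =>
    rw [pow_succ]
    have := c.mul_mem_hom ih ha
    convert this using 2
    · push_cast; ring
    · simp

theorem der_mem_hom (x : X) {n g : ℤ} {f : S} (hf : f ∈ c.hom n g) :
    c.der x f ∈ c.hom (n - 1) (g - gh x) := by
  have key : ∀ L : List X, c.der x (L.map c.co).prod ∈
      c.hom ((L.length : ℤ) - 1) ((L.map gh).sum - gh x) := by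
    intro L
    induction L with
    | nil => simp [c.der_one]
    | cons y L ih =>
      rw [List.map_cons, List.map_cons, List.prod_cons, c.der_co_mul]
      refine add_mem ?_ (Submodule.smul_mem _ _ ?_)
      · split_ifs with h
        · subst h
          simpa using c.prod_mem_hom L
        · exact zero_mem _
      · have := c.mul_mem_hom (c.co_mem_hom y) ih
        convert this using 2
        · simp
        · simp; ring
  unfold hom at hf
  induction hf using Submodule.span_induction with
  | mem a ha => obtain ⟨L, rfl, rfl, rfl⟩ := ha; exact key L
  | zero => simp
  | add x y _ _ hx hy => rw [map_add]; exact add_mem hx hy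
  | smul r x _ hx => rw [map_smul]; exact Submodule.smul_mem _ _ hx

/-- A twist acts on functions of ghost number `g` by a sign, which is trivial for even `g`. -/
theorem tw_of_mem_hom (x : X) {n g : ℤ} (hg : Even g) {f : S} (hf : f ∈ c.hom n g) :
    c.tw x f = f := by
  have key : ∀ L : List X, c.tw x (L.map c.co).prod =
      (if Even (gh x) ∨ Even (L.map gh).sum then (1 : ℝ) else -1) • (L.map c.co).prod := by
    intro L
    induction L with
    | nil => simp
    | cons y L ih =>
      rw [List.map_cons, List.prod_cons, map_mul, ih, c.tw_co, List.map_cons, List.sum_cons,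
        smul_mul_assoc, mul_smul_comm, smul_smul]
      congr 1
      unfold koszul
      have := Int.even_add (m := gh y) (n := (L.map gh).sum)
      by_cases hx : Even (gh x) <;> by_cases hy : Even (gh y) <;>
        by_cases hz : Even (L.map gh).sum <;>
        simp only [hx, hy, hz, this, iff_true, iff_false, true_or, or_true, or_self, if_true,
          if_false, not_true] <;> norm_num
  unfold hom at hf
  induction hf using Submodule.span_induction with
  | mem a ha => obtain ⟨L, rfl, rfl, rfl⟩ := ha; rw [key]; simp [hg]
  | zero => simp
  | add x y _ _ hx hy => rw [map_add, hx, hy]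
  | smul r x _ hx => rw [map_smul, hx]

theorem twist_ghost_zero {n : ℤ} {f : S} (hf : f ∈ c.hom n 0) (x : X) : c.tw x f = f :=
  c.tw_of_mem_hom x Even.zero hf

variable [Fintype X]

/-- The second order operator `∑ B^{xy} ∂_x ∂_y`. -/
def sec (B : Matrix X X ℝ) : S →ₗ[ℝ] S := ∑ x, ∑ y, B x y • (c.der x ∘ₗ c.der y)

theorem sec_apply (B : Matrix X X ℝ) (f : S) :
    c.sec B f = ∑ x, ∑ y, B x y • c.der x (c.der y f) := by
  simp [sec, LinearMap.sum_apply]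

theorem sec_add (A B : Matrix X X ℝ) : c.sec (A + B) = c.sec A + c.sec B := by
  simp [sec, add_smul, Finset.sum_add_distrib]

theorem sec_smul (r : ℝ) (B : Matrix X X ℝ) : c.sec (r • B) = r • c.sec B := by
  simp [sec, Finset.smul_sum, smul_smul]

theorem sec_neg (B : Matrix X X ℝ) : c.sec (-B) = -c.sec B := by
  rw [← neg_one_smul ℝ B, sec_smul]; exact neg_one_smul ℝ (c.sec B)

theorem sec_mem_hom {B : Matrix X X ℝ} {s : ℤ} (hB : ∀ x y, B x y ≠ 0 → gh x + gh y = s)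
    {n g : ℤ} {f : S} (hf : f ∈ c.hom n g) : c.sec B f ∈ c.hom (n - 2) (g - s) := by
  rw [sec_apply]
  refine Submodule.sum_mem _ fun x _ => Submodule.sum_mem _ fun y _ => ?_
  by_cases h : B x y = 0
  · simp [h]
  · have := c.der_mem_hom x (c.der_mem_hom y hf)
    refine Submodule.smul_mem _ _ ?_
    convert this using 2
    · ring
    · rw [← hB x y h]; ring

theorem der_sec_of_even {B : Matrix X X ℝ} (hB : ∀ x y, B x y ≠ 0 → Even (gh x + gh y)) (z : X)
    (f : S) : c.der z (c.sec B f) = c.sec B (c.der z f) := by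
  simp only [sec_apply, map_sum, map_smul]
  refine Finset.sum_congr rfl fun x _ => Finset.sum_congr rfl fun y _ => ?_
  by_cases h : B x y = 0
  · simp [h]
  · rw [c.der_der z x, c.der_der z y, map_smul, smul_smul (koszul gh z x),
      koszul_mul_of_even gh z (hB x y h),
      one_smul]

theorem der_sec_of_odd {B : Matrix X X ℝ} (hB : ∀ x y, B x y ≠ 0 → Odd (gh x + gh y)) (z : X)
    (f : S) : c.der z (c.sec B f) = ghSign gh z • c.sec B (c.der z f) := by
  simp only [sec_apply, map_sum, map_smul, Finset.smul_sum]
  refine Finset.sum_congr rfl fun x _ => Finset.sum_congr rfl fun y _ => ?_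
  by_cases h : B x y = 0
  · simp [h]
  · rw [c.der_der z x, c.der_der z y, map_smul, smul_smul (koszul gh z x),
      koszul_mul_of_odd gh z (hB x y h), smul_comm]

theorem sec_comm_of_even {B : Matrix X X ℝ} (hB : ∀ x y, B x y ≠ 0 → Even (gh x + gh y))
    (A : Matrix X X ℝ) (f : S) : c.sec A (c.sec B f) = c.sec B (c.sec A f) := by
  rw [sec_apply c A, sec_apply c A]
  simp only [c.der_sec_of_even hB, map_sum, map_smul]

theorem sec_anticomm_of_odd {A B : Matrix X X ℝ} (hA : ∀ x y, A x y ≠ 0 → Odd (gh x + gh y))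
    (hB : ∀ x y, B x y ≠ 0 → Odd (gh x + gh y)) (f : S) :
    c.sec A (c.sec B f) = -c.sec B (c.sec A f) := by
  rw [sec_apply c A, sec_apply c A]
  simp only [c.der_sec_of_odd hB, map_sum, map_smul, ← Finset.sum_neg_distrib]
  refine Finset.sum_congr rfl fun x _ => Finset.sum_congr rfl fun y _ => ?_
  by_cases h : A x y = 0
  · simp [h]
  · rw [smul_smul (ghSign gh y), mul_comm, ghSign_mul_of_odd gh (hA x y h)]
    simp

/-- The linear vector field `∑ M_{zy} ω^z ∂_y`. -/
def linVec (M : Matrix X X ℝ) : S →ₗ[ℝ] S :=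
  ∑ z, ∑ y, M z y • (LinearMap.mulLeft ℝ (c.co z) ∘ₗ c.der y)

theorem linVec_apply (M : Matrix X X ℝ) (f : S) :
    c.linVec M f = ∑ z, ∑ y, M z y • (c.co z * c.der y f) := by
  simp [linVec, LinearMap.sum_apply]

theorem linVec_mul_of_even (M : Matrix X X ℝ) {a : S} (ha : ∀ x, c.tw x a = a) (b : S) :
    c.linVec M (a * b) = c.linVec M a * b + a * c.linVec M b := by
  simp only [linVec_apply, Finset.sum_mul, Finset.mul_sum, ← Finset.sum_add_distrib]
  refine Finset.sum_congr rfl fun x _ => Finset.sum_congr rfl fun y _ => ?_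
  rw [c.der_mul, ha, mul_add, smul_add, smul_mul_assoc, mul_smul_comm, mul_assoc, ← mul_assoc _ a,
    ← c.commute_of_tw_eq ha, mul_assoc]

theorem der_linVec {M : Matrix X X ℝ} (hM : ∀ z y, M z y ≠ 0 → Odd (gh z + gh y)) (x : X) (f : S) :
    c.der x (c.linVec M f) = ∑ y, M x y • c.der y f + ghSign gh x • c.linVec M (c.der x f) := by
  simp only [linVec_apply, map_sum, map_smul, c.der_co_mul, smul_add, Finset.sum_add_distrib]
  congr 1
  · rw [Finset.sum_eq_single x]
    · simp
    · intro z _ hz; simp [Ne.symm hz]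
    · simp
  · simp only [Finset.smul_sum]
    refine Finset.sum_congr rfl fun z _ => Finset.sum_congr rfl fun y _ => ?_
    by_cases h : M z y = 0
    · simp [h]
    · rw [c.der_der x y, mul_smul_comm, smul_smul (koszul gh x z), koszul_mul_of_odd gh x (hM z y h),
        smul_comm]

/-- The transformation of a bivector by a linear vector field. -/
theorem sec_linVec {M B : Matrix X X ℝ} (hM : ∀ z y, M z y ≠ 0 → Odd (gh z + gh y)) (ε : ℝ)
    (hB : ∀ x y, B x y ≠ 0 → ghSign gh x * ghSign gh y = ε) (f : S) :
    c.sec B (c.linVec M f) = ε • c.linVec M (c.sec B f) +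
      c.sec (B * M + M.transpose * B * Matrix.diagonal (ghSign gh)) f := by
  have h1 : c.sec B (c.linVec M f) = (∑ x, ∑ y, B x y • c.der x (∑ z, M y z • c.der z f)) +
      ((∑ x, ∑ y, B x y • ghSign gh y • ∑ z, M x z • c.der z (c.der y f)) +
      ∑ x, ∑ y, (B x y * (ghSign gh x * ghSign gh y)) • c.linVec M (c.der x (c.der y f))) := by
    rw [sec_apply]
    simp only [← Finset.sum_add_distrib]
    refine Finset.sum_congr rfl fun x _ => Finset.sum_congr rfl fun y _ => ?_
    rw [c.der_linVec hM, map_add, map_smul, c.der_linVec hM]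
    simp only [smul_add, smul_smul]
    congr 3
    ring
  have h2 : ∑ x, ∑ y, (B x y * (ghSign gh x * ghSign gh y)) • c.linVec M (c.der x (c.der y f)) =
      ε • c.linVec M (c.sec B f) := by
    simp only [sec_apply, map_sum, map_smul, Finset.smul_sum]
    refine Finset.sum_congr rfl fun x _ => Finset.sum_congr rfl fun y _ => ?_
    by_cases h : B x y = 0
    · simp [h]
    · rw [hB x y h, mul_comm, mul_smul]
  have h3 : (∑ x, ∑ y, B x y • c.der x (∑ z, M y z • c.der z f)) = c.sec (B * M) f := by
    simp only [sec_apply, map_sum, map_smul, Finset.smul_sum, Matrix.mul_apply, Finset.sum_smul,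
      smul_smul]
    exact Finset.sum_congr rfl fun x _ => Finset.sum_comm
  have h4 : (∑ x, ∑ y, B x y • ghSign gh y • ∑ z, M x z • c.der z (c.der y f)) =
      c.sec (M.transpose * B * Matrix.diagonal (ghSign gh)) f := by
    rw [sec_apply]
    simp only [Matrix.mul_diagonal]
    simp only [Finset.smul_sum, Matrix.mul_apply, Finset.sum_smul,
      smul_smul, Matrix.transpose_apply, Finset.sum_mul]
    rw [Finset.sum_comm]
    rw [Finset.sum_congr rfl fun y _ => Finset.sum_comm, Finset.sum_comm]
    refine Finset.sum_congr rfl fun x _ => Finset.sum_congr rfl fun y _ =>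
      Finset.sum_congr rfl fun z _ => ?_
    congr 1; ring
  rw [h1, h2, h3, h4, sec_add, LinearMap.add_apply]
  abel

section Pullback

variable {Y : Type*} [DecidableEq Y] [Fintype Y] {gh' : Y → ℤ} {S' : Type*} [Ring S'] [Algebra ℝ S']
  (c' : SuperCalculus gh' S') {J : Matrix X Y ℝ} {φ : S →ₐ[ℝ] S'}

/-- The chain rule for a linear map of degree `0`. -/
theorem der_pullback (hJ : ∀ x y, J x y ≠ 0 → gh x = gh' y)
    (hφ : ∀ x, φ (c.co x) = ∑ y, J x y • c'.co y) (p : Y) (f : S) :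
    c'.der p (φ f) = ∑ x, J x p • φ (c.der x f) := by
  have : c'.der p ∘ₗ φ.toLinearMap = ∑ x, J x p • (φ.toLinearMap ∘ₗ c.der x) := by
    refine c.linearMap_ext ?_ ?_
    · simp [LinearMap.sum_apply, c.der_one, c'.der_one]
    · intro z f hf
      simp only [LinearMap.sum_apply, LinearMap.smul_apply, LinearMap.comp_apply,
        AlgHom.toLinearMap_apply] at hf ⊢
      rw [map_mul, c'.der_mul, hf, hφ]
      simp only [c.der_co_mul, map_add, smul_add, Finset.sum_add_distrib, map_smul, map_mul, hφ]
      congr 1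
      · simp only [map_sum, map_smul, c'.der_co]
        simp [apply_ite φ]
      · simp only [map_sum, map_smul, c'.tw_co, Finset.mul_sum, Finset.sum_mul, Finset.smul_sum,
          smul_mul_assoc, mul_smul_comm, smul_smul]
        refine Finset.sum_congr rfl fun x _ => Finset.sum_congr rfl fun y _ => ?_
        by_cases h1 : J x p = 0
        · simp [h1]
        by_cases h2 : J z y = 0
        · simp [h2]
        · have : koszul gh x z = koszul gh' p y := by
            simp [koszul, hJ x p h1, hJ z y h2]
          rw [this]; congr 1; ring
  have h := LinearMap.congr_fun this f
  simpa [LinearMap.sum_apply] using h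

theorem sec_pullback (hJ : ∀ x y, J x y ≠ 0 → gh x = gh' y)
    (hφ : ∀ x, φ (c.co x) = ∑ y, J x y • c'.co y) (B : Matrix Y Y ℝ) (f : S) :
    c'.sec B (φ f) = φ (c.sec (J * B * J.transpose) f) := by
  simp only [sec_apply, c.der_pullback c' hJ hφ, map_sum, map_smul, Finset.smul_sum,
    Matrix.mul_apply, Finset.sum_mul, Finset.sum_smul, smul_smul, Matrix.transpose_apply]
  have e1 : ∀ (F : Y → Y → X → X → S'), (∑ p, ∑ q, ∑ x, ∑ y, F p q x y) =
      ∑ x, ∑ y, ∑ q, ∑ p, F p q y x := by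
    intro F
    calc (∑ p, ∑ q, ∑ x, ∑ y, F p q x y) = ∑ w : (Y × Y) × (X × X), F w.1.1 w.1.2 w.2.1 w.2.2 := by
          simp only [Fintype.sum_prod_type]
      _ = ∑ w : (X × X) × (Y × Y), F w.2.2 w.2.1 w.1.2 w.1.1 :=
          Fintype.sum_equiv ((Equiv.prodComm _ _).trans
            (Equiv.prodCongr (Equiv.prodComm _ _) (Equiv.prodComm _ _))) _ _ fun _ => rfl
      _ = _ := by simp only [Fintype.sum_prod_type]
  rw [e1]
  refine Finset.sum_congr rfl fun x _ => Finset.sum_congr rfl fun y _ =>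
      Finset.sum_congr rfl fun q _ => Finset.sum_congr rfl fun p _ => ?_
  congr 1; ring

theorem pullback_mem_hom (hJ : ∀ x y, J x y ≠ 0 → gh x = gh' y)
    (hφ : ∀ x, φ (c.co x) = ∑ y, J x y • c'.co y) {n g : ℤ} {f : S} (hf : f ∈ c.hom n g) :
    φ f ∈ c'.hom n g := by
  have h1 : ∀ x, φ (c.co x) ∈ c'.hom 1 (gh x) := by
    intro x
    rw [hφ]
    refine Submodule.sum_mem _ fun y _ => ?_
    by_cases h : J x y = 0
    · simp [h]
    · rw [hJ x y h]; exact Submodule.smul_mem _ _ (c'.co_mem_hom y)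
  have key : ∀ L : List X, φ (L.map c.co).prod ∈ c'.hom L.length (L.map gh).sum := by
    intro L
    induction L with
    | nil => simpa using c'.one_mem_hom
    | cons y L ih =>
      rw [List.map_cons, List.map_cons, List.prod_cons, map_mul]
      have := c'.mul_mem_hom (h1 y) ih
      convert this using 2
      · simp [add_comm]
      · simp
  unfold hom at hf
  induction hf using Submodule.span_induction with
  | mem a ha => obtain ⟨L, rfl, rfl, rfl⟩ := ha; exact key L
  | zero => simp
  | add x y _ _ hx hy => rw [map_add]; exact add_mem hx hy
  | smul r x _ hx => rw [map_smul]; exact Submodule.smul_mem _ _ hx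

end Pullback

end SuperCalculus

section Concrete

variable {X Y : Type*} [DecidableEq X] [Fintype X] [DecidableEq Y] [Fintype Y]

theorem secondOrder_eq (gh : X → ℤ) (B : Matrix X X ℝ) :
    secondOrder gh B = (sfunCalculus gh).sec B := rfl

theorem mem_homogeneous_iff (gh : X → ℤ) (n : ℕ) (g : ℤ) (f : SFun gh) :
    f ∈ homogeneous gh n g ↔ f ∈ (sfunCalculus gh).hom n g := by
  unfold homogeneous SuperCalculus.hom
  simp only [Nat.cast_inj]
  rfl

theorem pullback_coord (ghX : X → ℤ) (ghY : Y → ℤ) {J : Matrix X Y ℝ}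
    (hJ : ∀ x y, J x y ≠ 0 → ghX x = ghY y) (x : X) :
    pullback ghX ghY J (coord ghX x) = ∑ y, J x y • coord ghY y := by
  unfold pullback
  by_cases hx : Even (ghX x)
  · have h0 : ∀ y, y ∉ Finset.univ.filter (fun y => Even (ghY y)) → J x y • coord ghY y = 0 := by
      intro y hy
      have : J x y = 0 := by
        by_contra hc
        exact hy (by simpa [← hJ x y hc] using hx)
      rw [this, zero_smul]
    rw [← Finset.sum_subset (Finset.subset_univ _) fun y _ => h0 y,
      ← Finset.sum_subtype_eq_sum_filter, coord_of_even _ hx, Algebra.TensorProduct.map_tmul,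
      MvPolynomial.aeval_X, map_one, TensorProduct.sum_tmul]
    refine Finset.sum_congr (by simp) fun y _ => ?_
    rw [coord_of_even _ y.2]
    rfl
  · have h0 : ∀ y, y ∉ Finset.univ.filter (fun y => ¬ Even (ghY y)) → J x y • coord ghY y = 0 := by
      intro y hy
      have : J x y = 0 := by
        by_contra hc
        exact hy (by simpa [← hJ x y hc] using hx)
      rw [this, zero_smul]
    rw [← Finset.sum_subset (Finset.subset_univ _) fun y _ => h0 y,
      ← Finset.sum_subtype_eq_sum_filter, coord_of_odd _ hx, Algebra.TensorProduct.map_tmul,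
      map_one]
    erw [ExteriorAlgebra.map_apply_ι]
    have : (Matrix.vecMulLinear (Matrix.of fun (x : OddIdx ghX) (y : OddIdx ghY) => J x.1 y.1))
        (Pi.single (⟨x, hx⟩ : OddIdx ghX) (1 : ℝ)) =
        ∑ y : OddIdx ghY, J x y.1 • Pi.single y (1 : ℝ) := by
      ext y
      simp [Finset.sum_apply, Pi.single_apply]
    rw [this, map_sum, TensorProduct.tmul_sum]
    refine Finset.sum_congr (by simp) fun y _ => ?_
    rw [coord_of_odd _ y.2, map_smul, TensorProduct.tmul_smul]

end Concrete

/-! ### Logarithms of power series over a non-commutative ring -/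

section Log

variable {S : Type*} [Ring S]

theorem coeff_pow_eq_zero {y : PowerSeries S} (hy : PowerSeries.coeff 0 y = 0) {j k : ℕ}
    (h : k < j) : PowerSeries.coeff k (y ^ j) = 0 := by
  induction j generalizing k with
  | zero => omega
  | succ j ih =>
    rw [pow_succ, PowerSeries.coeff_mul]
    refine Finset.sum_eq_zero fun p hp => ?_
    rw [Finset.HasAntidiagonal.mem_antidiagonal] at hp
    by_cases h2 : p.2 = 0
    · rw [h2, hy, mul_zero]
    · rw [ih (by omega), zero_mul]

theorem eq_zero_of_mul_eq_zero {Z f : PowerSeries S} (hZ : PowerSeries.coeff 0 Z = 1)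
    (hf : f * Z = 0) : f = 0 := by
  ext n
  induction n using Nat.strong_induction_on with
  | _ n ih =>
    have := congrArg (PowerSeries.coeff n) hf
    rw [PowerSeries.coeff_mul, Finset.sum_eq_single (n, 0)] at this
    · simpa [hZ] using this
    · intro p hp hne
      rw [Finset.HasAntidiagonal.mem_antidiagonal] at hp
      have : p.2 ≠ 0 := by
        intro h0
        exact hne (Prod.ext (by simp; omega) h0)
      rw [ih p.1 (by omega)]
      simp
    · simp

theorem mul_right_cancel_series {Z f g : PowerSeries S} (hZ : PowerSeries.coeff 0 Z = 1)
    (h : f * Z = g * Z) : f = g :=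
  sub_eq_zero.1 (eq_zero_of_mul_eq_zero hZ (by rw [sub_mul, h, sub_self]))

theorem central_of_coeff {a : PowerSeries S} (h : ∀ n b, PowerSeries.coeff n a * b =
    b * PowerSeries.coeff n a) (b : PowerSeries S) : a * b = b * a := by
  ext n
  rw [PowerSeries.coeff_mul, PowerSeries.coeff_mul, ← Finset.Nat.sum_antidiagonal_swap]
  exact Finset.sum_congr rfl fun p _ => h _ _

variable [Algebra ℝ S]

theorem coeff_real_smul (r : ℝ) (n : ℕ) (f : PowerSeries S) :
    PowerSeries.coeff n (r • f) = r • PowerSeries.coeff n f := rfl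

/-- The partial sum of the logarithm series. -/
def logPartial (Z : PowerSeries S) (N : ℕ) : PowerSeries S :=
  ∑ j ∈ Finset.range N, ((-1 : ℝ) ^ j / ((j + 1 : ℕ) : ℝ)) • (Z - 1) ^ (j + 1)

theorem coeff_logSeries {Z : PowerSeries S} (hZ : PowerSeries.coeff 0 Z = 1) {k N : ℕ}
    (hk : k ≤ N) :
    PowerSeries.coeff k (logSeries Z) = PowerSeries.coeff k (logPartial Z N) := by
  have hy : PowerSeries.coeff 0 (Z - 1) = 0 := by
    rw [map_sub, hZ, PowerSeries.coeff_zero_one, sub_self]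
  have h1 : PowerSeries.coeff k (logSeries Z) = ∑ j ∈ Finset.range k,
      ((-1 : ℝ) ^ j / ((j + 1 : ℕ) : ℝ)) • PowerSeries.coeff k ((Z - 1) ^ (j + 1)) := by
    rw [logSeries, PowerSeries.coeff_mk]
    refine Finset.sum_nbij' (fun j => j - 1) (fun j => j + 1) ?_ ?_ ?_ ?_ ?_
    · intro j hj; simp at hj ⊢; omega
    · intro j hj; simp at hj ⊢; omega
    · intro j hj; simp at hj ⊢; omega
    · intro j hj; simp
    · intro j hj
      obtain ⟨i, rfl⟩ : ∃ i, j = i + 1 := ⟨j - 1, by simp at hj; omega⟩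
      simp [pow_succ]
  rw [h1, logPartial, map_sum]
  refine Finset.sum_subset (Finset.range_subset_range.2 hk) fun j _ hj => ?_
  rw [Finset.mem_range] at hj
  rw [coeff_pow_eq_zero hy (by omega), smul_zero]

theorem coeff_zero_logSeries (Z : PowerSeries S) : PowerSeries.coeff 0 (logSeries Z) = 0 := by
  simp [logSeries]

/-- A derivation `δ` obeys `δ (log Z) = Z⁻¹ δ Z` for central `Z`. The derivation property is only
required for products with `Z`, as it is all that twisted derivations have for even `Z`. -/
theorem derivation_logSeries_mul {Z : PowerSeries S} (hZ : PowerSeries.coeff 0 Z = 1)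
    (hc : ∀ b, Z * b = b * Z) (δ : PowerSeries S →ₗ[ℝ] PowerSeries S)
    (hδ : ∀ N f, (∀ k ≤ N, PowerSeries.coeff k f = 0) → ∀ k ≤ N, PowerSeries.coeff k (δ f) = 0)
    (hd : ∀ b, δ (Z * b) = δ Z * b + Z * δ b) : δ (logSeries Z) * Z = δ Z := by
  have h1 : δ 1 = 0 := by
    have h := hd 1
    rw [mul_one, mul_one, left_eq_add] at h
    have hu : ∀ f : PowerSeries S, Z * f = 0 → f = 0 := by
      intro f hf
      ext n
      induction n using Nat.strong_induction_on with
      | _ n ih =>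
        have := congrArg (PowerSeries.coeff n) hf
        rw [PowerSeries.coeff_mul, Finset.sum_eq_single (0, n)] at this
        · simpa [hZ] using this
        · intro p hp hne
          rw [Finset.HasAntidiagonal.mem_antidiagonal] at hp
          have : p.1 ≠ 0 := by
            intro h0
            exact hne (Prod.ext h0 (by simp; omega))
          rw [ih p.2 (by omega)]
          simp
        · simp
    exact hu _ h
  set y := Z - 1 with hy
  have hy0 : PowerSeries.coeff 0 y = 0 := by
    rw [hy, map_sub, hZ, PowerSeries.coeff_zero_one, sub_self]
  have hyd : ∀ b, δ (y * b) = δ Z * b + y * δ b := by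
    intro b
    rw [hy, sub_mul, map_sub, hd, one_mul, sub_mul, one_mul]; abel
  have hyc : ∀ b, y * b = b * y := by
    intro b
    rw [hy, sub_mul, mul_sub, hc, one_mul, mul_one]
  have hpow : ∀ j : ℕ, δ (y ^ (j + 1)) = ((j + 1 : ℕ) : ℝ) • (y ^ j * δ Z) := by
    intro j
    induction j with
    | zero =>
      rw [zero_add, pow_one, hy, map_sub, h1]; simp
    | succ j ih =>
      have hcp : δ Z * y ^ (j + 1) = y ^ (j + 1) * δ Z := by
        have : Commute y (δ Z) := hyc _
        exact ((this.pow_left _).eq).symm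
      rw [pow_succ' y (j + 1), hyd, ih, mul_smul_comm, ← mul_assoc, ← pow_succ', hcp,
        Nat.cast_succ (j + 1), add_smul, one_smul, add_comm]
  have hlog : ∀ N, δ (logPartial Z N) * Z = δ Z - (-y) ^ N * δ Z := by
    intro N
    have : δ (logPartial Z N) = (∑ i ∈ Finset.range N, (-y) ^ i) * δ Z := by
      rw [logPartial, map_sum, Finset.sum_mul]
      refine Finset.sum_congr rfl fun j _ => ?_
      rw [map_smul, ← hy, hpow, smul_smul, div_mul_cancel₀ _ (by positivity), ← smul_mul_assoc]
      congr 1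
      rcases Nat.even_or_odd j with h | h <;> simp [h.neg_one_pow, h.neg_pow]
    have hZy : Z = 1 - -y := by rw [hy]; abel
    have hg := geom_sum_mul_neg (-y) N
    rw [← hZy] at hg
    rw [this, mul_assoc, ← hc, ← mul_assoc, hg, sub_mul, one_mul]
  ext k
  have e1 : PowerSeries.coeff k (δ (logSeries Z) * Z) =
      PowerSeries.coeff k (δ (logPartial Z (k + 1)) * Z) := by
    rw [← sub_eq_zero, ← map_sub, ← sub_mul, ← map_sub, PowerSeries.coeff_mul]
    refine Finset.sum_eq_zero fun p hp => ?_
    rw [Finset.HasAntidiagonal.mem_antidiagonal] at hp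
    rw [hδ (k + 1) _ _ p.1 (by omega), zero_mul]
    intro i hi
    rw [map_sub, coeff_logSeries hZ hi, sub_self]
  rw [e1, hlog, map_sub, sub_eq_self, PowerSeries.coeff_mul]
  refine Finset.sum_eq_zero fun p hp => ?_
  rw [Finset.HasAntidiagonal.mem_antidiagonal] at hp
  rw [coeff_pow_eq_zero (by rw [map_neg, hy0, neg_zero]) (by omega), zero_mul]

theorem logSeries_map {S' : Type*} [Ring S'] [Algebra ℝ S'] (φ : S →+* S')
    (hφ : ∀ (r : ℝ) a, φ (r • a) = r • φ a) (Z : PowerSeries S) :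
    logSeries (PowerSeries.map φ Z) = PowerSeries.map φ (logSeries Z) := by
  ext k
  simp only [logSeries, PowerSeries.coeff_mk, PowerSeries.coeff_map, map_sum, hφ]
  refine Finset.sum_congr rfl fun j _ => ?_
  have : (PowerSeries.map φ Z - 1) ^ j = PowerSeries.map φ ((Z - 1) ^ j) := by
    rw [map_pow, map_sub, map_one]
  rw [this, PowerSeries.coeff_map]

/-- The logarithm respects a grading of the coefficients. -/
theorem coeff_logSeries_mem {N : ℕ → Submodule ℝ S} (one : (1 : S) ∈ N 0)
    (mul : ∀ i j a b, a ∈ N i → b ∈ N j → a * b ∈ N (i + j)) {Z : PowerSeries S}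
    (hZ : ∀ k, PowerSeries.coeff k Z ∈ N k) (k : ℕ) :
    PowerSeries.coeff k (logSeries Z) ∈ N k := by
  have hy : ∀ k, PowerSeries.coeff k (Z - 1) ∈ N k := by
    intro k
    rw [map_sub, PowerSeries.coeff_one]
    refine sub_mem (hZ k) ?_
    split_ifs with h
    · subst h; exact one
    · exact zero_mem _
  have hp : ∀ j k, PowerSeries.coeff k ((Z - 1) ^ j) ∈ N k := by
    intro j
    induction j with
    | zero =>
      intro k
      rw [pow_zero, PowerSeries.coeff_one]
      split_ifs with h
      · subst h; exact one
      · exact zero_mem _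
    | succ j ih =>
      intro k
      rw [pow_succ, PowerSeries.coeff_mul]
      refine Submodule.sum_mem _ fun p hp => ?_
      rw [← Finset.HasAntidiagonal.mem_antidiagonal.1 hp]
      exact mul _ _ _ _ (ih _) (hy _)
  rw [logSeries, PowerSeries.coeff_mk]
  exact Submodule.sum_mem _ fun j _ => Submodule.smul_mem _ _ (hp j k)

end Log

/-! ### Operators acting on the coefficients of power series -/

section Lift

variable {S S' : Type*} [Ring S] [Algebra ℝ S] [Ring S'] [Algebra ℝ S']

/-- A linear map acting on the coefficients of power series. -/
def liftPS (f : S →ₗ[ℝ] S') : PowerSeries S →ₗ[ℝ] PowerSeries S' where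
  toFun φ := PowerSeries.mk fun n => f (PowerSeries.coeff n φ)
  map_add' φ ψ := by ext n; simp
  map_smul' r φ := by ext n; simp

@[simp] theorem coeff_liftPS (f : S →ₗ[ℝ] S') (n : ℕ) (φ : PowerSeries S) :
    PowerSeries.coeff n (liftPS f φ) = f (PowerSeries.coeff n φ) := by
  simp [liftPS]

/-- The Euler operator `X d/dX` on power series. -/
def eulerPS : PowerSeries S →ₗ[ℝ] PowerSeries S where
  toFun φ := PowerSeries.mk fun n => (n : ℝ) • PowerSeries.coeff n φ
  map_add' φ ψ := by ext n; simp
  map_smul' r φ := by ext n; simp [smul_comm r]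

@[simp] theorem coeff_eulerPS (n : ℕ) (φ : PowerSeries S) :
    PowerSeries.coeff n (eulerPS φ) = (n : ℝ) • PowerSeries.coeff n φ := by
  simp [eulerPS]

theorem eulerPS_mul (a b : PowerSeries S) : eulerPS (a * b) = eulerPS a * b + a * eulerPS b := by
  ext n
  rw [coeff_eulerPS, map_add, PowerSeries.coeff_mul, PowerSeries.coeff_mul, PowerSeries.coeff_mul,
    Finset.smul_sum, ← Finset.sum_add_distrib]
  refine Finset.sum_congr rfl fun p hp => ?_
  rw [← Finset.HasAntidiagonal.mem_antidiagonal.1 hp, coeff_eulerPS, coeff_eulerPS, Nat.cast_add, add_smul,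
    smul_mul_assoc, mul_smul_comm]

theorem liftPS_mul (δ τ : S →ₗ[ℝ] S) (h : ∀ a b, δ (a * b) = δ a * b + τ a * δ b)
    (a b : PowerSeries S) : liftPS δ (a * b) = liftPS δ a * b + liftPS τ a * liftPS δ b := by
  ext n
  rw [coeff_liftPS, map_add, PowerSeries.coeff_mul, PowerSeries.coeff_mul, PowerSeries.coeff_mul,
    map_sum, ← Finset.sum_add_distrib]
  refine Finset.sum_congr rfl fun p hp => ?_
  rw [h, coeff_liftPS, coeff_liftPS, coeff_liftPS]

theorem liftPS_order (δ : S →ₗ[ℝ] S) (N : ℕ) (f : PowerSeries S)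
    (h : ∀ k ≤ N, PowerSeries.coeff k f = 0) (k : ℕ) (hk : k ≤ N) :
    PowerSeries.coeff k (liftPS δ f) = 0 := by
  rw [coeff_liftPS, h k hk, map_zero]

end Lift

namespace TwistedDerivations

variable {X S : Type*} [Ring S] [Algebra ℝ S] (T : TwistedDerivations X S)

/-- Twisted derivations acting on the coefficients of power series. -/
def powerSeries : TwistedDerivations X (PowerSeries S) where
  der x := liftPS (T.der x)
  tw x := liftPS (T.tw x)
  leibniz x a b := liftPS_mul _ _ (T.leibniz x) a b
  central a ha b := by
    refine central_of_coeff (fun n b => T.central _ (fun x => ?_) b) b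
    rw [← coeff_liftPS, ha]

/-- Logarithmic derivatives of a power series with even coefficients. -/
theorem der_logSeries_mul {Z : PowerSeries S} (hZ : PowerSeries.coeff 0 Z = 1)
    (he : ∀ x, T.powerSeries.tw x Z = Z) (x : X) :
    T.powerSeries.der x (logSeries Z) * Z = T.powerSeries.der x Z :=
  derivation_logSeries_mul hZ (T.powerSeries.central Z he) (T.powerSeries.der x)
    (fun N f h k hk => liftPS_order _ N f h k hk)
    fun b => by rw [T.powerSeries.leibniz, he]

variable [Fintype X]

/-- The second order operator `∑ B^{xy} ∂_x ∂_y`. -/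
def sec (B : Matrix X X ℝ) : S →ₗ[ℝ] S := ∑ x, ∑ y, B x y • (T.der x ∘ₗ T.der y)

theorem sec_apply (B : Matrix X X ℝ) (f : S) :
    T.sec B f = ∑ x, ∑ y, B x y • T.der x (T.der y f) := by
  simp [sec, LinearMap.sum_apply]

/-- The bilinear operator `∑ B^{xy} (∂_y f)^x (∂_x g)`, where `^x` is the twist. -/
def bil (B : Matrix X X ℝ) (f g : S) : S := ∑ x, ∑ y, B x y • (T.tw x (T.der y f) * T.der x g)

/-- The bilinear operator `∑ B^{xy} (∂_x f) (∂_y g)`. -/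
def bracket (B : Matrix X X ℝ) (f g : S) : S := ∑ x, ∑ y, B x y • (T.der x f * T.der y g)

/-- `∂_x` has the logarithmic derivative `∂_x w`; the second order operator then acts by
`Z⁻¹ ∂∂ Z = ∂∂ w + ∂w ∂w`. -/
theorem sec_of_der_eq {Z w : S} (h : ∀ x, T.der x w * Z = T.der x Z) (B : Matrix X X ℝ) :
    T.sec B Z = (T.sec B w + T.bil B w w) * Z := by
  simp only [sec_apply, bil, ← Finset.sum_add_distrib, Finset.sum_mul]
  refine Finset.sum_congr rfl fun x _ => Finset.sum_congr rfl fun y _ => ?_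
  rw [← h y, T.leibniz, ← h x, ← smul_add, smul_mul_assoc, add_mul, mul_assoc]

/-- The second order operator on a product: the defect is the bracket. -/
theorem sec_mul {B : Matrix X X ℝ} (hB : B.IsSymm) {Z b : S} (hZ : ∀ x, T.tw x Z = Z)
    (hZB : ∀ x y, B x y ≠ 0 → T.tw x (T.der y Z) = T.der y Z) :
    T.sec B (Z * b) = T.sec B Z * b + Z * T.sec B b + (2 : ℝ) • T.bracket B Z b := by
  have h1 : T.sec B (Z * b) = T.sec B Z * b + Z * T.sec B b + T.bracket B Z b +
      ∑ x, ∑ y, B x y • (T.der y Z * T.der x b) := by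
    simp only [sec_apply, bracket, Finset.sum_mul, Finset.mul_sum, ← Finset.sum_add_distrib]
    refine Finset.sum_congr rfl fun x _ => Finset.sum_congr rfl fun y _ => ?_
    by_cases h : B x y = 0
    · simp [h]
    · rw [T.leibniz, map_add, T.leibniz, T.leibniz, hZ, hZ, hZB x y h, smul_mul_assoc,
        mul_smul_comm, ← smul_add, ← smul_add, ← smul_add]
      congr 1; abel
  have h2 : ∑ x, ∑ y, B x y • (T.der y Z * T.der x b) = T.bracket B Z b := by
    rw [bracket, Finset.sum_comm]
    refine Finset.sum_congr rfl fun x _ => Finset.sum_congr rfl fun y _ => ?_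
    rw [hB.apply]
  rw [h1, h2, two_smul, add_assoc _ (T.bracket B Z b)]

@[simp] theorem coeff_powerSeries_sec (B : Matrix X X ℝ) (n : ℕ) (f : PowerSeries S) :
    PowerSeries.coeff n (T.powerSeries.sec B f) = T.sec B (PowerSeries.coeff n f) := by
  simp only [sec_apply, map_sum, coeff_real_smul]
  simp [powerSeries]

theorem coeff_powerSeries_bil (B : Matrix X X ℝ) (n : ℕ) (f g : PowerSeries S) :
    PowerSeries.coeff n (T.powerSeries.bil B f g) = ∑ p ∈ Finset.HasAntidiagonal.antidiagonal n,
      T.bil B (PowerSeries.coeff p.1 f) (PowerSeries.coeff p.2 g) := by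
  simp only [bil, map_sum, coeff_real_smul, PowerSeries.coeff_mul]
  simp only [powerSeries, coeff_liftPS, Finset.smul_sum]
  rw [Finset.sum_congr rfl fun x _ => Finset.sum_comm, Finset.sum_comm]

theorem coeff_powerSeries_bracket (B : Matrix X X ℝ) (n : ℕ) (f g : PowerSeries S) :
    PowerSeries.coeff n (T.powerSeries.bracket B f g) =
      ∑ p ∈ Finset.HasAntidiagonal.antidiagonal n,
        T.bracket B (PowerSeries.coeff p.1 f) (PowerSeries.coeff p.2 g) := by
  simp only [bracket, map_sum, coeff_real_smul, PowerSeries.coeff_mul]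
  simp only [powerSeries, coeff_liftPS, Finset.smul_sum]
  rw [Finset.sum_congr rfl fun x _ => Finset.sum_comm, Finset.sum_comm]

end TwistedDerivations

/-! ### Perturbation series and the connectedness of their logarithms -/

section Connected

/-- The series `∑ h^j μ^k P^j u^k / (j! k!)`, that is `exp (h P) exp (μ u)`; the outer variable is
`μ`, the inner one `h`. -/
def expSeries {S : Type*} [Ring S] [Algebra ℝ S] (P : S →ₗ[ℝ] S) (u : S) :
    PowerSeries (PowerSeries S) :=
  PowerSeries.mk fun k => PowerSeries.mk fun j =>
    (1 / ((j.factorial : ℝ) * (k.factorial : ℝ))) • (P ^ j) (u ^ k)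

theorem coeff_expSeries {S : Type*} [Ring S] [Algebra ℝ S] (P : S →ₗ[ℝ] S) (u : S) (k j : ℕ) :
    PowerSeries.coeff j (PowerSeries.coeff k (expSeries P u)) =
      (1 / ((j.factorial : ℝ) * (k.factorial : ℝ))) • (P ^ j) (u ^ k) := by
  simp [expSeries]

theorem expSeries_zero {S : Type*} [Ring S] [Algebra ℝ S] {P : S →ₗ[ℝ] S} (hP : P 1 = 0) (u : S) :
    PowerSeries.coeff 0 (expSeries P u) = 1 := by
  ext j
  rw [coeff_expSeries, PowerSeries.coeff_one]
  cases j with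
  | zero => simp
  | succ j => simp [pow_succ, hP]

/-- The variable `h`. -/
def hVar (S : Type*) [Ring S] : PowerSeries (PowerSeries S) := PowerSeries.C PowerSeries.X

theorem coeff_succ_hVar_mul {S : Type*} [Ring S] (f : PowerSeries (PowerSeries S)) (k j : ℕ) :
    PowerSeries.coeff (j + 1) (PowerSeries.coeff k (hVar S * f)) =
      PowerSeries.coeff j (PowerSeries.coeff k f) := by
  rw [hVar, PowerSeries.coeff_C_mul, PowerSeries.coeff_succ_X_mul]

theorem coeff_zero_hVar_mul {S : Type*} [Ring S] (f : PowerSeries (PowerSeries S)) (k : ℕ) :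
    PowerSeries.coeff 0 (PowerSeries.coeff k (hVar S * f)) = 0 := by
  rw [hVar, PowerSeries.coeff_C_mul, PowerSeries.coeff_zero_X_mul]

theorem euler_expSeries {S : Type*} [Ring S] [Algebra ℝ S] (P : S →ₗ[ℝ] S) (u : S) :
    liftPS eulerPS (expSeries P u) = hVar S * liftPS (liftPS P) (expSeries P u) := by
  ext k j
  cases j with
  | zero => rw [coeff_zero_hVar_mul]; simp
  | succ j =>
    rw [coeff_succ_hVar_mul, coeff_liftPS, coeff_eulerPS, coeff_liftPS, coeff_liftPS,
      coeff_expSeries, coeff_expSeries, map_smul, ← LinearMap.comp_apply, smul_smul, pow_succ',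
      Nat.factorial_succ]
    congr 1
    push_cast
    field_simp

/-- The logarithm of `exp (μ u)` is `μ u`. -/
theorem coeff_log_exp {S : Type*} [Ring S] [Algebra ℝ S] {u : S} (hu : ∀ b, u * b = b * u)
    {E : PowerSeries S} (hE : ∀ k, PowerSeries.coeff k E = (1 / (k.factorial : ℝ)) • u ^ k) {k : ℕ}
    (hk : 2 ≤ k) : PowerSeries.coeff k (logSeries E) = 0 := by
  have hE0 : PowerSeries.coeff 0 E = 1 := by simp [hE]
  have hpow : ∀ (n : ℕ) (b : S), u ^ n * b = b * u ^ n := fun n b =>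
    (show Commute u b from hu b).pow_left n
  have hEc : ∀ b, E * b = b * E := central_of_coeff fun n b => by
    rw [hE, smul_mul_assoc, hpow, mul_smul_comm]
  have h1 := derivation_logSeries_mul hE0 hEc eulerPS
    (fun N f h k hk => by rw [coeff_eulerPS, h k hk, smul_zero]) (fun b => eulerPS_mul E b)
  have h2 : eulerPS E = (PowerSeries.C u * PowerSeries.X) * E := by
    ext n
    cases n with
    | zero => simp [mul_assoc]
    | succ n =>
      rw [mul_assoc, PowerSeries.coeff_C_mul, PowerSeries.coeff_succ_X_mul, coeff_eulerPS, hE, hE,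
        smul_smul, mul_smul_comm, pow_succ', Nat.factorial_succ]
      congr 1
      push_cast
      field_simp
  have h3 := congrArg (PowerSeries.coeff k) (mul_right_cancel_series hE0 (h1.trans h2))
  rw [coeff_eulerPS, PowerSeries.coeff_C_mul, PowerSeries.coeff_X, if_neg (by omega), mul_zero]
    at h3
  exact (smul_eq_zero.1 h3).resolve_left (by positivity)

namespace TwistedDerivations

variable {X S : Type*} [Ring S] [Algebra ℝ S] (T : TwistedDerivations X S)

/-- A power series in `μ` and `h` is even if its coefficients are. -/
theorem tw_tw_of_coeff {f : PowerSeries (PowerSeries S)}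
    (h : ∀ k j x, T.tw x (PowerSeries.coeff j (PowerSeries.coeff k f)) =
      PowerSeries.coeff j (PowerSeries.coeff k f)) (x : X) :
    T.powerSeries.powerSeries.tw x f = f := by
  ext k j
  simp only [powerSeries, coeff_liftPS, h]

variable [Fintype X]

theorem coeff_coeff_sec (B : Matrix X X ℝ) (k j : ℕ) (f : PowerSeries (PowerSeries S)) :
    PowerSeries.coeff j (PowerSeries.coeff k (T.powerSeries.powerSeries.sec B f)) =
      T.sec B (PowerSeries.coeff j (PowerSeries.coeff k f)) := by
  rw [coeff_powerSeries_sec, coeff_powerSeries_sec]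

theorem coeff_coeff_bil (B : Matrix X X ℝ) (k j : ℕ) (f g : PowerSeries (PowerSeries S)) :
    PowerSeries.coeff j (PowerSeries.coeff k (T.powerSeries.powerSeries.bil B f g)) =
      ∑ p ∈ Finset.HasAntidiagonal.antidiagonal k, ∑ q ∈ Finset.HasAntidiagonal.antidiagonal j,
        T.bil B (PowerSeries.coeff q.1 (PowerSeries.coeff p.1 f))
          (PowerSeries.coeff q.2 (PowerSeries.coeff p.2 g)) := by
  rw [coeff_powerSeries_bil, map_sum]
  simp only [coeff_powerSeries_bil]

theorem coeff_coeff_bracket (B : Matrix X X ℝ) (k j : ℕ) (f g : PowerSeries (PowerSeries S)) :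
    PowerSeries.coeff j (PowerSeries.coeff k (T.powerSeries.powerSeries.bracket B f g)) =
      ∑ p ∈ Finset.HasAntidiagonal.antidiagonal k, ∑ q ∈ Finset.HasAntidiagonal.antidiagonal j,
        T.bracket B (PowerSeries.coeff q.1 (PowerSeries.coeff p.1 f))
          (PowerSeries.coeff q.2 (PowerSeries.coeff p.2 g)) := by
  rw [coeff_powerSeries_bracket, map_sum]
  simp only [coeff_powerSeries_bracket]

theorem sec_powerSeries (B : Matrix X X ℝ) :
    T.powerSeries.sec B = liftPS (T.sec B) := by
  ext f n
  rw [coeff_powerSeries_sec, coeff_liftPS]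

theorem bil_zero_left (B : Matrix X X ℝ) (g : S) : T.bil B 0 g = 0 := by simp [bil]

theorem bil_zero_right (B : Matrix X X ℝ) (f : S) : T.bil B f 0 = 0 := by simp [bil]

theorem bracket_zero_left (B : Matrix X X ℝ) (g : S) : T.bracket B 0 g = 0 := by simp [bracket]

theorem bracket_zero_right (B : Matrix X X ℝ) (f : S) : T.bracket B f 0 = 0 := by simp [bracket]

/-- The logarithm of `exp (h P) exp (μ u)` solves the flow equation `∂_h w = P w + (∂w)(∂w)`,
where `P` contracts two derivatives by a bivector. -/
theorem euler_log_expSeries {B : Matrix X X ℝ} {u : S} (h1 : T.sec B 1 = 0)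
    (he : ∀ k j x, T.tw x (PowerSeries.coeff j (PowerSeries.coeff k (expSeries (T.sec B) u))) =
      PowerSeries.coeff j (PowerSeries.coeff k (expSeries (T.sec B) u))) :
    liftPS eulerPS (logSeries (expSeries (T.sec B) u)) = hVar S *
      (T.powerSeries.powerSeries.sec B (logSeries (expSeries (T.sec B) u)) +
        T.powerSeries.powerSeries.bil B (logSeries (expSeries (T.sec B) u))
          (logSeries (expSeries (T.sec B) u))) := by
  set V := expSeries (T.sec B) u with hV
  have hV0 : PowerSeries.coeff 0 V = 1 := expSeries_zero h1 u
  have hVe := T.tw_tw_of_coeff he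
  have hVc := T.powerSeries.powerSeries.central V hVe
  have e1 := derivation_logSeries_mul hV0 hVc (liftPS eulerPS) (liftPS_order _)
    (fun b => by
      have := liftPS_mul (S := PowerSeries S) eulerPS LinearMap.id
        (fun a b => by rw [eulerPS_mul]; rfl) V b
      rw [this]
      congr 2
      ext n : 1
      simp)
  have e2 := T.powerSeries.powerSeries.sec_of_der_eq (fun x => T.powerSeries.der_logSeries_mul hV0
    hVe x) B
  refine mul_right_cancel_series hV0 (e1.trans ?_)
  rw [mul_assoc, ← e2, hV, euler_expSeries, sec_powerSeries, sec_powerSeries]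

/-- Connectedness: a diagram with `k` vertices that contributes to the logarithm has at least
`k - 1` edges. -/
theorem coeff_log_expSeries_eq_zero {B : Matrix X X ℝ} {u : S} (h1 : T.sec B 1 = 0)
    (he : ∀ k j x, T.tw x (PowerSeries.coeff j (PowerSeries.coeff k (expSeries (T.sec B) u))) =
      PowerSeries.coeff j (PowerSeries.coeff k (expSeries (T.sec B) u)))
    (hu : ∀ x, T.tw x u = u) {k j : ℕ} (hjk : j + 1 < k) :
    PowerSeries.coeff j (PowerSeries.coeff k (logSeries (expSeries (T.sec B) u))) = 0 := by
  have hflow := T.euler_log_expSeries h1 he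
  set V := expSeries (T.sec B) u with hV
  induction j using Nat.strong_induction_on generalizing k with
  | _ j ih =>
    cases j with
    | zero =>
      have := logSeries_map (PowerSeries.constantCoeff (R := S)) (fun r a => rfl) V
      have h2 := congrArg (PowerSeries.coeff k) this
      rw [PowerSeries.coeff_map] at h2
      rw [PowerSeries.coeff_zero_eq_constantCoeff_apply, ← h2]
      refine coeff_log_exp (T.central u hu) (fun n => ?_) (by omega)
      rw [PowerSeries.coeff_map, ← PowerSeries.coeff_zero_eq_constantCoeff_apply, hV,
        coeff_expSeries]
      simp
    | succ j =>
      have h2 := congrArg (fun f => PowerSeries.coeff (j + 1) (PowerSeries.coeff k f)) hflow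
      simp only [coeff_succ_hVar_mul, map_add, coeff_liftPS, coeff_eulerPS, coeff_coeff_sec,
        coeff_coeff_bil] at h2
      rw [ih j (by omega) (by omega), map_zero, zero_add, Finset.sum_eq_zero] at h2
      · exact (smul_eq_zero.1 h2).resolve_left (by positivity)
      · intro p hp
        refine Finset.sum_eq_zero fun q hq => ?_
        rw [Finset.HasAntidiagonal.mem_antidiagonal] at hp hq
        by_cases hc : q.1 + 1 < p.1
        · rw [ih q.1 (by omega) hc, bil_zero_left]
        · rw [ih q.2 (by omega) (by omega), bil_zero_right]

end TwistedDerivations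

namespace SuperCalculus

variable {X : Type*} [DecidableEq X] [Fintype X] {gh : X → ℤ} {S : Type*} [Ring S] [Algebra ℝ S]
  (c : SuperCalculus gh S)

theorem sec_one (B : Matrix X X ℝ) : c.sec B 1 = 0 := by
  simp [sec_apply, c.der_one]

theorem sec_pow_mem_hom {B : Matrix X X ℝ} (hB : ∀ x y, B x y ≠ 0 → gh x + gh y = 0)
    {n : ℤ} {f : S} (hf : f ∈ c.hom n 0) (j : ℕ) : (c.sec B ^ j) f ∈ c.hom (n - 2 * j) 0 := by
  induction j with
  | zero => simpa using hf
  | succ j ih =>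
    rw [pow_succ', Module.End.mul_apply]
    have := c.sec_mem_hom hB ih
    convert this using 2
    · push_cast; ring
    · simp

theorem coeff_expSeries_mem_hom {B : Matrix X X ℝ} (hB : ∀ x y, B x y ≠ 0 → gh x + gh y = 0)
    {u : S} (hu : u ∈ c.hom 3 0) (k j : ℕ) :
    PowerSeries.coeff j (PowerSeries.coeff k (expSeries (c.sec B) u)) ∈
      c.hom (3 * k - 2 * j) 0 := by
  rw [coeff_expSeries]
  refine Submodule.smul_mem _ _ ?_
  have := c.sec_pow_mem_hom hB (c.pow_mem_hom hu k) j
  convert this using 2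
  ring

/-- The logarithm of a series whose coefficients at `μ^k h^j` have degree `3 k - 2 j` and ghost
number `0` has the same property. -/
theorem coeff_log_mem_hom {Z : PowerSeries (PowerSeries S)}
    (hZ : ∀ k j : ℕ, PowerSeries.coeff j (PowerSeries.coeff k Z) ∈ c.hom (3 * k - 2 * j) 0) (k j : ℕ) :
    PowerSeries.coeff j (PowerSeries.coeff k (logSeries Z)) ∈ c.hom (3 * k - 2 * j) 0 := by
  let N : ℕ → Submodule ℝ (PowerSeries S) := fun k =>
    { carrier := {f | ∀ j : ℕ, PowerSeries.coeff j f ∈ c.hom (3 * k - 2 * j) 0}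
      add_mem' := fun {a b} ha hb j => by rw [map_add]; exact add_mem (ha j) (hb j)
      zero_mem' := fun j => by rw [map_zero]; exact zero_mem _
      smul_mem' := fun r a ha j => Submodule.smul_mem _ r (ha j) }
  refine coeff_logSeries_mem (N := N) ?_ ?_ (fun k => hZ k) k j
  · intro j
    rw [PowerSeries.coeff_one]
    split_ifs with h
    · subst h; simpa using c.one_mem_hom
    · exact zero_mem _
  · intro k l a b ha hb j
    rw [PowerSeries.coeff_mul]
    refine Submodule.sum_mem _ fun p hp => ?_
    have := c.mul_mem_hom (ha p.1) (hb p.2)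
    rw [Finset.HasAntidiagonal.mem_antidiagonal] at hp
    convert this using 2
    · rw [← hp]; push_cast; ring
    · simp

end SuperCalculus

end Connected

/-! ### Chain homotopies of a dg Frobenius algebra -/

namespace DGFrobenius

variable {C : Type*} [Ring C] [Algebra ℝ C] {𝒞 : ℕ → Submodule ℝ C} [GradedAlgebra 𝒞]
  {A : DGFrobenius 𝒞 3} {I : Type*} (e : HomBasis I 𝒞)

include e in
/-- As `i j` is even for `i + j = 3`, the pairing is symmetric in the ordinary sense. -/
theorem pair_comm (a b : C) : A.pair a b = A.pair b a := by
  have : A.pair = LinearMap.flip A.pair := by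
    refine e.basis.ext fun i => e.basis.ext fun j => ?_
    rw [LinearMap.flip_apply]
    by_cases h : e.deg i + e.deg j = 3
    · rw [A.pair_symm _ _ _ (e.mem i) _ (e.mem j), Even.neg_one_pow, one_mul]
      rw [Nat.even_mul]
      by_contra hc
      simp only [not_or, Nat.not_even_iff_odd] at hc
      exact absurd (hc.1.add_odd hc.2) (by rw [h]; decide)
    · rw [A.pair_degree _ _ _ (e.mem i) _ (e.mem j) h,
        A.pair_degree _ _ _ (e.mem j) _ (e.mem i) (by omega)]
  exact LinearMap.congr_fun (LinearMap.congr_fun this a) b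

include e in
theorem pair_d_of_cocycle {z : C} (hz : A.d z = 0) (b : C) : A.pair (A.d b) z = 0 := by
  have : LinearMap.flip A.pair z ∘ₗ A.d = 0 := by
    refine e.basis.ext fun i => ?_
    have := A.pair_d _ _ (e.mem i) z
    rw [hz, map_zero, mul_zero, add_zero] at this
    simpa using this
  exact LinearMap.congr_fun this b

variable {ι : A.Cohomology →ₗ[ℝ] C}

theorem IsEmbedding.d_apply (hι : A.IsEmbedding ι) (x : A.Cohomology) : A.d (ι x) = 0 := by
  obtain ⟨a, rfl⟩ := Submodule.mkQ_surjective _ x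
  obtain ⟨b, hb⟩ := hι.represents a
  have : A.d (ι (A.cls a)) = 0 := by
    rw [hb, map_add, A.d_d, add_zero]; exact a.2
  exact this

theorem IsEmbedding.injective (hι : A.IsEmbedding ι) : Function.Injective ι := by
  rw [← LinearMap.ker_eq_bot, LinearMap.ker_eq_bot']
  intro x hx
  obtain ⟨a, rfl⟩ := Submodule.mkQ_surjective _ x
  obtain ⟨b, hb⟩ := hι.represents a
  have h0 : (a : C) + A.d b = 0 := hb.symm.trans hx
  rw [Submodule.mkQ_apply, Submodule.Quotient.mk_eq_zero]
  change (a : C) ∈ LinearMap.range A.d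
  exact ⟨-b, by rw [map_neg]; exact (eq_neg_of_add_eq_zero_left h0).symm⟩

section Homotopy

variable {K : C →ₗ[ℝ] C}

include e in
theorem IsChainHomotopy.pair_K_embedding (hK : A.IsChainHomotopy ι K) (b : C) (x : A.Cohomology) :
    A.pair (K b) (ι x) = 0 := by
  have : LinearMap.flip A.pair (ι x) ∘ₗ K = 0 := by
    refine e.basis.ext fun i => ?_
    have := hK.symmetric _ _ (e.mem i) (ι x)
    rw [hK.comp_embedding, map_zero, mul_zero] at this
    simpa using this
  exact LinearMap.congr_fun this b

include e in
/-- The pairing is non-degenerate on the image of `ι`. -/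
theorem IsChainHomotopy.embedding_eq_zero (hι : A.IsEmbedding ι) (hK : A.IsChainHomotopy ι K)
    {x : A.Cohomology} (hx : ∀ y, A.pair (ι x) (ι y) = 0) : ι x = 0 := by
  obtain ⟨Q, hQ, hKd⟩ := hK.homotopy
  refine A.pair_nondegenerate.1 _ fun b => ?_
  obtain ⟨y, hy⟩ := (hQ b).1
  have hb : b = A.d (K b) + K (A.d b) + ι y := by rw [hKd, hy]; abel
  rw [pair_comm e, hb, map_add, map_add, LinearMap.add_apply, LinearMap.add_apply,
    pair_d_of_cocycle e (hι.d_apply x), hK.pair_K_embedding e, pair_comm e, hx]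
  simp

/-- The algebraic consequences of the conditions on a chain homotopy. -/
structure HomotopyIdentities (A : DGFrobenius 𝒞 3) (K Q : C →ₗ[ℝ] C) : Prop where
  homotopy : ∀ a, A.d (K a) + K (A.d a) = a - Q a
  proj_K : ∀ a, Q (K a) = 0
  proj_d : ∀ a, Q (A.d a) = 0
  K_proj : ∀ a, K (Q a) = 0
  d_proj : ∀ a, A.d (Q a) = 0

include e in
theorem IsChainHomotopy.identities (hι : A.IsEmbedding ι) (hK : A.IsChainHomotopy ι K)
    {Q : C →ₗ[ℝ] C} (hQ : A.IsOrthogonalProjection ι Q)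
    (hKd : ∀ a, A.d (K a) + K (A.d a) = a - Q a) : HomotopyIdentities A K Q := by
  have h0 : ∀ a, (∀ y, A.pair a (ι y) = 0) → Q a = 0 := by
    intro a ha
    obtain ⟨x, hx⟩ := (hQ a).1
    rw [← hx]
    refine hK.embedding_eq_zero e hι fun y => ?_
    rw [hx, (hQ a).2, ha]
  refine ⟨hKd, fun a => h0 _ fun y => hK.pair_K_embedding e a y,
    fun a => h0 _ fun y => pair_d_of_cocycle e (hι.d_apply y) a, fun a => ?_, fun a => ?_⟩
  · obtain ⟨x, hx⟩ := (hQ a).1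
    rw [← hx, hK.comp_embedding]
  · obtain ⟨x, hx⟩ := (hQ a).1
    rw [← hx, hι.d_apply]

namespace HomotopyIdentities

variable {Q : C →ₗ[ℝ] C} (hK : HomotopyIdentities A K Q)

include hK

theorem dK (a : C) : A.d (K a) = a - Q a - K (A.d a) := by
  rw [← hK.homotopy a]; abel

theorem dKdK (a : C) : A.d (K (A.d (K a))) = A.d (K a) := by
  rw [hK.dK (A.d (K a)), hK.proj_d, A.d_d, map_zero, sub_zero, sub_zero]

theorem KdKd (a : C) : K (A.d (K (A.d a))) = K (A.d a) := by
  rw [hK.dK (A.d a), hK.proj_d, A.d_d, map_zero, sub_zero, sub_zero]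

theorem square_zero (a : C) : K (A.d (K (K (A.d (K a))))) = 0 := by
  rw [hK.dK (K (A.d (K a))), hK.proj_K, hK.dKdK, sub_zero, sub_self, map_zero]

/-- The difference of the two homotopies is exact: `K - K d K = d K³ d = [d, K³ d]`. -/
theorem sub_eq (a : C) : A.d (K (K (K (A.d a)))) = K a - K (A.d (K a)) := by
  have h1 : K (A.d (K (K (A.d a)))) = 0 := by
    rw [hK.dK (K (A.d a)), hK.proj_K, hK.dK (A.d a), hK.proj_d, A.d_d]
    simp
  have h2 : K (K (A.d a)) = K a - K (A.d (K a)) := by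
    have : K (A.d (K a)) = K a - K (K (A.d a)) := by
      rw [hK.dK a, map_sub, map_sub, hK.K_proj, sub_zero]
    rw [this]; abel
  rw [hK.dK (K (K (A.d a))), hK.proj_K, h1, h2, sub_zero, sub_zero]

end HomotopyIdentities

theorem IsChainHomotopy.strict (hK : A.IsChainHomotopy ι K) {Q : C →ₗ[ℝ] C}
    (hQ : A.IsOrthogonalProjection ι Q) (hid : HomotopyIdentities A K Q) :
    A.IsChainHomotopy ι (K ∘ₗ A.d ∘ₗ K) where
  degree i a ha := hK.degree i _ (A.d_degree i _ (hK.degree i a ha))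
  degree_zero a ha := by simp [hK.degree_zero a ha]
  homotopy := ⟨Q, hQ, fun a => by
    simp only [LinearMap.comp_apply]
    rw [hid.dKdK, hid.KdKd, hid.homotopy]⟩
  symmetric i a ha b := by
    simp only [LinearMap.comp_apply]
    cases i with
    | zero =>
      have := hK.symmetric 0 a ha (A.d (K b))
      rw [hK.degree_zero a ha] at this ⊢
      simpa using this
    | succ i =>
      have h1 := hK.symmetric (i + 1) _ (A.d_degree i _ (hK.degree i a ha)) b
      have h2 := A.pair_d i _ (hK.degree i a ha) (K b)
      have h3 := hK.symmetric (i + 1) a ha (A.d (K b))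
      rw [h1, eq_neg_of_add_eq_zero_left h2, h3, pow_succ]
      rcases neg_one_pow_eq_or ℝ i with h | h <;> rw [h] <;> ring
  comp_embedding x := by simp [hK.comp_embedding x]

end Homotopy

end DGFrobenius

/-! ### Matrices of graded maps -/

section Matrices

/-- If the matrix `G` pairs degrees of sum `3`, then so does its inverse. -/
theorem inv_degree {I : Type*} [Fintype I] [DecidableEq I] {deg : I → ℕ} {G : Matrix I I ℝ}
    (hG : IsUnit G.det) (hdeg : ∀ i j, G i j ≠ 0 → deg i + deg j = 3) {i j : I}
    (h : G⁻¹ i j ≠ 0) : deg i + deg j = 3 := by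
  -- conjugation with `2 ^ deg` multiplies `G` by `8`, hence `G⁻¹` by `8` as well
  set D : Matrix I I ℝ := Matrix.diagonal fun i => (2 : ℝ) ^ deg i with hD
  set E : Matrix I I ℝ := Matrix.diagonal fun i => ((2 : ℝ) ^ deg i)⁻¹ with hE
  have hDE : D * E = 1 := by
    rw [hD, hE, Matrix.diagonal_mul_diagonal, ← Matrix.diagonal_one]
    congr 1; ext i; exact mul_inv_cancel₀ (by positivity)
  have hDG : D * G * D = (8 : ℝ) • G := by
    ext i j
    rw [hD, Matrix.mul_diagonal, Matrix.diagonal_mul, Matrix.smul_apply, smul_eq_mul]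
    by_cases h : G i j = 0
    · simp [h]
    · have h8 : (2 : ℝ) ^ deg i * 2 ^ deg j = 8 := by
        rw [← pow_add, hdeg i j h]; norm_num
      linear_combination G i j * h8
  have h1 : D * G = (8 : ℝ) • (G * E) := by
    rw [← Matrix.smul_mul, ← hDG, Matrix.mul_assoc, hDE, Matrix.mul_one]
  have h2 : D * G⁻¹ * D = (8 : ℝ) • G⁻¹ := by
    calc D * G⁻¹ * D = D * G⁻¹ * (D * G) * G⁻¹ := by
          rw [Matrix.mul_assoc _ (D * G), Matrix.mul_assoc D G, Matrix.mul_nonsing_inv _ hG,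
            Matrix.mul_one]
      _ = (8 : ℝ) • (D * (G⁻¹ * G) * E * G⁻¹) := by
          rw [h1]; simp only [Matrix.mul_smul, Matrix.smul_mul, Matrix.mul_assoc]
      _ = (8 : ℝ) • G⁻¹ := by
          rw [Matrix.nonsing_inv_mul _ hG, Matrix.mul_one, hDE, Matrix.one_mul]
  have h3 := congrFun (congrFun h2 i) j
  rw [hD, Matrix.mul_diagonal, Matrix.diagonal_mul, Matrix.smul_apply, smul_eq_mul,
    mul_right_comm, mul_left_inj' h, ← pow_add] at h3
  have h4 : (2 : ℝ) ^ (deg i + deg j) = 2 ^ 3 := by rw [h3]; norm_num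
  exact pow_right_injective₀ (by norm_num) (by norm_num) h4

variable {C : Type*} [Ring C] [Algebra ℝ C] {𝒞 : ℕ → Submodule ℝ C} [GradedAlgebra 𝒞]
  {A : DGFrobenius 𝒞 3} {I : Type*} [Fintype I] [DecidableEq I] (e : HomBasis I 𝒞)

omit [DecidableEq I] in
/-- The coordinates of a homogeneous vector vanish except for basis vectors of its degree. -/
theorem HomBasis.deg_of_repr_ne_zero {n : ℕ} {v : C} (hv : v ∈ 𝒞 n) {i : I}
    (h : e.basis.repr v i ≠ 0) : e.deg i = n := by
  by_contra hne
  have h1 : GradedRing.proj 𝒞 (e.deg i) v = 0 := by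
    rw [GradedRing.proj_apply, DirectSum.decompose_of_mem_ne 𝒞 hv (Ne.symm hne)]
  have h2 : GradedRing.proj 𝒞 (e.deg i) v =
      ∑ j, (if e.deg j = e.deg i then e.basis.repr v j else 0) • e.basis j := by
    conv_lhs => rw [← e.basis.sum_repr v, map_sum]
    refine Finset.sum_congr rfl fun j _ => ?_
    have hj : e.basis.repr v j • e.basis j ∈ 𝒞 (e.deg j) := Submodule.smul_mem _ _ (e.mem j)
    rw [GradedRing.proj_apply]
    split_ifs with hc
    · rw [← hc, DirectSum.decompose_of_mem_same 𝒞 hj]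
    · rw [DirectSum.decompose_of_mem_ne 𝒞 hj hc, zero_smul]
  have h3 := Fintype.linearIndependent_iff.1 e.basis.linearIndependent _ (h2.symm.trans h1) i
  rw [if_pos rfl] at h3
  exact h h3

section Propagators

variable {𝔤 : Type*} [LieRing 𝔤] [LieAlgebra ℝ 𝔤] {J P : Type*} [Fintype J] [DecidableEq J]
  [Fintype P] [DecidableEq P]

/-- The Gram matrix of a pairing. -/
def gram {V K : Type*} [AddCommGroup V] [Module ℝ V] (κ : LinearMap.BilinForm ℝ V) (v : K → V) :
    Matrix K K ℝ := Matrix.of fun i j => κ (v i) (v j)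

theorem apply_eq_sum_left {V : Type*} [AddCommGroup V] [Module ℝ V] (κ : LinearMap.BilinForm ℝ V)
    (b : Module.Basis I ℝ V) (v w : V) : κ v w = ∑ i, b.repr v i * κ (b i) w := by
  conv_lhs => rw [← b.sum_repr v]
  simp only [map_sum, LinearMap.sum_apply, map_smul, LinearMap.smul_apply, smul_eq_mul]

theorem apply_eq_sum_right {V W : Type*} [AddCommGroup V] [Module ℝ V] [AddCommGroup W]
    [Module ℝ W] (κ : LinearMap.BilinForm ℝ V) (b : Module.Basis I ℝ W) (f : W →ₗ[ℝ] V) (v : V)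
    (w : W) : κ v (f w) = ∑ i, κ v (f (b i)) * b.repr w i := by
  conv_lhs => rw [← b.sum_repr w]
  simp only [map_sum, map_smul, smul_eq_mul, mul_comm]

theorem isUnit_det_gram {V : Type*} [AddCommGroup V] [Module ℝ V] {κ : LinearMap.BilinForm ℝ V}
    (hκ : κ.Nondegenerate) (b : Module.Basis I ℝ V) : IsUnit (gram κ b).det := by
  have h : gram κ b = LinearMap.BilinForm.toMatrix b κ := by
    ext i j; rw [LinearMap.BilinForm.toMatrix_apply]; rfl
  rw [h]
  exact isUnit_iff_ne_zero.2 ((LinearMap.BilinForm.nondegenerate_toMatrix_iff b).2 hκ).det_ne_zero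

open scoped Kronecker in
theorem propagator_eq (κ : LinearMap.BilinForm ℝ 𝔤) (T : Module.Basis J ℝ 𝔤) (K : C →ₗ[ℝ] C) :
    propagator A κ e T K = (LinearMap.toMatrix e.basis e.basis K * (gram A.pair e.basis)⁻¹) ⊗ₖ
      (gram κ T)⁻¹ := rfl

theorem propagator_add (κ : LinearMap.BilinForm ℝ 𝔤) (T : Module.Basis J ℝ 𝔤) (K L : C →ₗ[ℝ] C) :
    propagator A κ e T (K + L) = propagator A κ e T K + propagator A κ e T L := by
  rw [propagator_eq, map_add, Matrix.add_mul, Matrix.add_kronecker]; rfl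

theorem propagator_smul (κ : LinearMap.BilinForm ℝ 𝔤) (T : Module.Basis J ℝ 𝔤) (r : ℝ)
    (K : C →ₗ[ℝ] C) :
    propagator A κ e T (r • K) = r • propagator A κ e T K := by
  rw [propagator_eq, map_smul, Matrix.smul_mul, Matrix.smul_kronecker]; rfl

theorem gram_degree {i j : I} (h : gram A.pair e.basis i j ≠ 0) : e.deg i + e.deg j = 3 := by
  by_contra hc
  exact h (A.pair_degree _ _ _ (e.mem i) _ (e.mem j) hc)

/-- The entries of the propagator of a map of degree `-s` have degrees of sum `3 - s`. -/
theorem propagator_ghost (κ : LinearMap.BilinForm ℝ 𝔤) (T : Module.Basis J ℝ 𝔤) {K : C →ₗ[ℝ] C}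
    {s : ℤ} (hK : ∀ i m, LinearMap.toMatrix e.basis e.basis K i m ≠ 0 →
      (e.deg i : ℤ) + s = e.deg m) {x y : I × J} (h : propagator A κ e T K x y ≠ 0) :
    ghost e J x + ghost e J y = s - 1 := by
  have h1 : (LinearMap.toMatrix e.basis e.basis K * (gram A.pair e.basis)⁻¹) x.1 y.1 ≠ 0 :=
    left_ne_zero_of_mul h
  rw [Matrix.mul_apply] at h1
  obtain ⟨m, -, hm⟩ := Finset.exists_ne_zero_of_sum_ne_zero h1
  have h2 := hK _ _ (left_ne_zero_of_mul hm)
  have h3 := inv_degree (isUnit_det_gram A.pair_nondegenerate e.basis)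
    (fun i j h => gram_degree e h) (right_ne_zero_of_mul hm)
  unfold ghost
  omega

/-- The linear vector field `ω ↦ d ω` on `𝔤 ⊗ C[1]`. -/
def diffMatrix (A : DGFrobenius 𝒞 3) (e : HomBasis I 𝒞) (J : Type*) [DecidableEq J] :
    Matrix (I × J) (I × J) ℝ :=
  Matrix.of fun x y => if x.2 = y.2 then
    (-1 : ℝ) ^ e.deg x.1 * LinearMap.toMatrix e.basis e.basis A.d y.1 x.1 else 0

theorem toMatrix_d_degree {i m : I} (h : LinearMap.toMatrix e.basis e.basis A.d i m ≠ 0) :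
    e.deg i = e.deg m + 1 := by
  rw [LinearMap.toMatrix_apply] at h
  exact e.deg_of_repr_ne_zero (A.d_degree _ _ (e.mem m)) h

theorem diffMatrix_odd {x y : I × J} (h : diffMatrix A e J x y ≠ 0) :
    Odd (ghost e J x + ghost e J y) := by
  unfold diffMatrix at h
  rw [Matrix.of_apply] at h
  split_ifs at h with hc
  · have := toMatrix_d_degree e (right_ne_zero_of_mul h)
    unfold ghost
    rw [this]
    exact ⟨-e.deg x.1, by push_cast; ring⟩
  · exact absurd rfl h

theorem ghSign_ghost (x : I × J) : ghSign (ghost e J) x = -(-1 : ℝ) ^ e.deg x.1 := by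
  unfold ghSign ghost
  have : Even (1 - (e.deg x.1 : ℤ)) ↔ ¬ Even (e.deg x.1) := by
    rw [Int.even_sub, Int.even_coe_nat]; simp
  rw [if_congr this rfl rfl]
  rcases Nat.even_or_odd (e.deg x.1) with h | h
  · simp [h, h.neg_one_pow]
  · rw [if_pos (Nat.not_even_iff_odd.2 h), h.neg_one_pow, neg_neg]

/-- The compatibility of the pairing with the differential, for the inverse Gram matrix. -/
theorem inv_gram_mul_transpose_d :
    (gram A.pair e.basis)⁻¹ * Matrix.diagonal (fun i => (-1 : ℝ) ^ e.deg i) *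
      (LinearMap.toMatrix e.basis e.basis A.d).transpose =
      -(LinearMap.toMatrix e.basis e.basis A.d * (gram A.pair e.basis)⁻¹) := by
  set G := gram A.pair e.basis with hG
  set D := LinearMap.toMatrix e.basis e.basis A.d with hD
  set N := Matrix.diagonal (fun i => (-1 : ℝ) ^ e.deg i) with hN
  have hu : IsUnit G.det := isUnit_det_gram A.pair_nondegenerate e.basis
  have hNN : N * N = 1 := by
    rw [hN, Matrix.diagonal_mul_diagonal, ← Matrix.diagonal_one]
    congr 1; ext i
    rw [← mul_pow]; simp
  have h1 : D.transpose * G + N * G * D = 0 := by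
    ext i j
    have h := A.pair_d _ _ (e.mem i) (e.basis j)
    have e1 : A.pair (A.d (e.basis i)) (e.basis j) = (D.transpose * G) i j := by
      rw [Matrix.mul_apply, apply_eq_sum_left A.pair e.basis]
      simp only [hD, hG, gram, Matrix.transpose_apply, Matrix.of_apply, LinearMap.toMatrix_apply]
    have e2 : A.pair (e.basis i) (A.d (e.basis j)) = (G * D) i j := by
      rw [Matrix.mul_apply]
      refine (apply_eq_sum_right A.pair e.basis LinearMap.id _ _).trans ?_
      simp only [hD, hG, gram, Matrix.of_apply, LinearMap.toMatrix_apply, LinearMap.id_apply]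
      rfl
    rw [e1, e2] at h
    rw [Matrix.add_apply, Matrix.mul_assoc N, hN, Matrix.diagonal_mul]
    exact h
  have h2 : D.transpose = -(N * G * D * G⁻¹) := by
    rw [← Matrix.neg_mul, ← eq_neg_of_add_eq_zero_left h1, Matrix.mul_assoc,
      Matrix.mul_nonsing_inv _ hu, Matrix.mul_one]
  rw [h2, Matrix.mul_neg]
  congr 1
  calc G⁻¹ * N * (N * G * D * G⁻¹) = G⁻¹ * (N * N) * G * D * G⁻¹ := by
        simp only [Matrix.mul_assoc]
    _ = D * G⁻¹ := by rw [hNN, Matrix.mul_one, Matrix.nonsing_inv_mul _ hu, Matrix.one_mul]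

open scoped Kronecker in
/-- The bivector of `K` transforms under the vector field of `d` into that of a commutator of `K`
and `d`. -/
theorem propagator_mul_diffMatrix (κ : LinearMap.BilinForm ℝ 𝔤) (T : Module.Basis J ℝ 𝔤)
    {K : C →ₗ[ℝ] C} {ε : ℝ} (hK : ∀ x y, propagator A κ e T K x y ≠ 0 →
      ghSign (ghost e J) x * ghSign (ghost e J) y = ε) :
    propagator A κ e T K * diffMatrix A e J + (diffMatrix A e J).transpose *
      propagator A κ e T K * Matrix.diagonal (ghSign (ghost e J)) =
      -propagator A κ e T (K ∘ₗ A.d + ε • (A.d ∘ₗ K)) := by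
  set G := gram A.pair e.basis with hG
  set D := LinearMap.toMatrix e.basis e.basis A.d with hD
  set N := Matrix.diagonal (fun i => (-1 : ℝ) ^ e.deg i) with hN
  have hM : diffMatrix A e J = (N * D.transpose) ⊗ₖ (1 : Matrix J J ℝ) := by
    ext x y
    rw [diffMatrix, Matrix.of_apply, Matrix.kroneckerMap_apply, hN, Matrix.diagonal_mul,
      Matrix.one_apply, Matrix.transpose_apply]
    split_ifs with hxy
    · rw [mul_one]
    · rw [mul_zero]
  have h1 : propagator A κ e T K * diffMatrix A e J = -propagator A κ e T (K ∘ₗ A.d) := by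
    rw [hM, propagator_eq, propagator_eq, ← Matrix.mul_kronecker_mul, Matrix.mul_one,
      Matrix.mul_assoc, ← Matrix.mul_assoc _ N, inv_gram_mul_transpose_d, Matrix.mul_neg,
      ← Matrix.mul_assoc, LinearMap.toMatrix_comp e.basis e.basis e.basis]
    ext x y
    simp [Matrix.kroneckerMap_apply]
  have h2 : (diffMatrix A e J).transpose * propagator A κ e T K *
      Matrix.diagonal (ghSign (ghost e J)) = -(ε • propagator A κ e T (A.d ∘ₗ K)) := by
    have h3 : Matrix.diagonal (fun x : I × J => (-1 : ℝ) ^ e.deg x.1) * propagator A κ e T K *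
        Matrix.diagonal (ghSign (ghost e J)) = -(ε • propagator A κ e T K) := by
      ext x y
      rw [Matrix.mul_diagonal, Matrix.diagonal_mul, Matrix.neg_apply, Matrix.smul_apply,
        smul_eq_mul]
      by_cases h : propagator A κ e T K x y = 0
      · simp [h]
      · have := hK x y h
        rw [ghSign_ghost e x] at this
        linear_combination -(propagator A κ e T K x y) * this
    have h4 : (diffMatrix A e J).transpose = D ⊗ₖ (1 : Matrix J J ℝ) *
        Matrix.diagonal (fun x : I × J => (-1 : ℝ) ^ e.deg x.1) := by
      ext x y
      rw [Matrix.transpose_apply, diffMatrix, Matrix.of_apply, Matrix.mul_diagonal,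
        Matrix.kroneckerMap_apply, Matrix.one_apply]
      by_cases h : y.2 = x.2
      · simp [h, mul_comm, hD]
      · simp [h, Ne.symm h]
    rw [h4, Matrix.mul_assoc, Matrix.mul_assoc, ← Matrix.mul_assoc (Matrix.diagonal _), h3,
      Matrix.mul_neg, Matrix.mul_smul, propagator_eq, propagator_eq, ← Matrix.mul_kronecker_mul,
      Matrix.one_mul, ← Matrix.mul_assoc, LinearMap.toMatrix_comp e.basis e.basis e.basis]
  rw [h1, h2, propagator_add, propagator_smul, neg_add]

section Cohomology

variable {ι : A.Cohomology →ₗ[ℝ] C} (h : HomBasis P A.cohomologyDeg)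

include e in
theorem isUnit_det_gram_cohomology {K : C →ₗ[ℝ] C} (hι : A.IsEmbedding ι)
    (hK : A.IsChainHomotopy ι K) : IsUnit (gram A.pair fun p => ι (h.basis p)).det := by
  rw [isUnit_iff_ne_zero]
  intro h0
  obtain ⟨v, hv, hGv⟩ := Matrix.exists_mulVec_eq_zero_iff.2 h0
  set x : A.Cohomology := ∑ p, v p • h.basis p with hx
  have h1 : ι x = 0 := by
    refine hK.embedding_eq_zero e hι fun y => ?_
    have h2 : A.pair.flip (ι x) ∘ₗ ι = 0 := by
      refine h.basis.ext fun p => ?_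
      have h3 := congrFun hGv p
      rw [Matrix.mulVec, dotProduct] at h3
      simp only [hx, map_sum, map_smul]
      simpa [gram, mul_comm] using h3
    rw [DGFrobenius.pair_comm e]
    exact LinearMap.congr_fun h2 y
  have h2 : x = 0 := hι.injective (by rw [h1, map_zero])
  have h3 := Fintype.linearIndependent_iff.1 h.basis.linearIndependent v h2
  exact hv (funext h3)

include e in
theorem cohomologyPoisson_ghost {K : C →ₗ[ℝ] C} (hι : A.IsEmbedding ι)
    (hK : A.IsChainHomotopy ι K) (κ : LinearMap.BilinForm ℝ 𝔤) (T : Module.Basis J ℝ 𝔤)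
    {x y : P × J} (hxy : cohomologyPoisson A κ T h ι x y ≠ 0) :
    ghost h J x + ghost h J y = -1 := by
  have h3 := inv_degree (deg := h.deg) (isUnit_det_gram_cohomology e h hι hK)
    (fun p q hpq => by
      by_contra hc
      exact hpq (A.pair_degree _ _ _ (hι.degree _ _ (h.mem p)) _ (hι.degree _ _ (h.mem q)) hc))
    (left_ne_zero_of_mul hxy)
  unfold ghost
  omega

include e in
theorem cohomologyPoisson_symm (κ : LinearMap.BilinForm ℝ 𝔤) (hκ : κ.IsSymm)
    (T : Module.Basis J ℝ 𝔤) : (cohomologyPoisson A κ T h ι).IsSymm := by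
  have h1 : (gram A.pair fun p => ι (h.basis p))⁻¹.transpose =
      (gram A.pair fun p => ι (h.basis p))⁻¹ := by
    rw [Matrix.transpose_nonsing_inv]
    congr 1
    ext p q
    exact DGFrobenius.pair_comm e _ _
  have h2 : (gram κ T)⁻¹.transpose = (gram κ T)⁻¹ := by
    rw [Matrix.transpose_nonsing_inv]
    congr 1
    ext p q
    exact hκ.eq _ _
  refine Matrix.ext fun x y => ?_
  exact congrArg₂ (· * ·) (congrFun (congrFun h1 x.1) y.1) (congrFun (congrFun h2 x.2) y.2)

open scoped Kronecker in
/-- The push-forward of the bivector of the cohomology under `ι` is that of the projection. -/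
theorem embedding_cohomologyPoisson {K Q : C →ₗ[ℝ] C} (hι : A.IsEmbedding ι)
    (hK : A.IsChainHomotopy ι K) (hQ : A.IsOrthogonalProjection ι Q)
    (κ : LinearMap.BilinForm ℝ 𝔤) (T : Module.Basis J ℝ 𝔤) {R : Matrix (I × J) (P × J) ℝ}
    (hR : R = Matrix.of fun x y =>
      if x.2 = y.2 then e.basis.repr (ι (h.basis y.1)) x.1 else 0) :
    R * cohomologyPoisson A κ T h ι * R.transpose = propagator A κ e T Q := by
  set G := gram A.pair e.basis with hG
  set G' := gram A.pair (fun p => ι (h.basis p)) with hG'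
  set L := LinearMap.toMatrix h.basis e.basis ι with hL
  have hu : IsUnit G.det := isUnit_det_gram A.pair_nondegenerate e.basis
  have hu' : IsUnit G'.det := isUnit_det_gram_cohomology e h hι hK
  have hRL : R = L ⊗ₖ (1 : Matrix J J ℝ) := by
    ext x y
    rw [hR, Matrix.of_apply, Matrix.kroneckerMap_apply, Matrix.one_apply, hL,
      LinearMap.toMatrix_apply]
    split_ifs <;> simp
  choose s hs using fun a => (hQ a).1
  set Z : Matrix P I ℝ := Matrix.of fun p i => h.basis.repr (s (e.basis i)) p with hZ
  have hQm : LinearMap.toMatrix e.basis e.basis Q = L * Z := by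
    ext i j
    rw [LinearMap.toMatrix_apply, ← hs, Matrix.mul_apply]
    conv_lhs => rw [← h.basis.sum_repr (s (e.basis j))]
    rw [map_sum, map_sum, Finsupp.finsetSum_apply]
    refine Finset.sum_congr rfl fun p _ => ?_
    rw [map_smul, map_smul, Finsupp.smul_apply, hL, LinearMap.toMatrix_apply, hZ, Matrix.of_apply,
      smul_eq_mul, mul_comm]
  have hLQ : G' * Z = L.transpose * G := by
    ext p j
    have h1 : A.pair (ι (h.basis p)) (Q (e.basis j)) = A.pair (ι (h.basis p)) (e.basis j) := by
      rw [DGFrobenius.pair_comm e, (hQ _).2, DGFrobenius.pair_comm e]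
    rw [← hs, apply_eq_sum_right A.pair h.basis, apply_eq_sum_left A.pair e.basis] at h1
    simp only [Matrix.mul_apply, hG', gram, hZ, hL, hG, Matrix.of_apply, Matrix.transpose_apply,
      LinearMap.toMatrix_apply]
    exact h1
  have hZ' : Z = G'⁻¹ * L.transpose * G := by
    rw [Matrix.mul_assoc, ← hLQ, ← Matrix.mul_assoc, Matrix.nonsing_inv_mul _ hu', Matrix.one_mul]
  have hB : cohomologyPoisson A κ T h ι = G'⁻¹ ⊗ₖ (gram κ T)⁻¹ := rfl
  rw [hRL, propagator_eq, hQm, hB, ← Matrix.mul_kronecker_mul, Matrix.one_mul,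
    ← Matrix.kroneckerMap_transpose, Matrix.transpose_one, ← Matrix.mul_kronecker_mul,
    Matrix.mul_one, hZ']
  congr 1
  rw [Matrix.mul_assoc, Matrix.mul_assoc, Matrix.mul_assoc, Matrix.mul_nonsing_inv _ hu,
    Matrix.mul_one]

end Cohomology

end Propagators

end Matrices

/-! ### The cubic term of the Chern-Simons action -/

theorem sum_eq_zero_of_cyclic {X S : Type*} [Fintype X] [AddCommGroup S] [Module ℝ S]
    (f : X → X → X → S) (h : ∀ x y z, f x y z + f y z x + f z x y = 0) :
    ∑ x, ∑ y, ∑ z, f x y z = 0 := by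
  have h1 : ∑ x, ∑ y, ∑ z, f y z x = ∑ x, ∑ y, ∑ z, f x y z := by
    rw [Finset.sum_comm]
    exact Finset.sum_congr rfl fun y _ => Finset.sum_comm
  have h2 : ∑ x, ∑ y, ∑ z, f z x y = ∑ x, ∑ y, ∑ z, f x y z := by
    rw [Finset.sum_congr rfl fun x _ => Finset.sum_comm, Finset.sum_comm]
  have h3 : (3 : ℝ) • ∑ x, ∑ y, ∑ z, f x y z = 0 := by
    have : (3 : ℝ) • ∑ x, ∑ y, ∑ z, f x y z = ∑ x, ∑ y, ∑ z, f x y z +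
        ∑ x, ∑ y, ∑ z, f y z x + ∑ x, ∑ y, ∑ z, f z x y := by
      rw [h1, h2]; module
    rw [this]
    simp only [← Finset.sum_add_distrib, h, Finset.sum_const_zero]
  exact (smul_eq_zero.1 h3).resolve_left (by norm_num)

namespace SuperCalculus

variable {X : Type*} [DecidableEq X] [Fintype X] {gh : X → ℤ} {S : Type*} [Ring S] [Algebra ℝ S]
  (c : SuperCalculus gh S)

/-- The cubic function `⅙ ∑ t_{xyz} ω^x ω^y ω^z`. -/
def cubic (t : X → X → X → ℝ) : S :=
  (1 / 6 : ℝ) • ∑ x, ∑ y, ∑ z, t x y z • (c.co x * c.co y * c.co z)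

theorem cubic_mem_hom {t : X → X → X → ℝ} (ht : ∀ x y z, t x y z ≠ 0 → gh x + gh y + gh z = 0) :
    c.cubic t ∈ c.hom 3 0 := by
  refine Submodule.smul_mem _ _ (Submodule.sum_mem _ fun x _ => Submodule.sum_mem _ fun y _ =>
    Submodule.sum_mem _ fun z _ => ?_)
  by_cases h : t x y z = 0
  · rw [h, zero_smul]; exact Submodule.zero_mem _
  · have := c.mul_mem_hom (c.mul_mem_hom (c.co_mem_hom x) (c.co_mem_hom y)) (c.co_mem_hom z)
    rw [ht x y z h] at this
    exact Submodule.smul_mem _ _ this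

theorem der_cubic {t : X → X → X → ℝ} (h1 : ∀ x y z, t y x z = koszul gh x y * t x y z)
    (h2 : ∀ x y z, t x z y = koszul gh y z * t x y z) (x : X) :
    c.der x (c.cubic t) = (1 / 2 : ℝ) • ∑ a, ∑ b, t x a b • (c.co a * c.co b) := by
  have e1 : ∀ a b d, c.der x (c.co a * c.co b * c.co d) = (if x = a then c.co b * c.co d else 0) +
      (if x = b then koszul gh x a • (c.co a * c.co d) else 0) +
      (if x = d then (koszul gh x a * koszul gh x b) • (c.co a * c.co b) else 0) := by
    intro a b d
    rw [mul_assoc, c.der_co_mul, c.der_co_mul, c.der_co, mul_add, smul_add, mul_smul_comm,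
      smul_smul, ← add_assoc]
    congr 2
    · split_ifs <;> simp
    · split_ifs <;> simp
  have s1 : ∑ a, ∑ b, ∑ d, t a b d • (if x = a then c.co b * c.co d else 0) =
      ∑ a, ∑ b, t x a b • (c.co a * c.co b) := by
    rw [Finset.sum_eq_single x]
    · simp
    · intro a _ ha; simp [Ne.symm ha]
    · simp
  have s2 : ∑ a, ∑ b, ∑ d, t a b d • (if x = b then koszul gh x a • (c.co a * c.co d) else 0) =
      ∑ a, ∑ b, t x a b • (c.co a * c.co b) := by
    refine Finset.sum_congr rfl fun a _ => ?_
    rw [Finset.sum_eq_single x]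
    · refine Finset.sum_congr rfl fun d _ => ?_
      rw [if_pos rfl, smul_smul, h1 x a d]
      congr 1
      linear_combination t x a d * koszul_mul_self gh x a
    · intro b _ hb; simp [Ne.symm hb]
    · simp
  have s3 : ∑ a, ∑ b, ∑ d,
      t a b d • (if x = d then (koszul gh x a * koszul gh x b) • (c.co a * c.co b) else 0) =
      ∑ a, ∑ b, t x a b • (c.co a * c.co b) := by
    refine Finset.sum_congr rfl fun a _ => Finset.sum_congr rfl fun b _ => ?_
    rw [Finset.sum_eq_single x]
    · rw [if_pos rfl, smul_smul, h2 a x b, h1 x a b]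
      congr 1
      linear_combination t x a b * koszul_mul_self gh x a +
        t x a b * (koszul gh x a) ^ 2 * koszul_mul_self gh x b
    · intro d _ hd; simp [Ne.symm hd]
    · simp
  rw [cubic]
  simp only [map_smul, map_sum, e1, smul_add, Finset.sum_add_distrib]
  simp only [← smul_add]
  rw [s1, s2, s3]
  module

theorem sec_cubic {t : X → X → X → ℝ} (h1 : ∀ x y z, t y x z = koszul gh x y * t x y z)
    (h2 : ∀ x y z, t x z y = koszul gh y z * t x y z) {B : Matrix X X ℝ}
    (hB : ∀ z, ∑ x, ∑ y, B x y * t y x z = 0) : c.sec B (c.cubic t) = 0 := by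
  have h3 : ∀ x y, c.der x (c.der y (c.cubic t)) = ∑ a, t y x a • c.co a := by
    intro x y
    rw [c.der_cubic h1 h2]
    simp only [map_smul, map_sum, c.der_co_mul, c.der_co, smul_add, Finset.sum_add_distrib]
    have s1 : ∑ a, ∑ b, t y a b • (if x = a then c.co b else 0) = ∑ a, t y x a • c.co a := by
      rw [Finset.sum_eq_single x]
      · simp
      · intro a _ ha; simp [Ne.symm ha]
      · simp
    have s2 : ∑ a, ∑ b, t y a b • koszul gh x a • (c.co a * if x = b then 1 else 0) =
        ∑ a, t y x a • c.co a := by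
      refine Finset.sum_congr rfl fun a _ => ?_
      rw [Finset.sum_eq_single x]
      · rw [if_pos rfl, mul_one, smul_smul, h2 y x a]
        congr 1
        linear_combination t y x a * koszul_mul_self gh x a
      · intro b _ hb; simp [Ne.symm hb]
      · simp
    rw [s1, s2]; module
  rw [sec_apply]
  simp only [h3, Finset.smul_sum, smul_smul]
  rw [Finset.sum_congr rfl fun x _ => Finset.sum_comm, Finset.sum_comm]
  refine Finset.sum_eq_zero fun z _ => ?_
  simp only [← Finset.sum_smul, hB, zero_smul]

theorem bracket_cubic {t : X → X → X → ℝ} (h1 : ∀ x y z, t y x z = koszul gh x y * t x y z)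
    (h2 : ∀ x y z, t x z y = koszul gh y z * t x y z) (B : Matrix X X ℝ) :
    c.toTwisted.bracket B (c.cubic t) (c.cubic t) = (1 / 4 : ℝ) • ∑ a, ∑ b, ∑ d, ∑ f,
      (∑ x, ∑ y, B x y * t x a b * t y d f) • (c.co a * c.co b * (c.co d * c.co f)) := by
  have h : ∀ x y, B x y • (c.der x (c.cubic t) * c.der y (c.cubic t)) = (1 / 4 : ℝ) •
      ∑ a, ∑ b, ∑ d, ∑ f, (B x y * t x a b * t y d f) • (c.co a * c.co b * (c.co d * c.co f)) := by
    intro x y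
    rw [c.der_cubic h1 h2, c.der_cubic h1 h2, smul_mul_smul_comm, smul_smul]
    simp only [Finset.sum_mul]
    simp only [Finset.mul_sum, Finset.smul_sum, smul_mul_smul_comm, smul_smul]
    refine Finset.sum_congr rfl fun a _ => Finset.sum_congr rfl fun b _ =>
      Finset.sum_congr rfl fun d _ => Finset.sum_congr rfl fun f _ => ?_
    congr 1; ring
  refine (Finset.sum_congr rfl fun x _ => Finset.sum_congr rfl fun y _ => h x y).trans ?_
  simp only [← Finset.smul_sum, Finset.sum_smul]
  congr 1
  have comm : ∀ F : X → X → X → S, ∑ x, ∑ y, ∑ a, F x y a = ∑ a, ∑ x, ∑ y, F x y a := fun F => by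
    rw [Finset.sum_congr rfl fun x _ => Finset.sum_comm, Finset.sum_comm]
  rw [comm]
  refine Finset.sum_congr rfl fun a _ => ?_
  rw [comm]
  refine Finset.sum_congr rfl fun b _ => ?_
  rw [comm]
  refine Finset.sum_congr rfl fun d _ => ?_
  rw [comm]

theorem linVec_cubic {t : X → X → X → ℝ} (h1 : ∀ x y z, t y x z = koszul gh x y * t x y z)
    (h2 : ∀ x y z, t x z y = koszul gh y z * t x y z) (M : Matrix X X ℝ) :
    c.linVec M (c.cubic t) = (1 / 2 : ℝ) • ∑ z, ∑ a, ∑ b, (∑ y, M z y * t y a b) •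
      (c.co z * (c.co a * c.co b)) := by
  rw [linVec_apply, Finset.smul_sum]
  refine Finset.sum_congr rfl fun z _ => ?_
  simp only [c.der_cubic h1 h2, mul_smul_comm, smul_comm _ (1 / 2 : ℝ)]
  rw [← Finset.smul_sum]
  congr 1
  simp only [Finset.mul_sum, Finset.smul_sum, mul_smul_comm, smul_smul, Finset.sum_smul]
  rw [Finset.sum_comm]
  refine Finset.sum_congr rfl fun a _ => Finset.sum_comm

/-- Moving a coordinate past two others. -/
theorem co_rotate (x y z : X) : c.co y * c.co z * c.co x =
    (koszul gh x y * koszul gh x z) • (c.co x * c.co y * c.co z) := by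
  rw [mul_assoc, c.co_mul_co z x, mul_smul_comm, ← mul_assoc, c.co_mul_co y x, smul_mul_assoc,
    smul_smul, koszul_symm gh z x, koszul_symm gh y x, mul_comm (koszul gh x z)]

/-- If `½ ∑ B ∂_x u ∂_y u = 0` and `∑ B ∂_x ∂_y u = 0`, then `u` is a solution of the master
equation at every order, as expressed by its powers. -/
theorem sec_pow_eq_zero {B : Matrix X X ℝ} (hB : B.IsSymm)
    (hodd : ∀ x y, B x y ≠ 0 → Odd (gh x + gh y)) {u : S} (hu : ∀ x, c.tw x u = u)
    (h1 : c.sec B u = 0) (h2 : c.toTwisted.bracket B u u = 0) (k : ℕ) : c.sec B (u ^ k) = 0 := by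
  have hc := c.commute_of_tw_eq hu
  have h3 : ∀ k : ℕ, c.toTwisted.bracket B u (u ^ k) = 0 := by
    intro k
    induction k with
    | zero =>
      simp only [TwistedDerivations.bracket, pow_zero]
      refine Finset.sum_eq_zero fun x _ => Finset.sum_eq_zero fun y _ => ?_
      rw [show c.toTwisted.der y 1 = 0 from c.der_one y, mul_zero, smul_zero]
    | succ k ih =>
      have : c.toTwisted.bracket B u (u ^ (k + 1)) =
          c.toTwisted.bracket B u u * u ^ k + u * c.toTwisted.bracket B u (u ^ k) := by
        simp only [TwistedDerivations.bracket, Finset.sum_mul, Finset.mul_sum,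
          ← Finset.sum_add_distrib]
        refine Finset.sum_congr rfl fun x _ => Finset.sum_congr rfl fun y _ => ?_
        have hl : c.toTwisted.der y (u ^ (k + 1)) =
            c.toTwisted.der y u * u ^ k + u * c.toTwisted.der y (u ^ k) := by
          rw [pow_succ', c.toTwisted.leibniz]
          congr 2
          exact hu y
        rw [hl, mul_add, smul_add, ← mul_assoc, ← mul_assoc, smul_mul_assoc, ← hc, mul_assoc u,
          mul_smul_comm]
      rw [this, h2, ih, zero_mul, mul_zero, add_zero]
  induction k with
  | zero => rw [pow_zero, c.sec_one]
  | succ k ih =>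
    have h4 := c.toTwisted.sec_mul hB (Z := u) (b := u ^ k) hu (fun x y hxy => by
      change c.tw x (c.der y u) = c.der y u
      rw [c.tw_der, hu, koszul_eq_one gh (hodd x y hxy), one_smul])
    have h5 : c.toTwisted.sec B = c.sec B := rfl
    rw [h5, h1, ih, h3] at h4
    rw [pow_succ', h4]
    simp

theorem linVec_pow_eq_zero (M : Matrix X X ℝ) {u : S} (hu : ∀ x, c.tw x u = u)
    (h : c.linVec M u = 0) (k : ℕ) : c.linVec M (u ^ k) = 0 := by
  induction k with
  | zero => simp [linVec_apply, c.der_one]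
  | succ k ih => rw [pow_succ', c.linVec_mul_of_even M hu, h, ih, zero_mul, mul_zero, add_zero]

end SuperCalculus

theorem neg_one_pow_eq_of_even_add {m n : ℕ} (h : Even (m + n)) : (-1 : ℝ) ^ m = (-1) ^ n := by
  rw [Nat.even_add] at h
  by_cases hm : Even m
  · rw [hm.neg_one_pow, (h.1 hm).neg_one_pow]
  · rw [(Nat.not_even_iff_odd.1 hm).neg_one_pow,
      (Nat.not_even_iff_odd.1 (mt h.2 hm)).neg_one_pow]

section ChernSimons

variable {C : Type*} [Ring C] [Algebra ℝ C] {𝒞 : ℕ → Submodule ℝ C} [GradedAlgebra 𝒞]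
  {𝔤 : Type*} [LieRing 𝔤] [LieAlgebra ℝ 𝔤] {I J : Type*}

theorem koszul_ghost (e : HomBasis I 𝒞) (x y : I × J) : koszul (ghost e J) x y =
    (-1 : ℝ) ^ ((e.deg x.1 + 1) * (e.deg y.1 + 1)) := by
  have h : ∀ z : I × J, Even (ghost e J z) ↔ Even (e.deg z.1 + 1) := fun z => by
    unfold ghost
    rw [Int.even_sub, Int.even_coe_nat, Nat.even_add_one]; simp
  unfold koszul
  simp only [h, ← Nat.even_mul]
  split_ifs with hc
  · rw [hc.neg_one_pow]
  · rw [(Nat.not_even_iff_odd.1 hc).neg_one_pow]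

/-- The coefficients `(-1)^{|j|(|k|+1)} κ(T_a, [T_b, T_c]) π(e_i, e_j e_k)` of the cubic term. -/
def csTensor (A : DGFrobenius 𝒞 3) (κ : LinearMap.BilinForm ℝ 𝔤) (e : HomBasis I 𝒞)
    (T : Module.Basis J ℝ 𝔤) (x y z : I × J) : ℝ :=
  (-1 : ℝ) ^ (e.deg y.1 * (e.deg z.1 + 1)) * κ (T x.2) ⁅T y.2, T z.2⁆ *
      A.pair (e.basis x.1) (e.basis y.1 * e.basis z.1)

variable {A : DGFrobenius 𝒞 3} {κ : LinearMap.BilinForm ℝ 𝔤} (hκ : IsQuadratic κ)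
  (e : HomBasis I 𝒞) (T : Module.Basis J ℝ 𝔤)

theorem pair_mul_degree {i j k : I} (h : A.pair (e.basis i) (e.basis j * e.basis k) ≠ 0) :
    e.deg i + e.deg j + e.deg k = 3 := by
  by_contra hc
  exact h (A.pair_degree _ _ _ (e.mem i) _ (SetLike.mul_mem_graded (e.mem j) (e.mem k)) (by omega))

include hκ in
theorem IsQuadratic.lie_left (x y z : 𝔤) : κ x ⁅y, z⁆ = -κ y ⁅x, z⁆ := by
  rw [← hκ.invariant, ← hκ.invariant, ← lie_skew, map_neg, LinearMap.neg_apply]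

include hκ in
theorem IsQuadratic.lie_rotate (x y z : 𝔤) : κ x ⁅y, z⁆ = κ y ⁅z, x⁆ := by
  rw [hκ.lie_left, ← lie_skew z x, map_neg]

theorem csTensor_ghost {x y z : I × J} (h : csTensor A κ e T x y z ≠ 0) :
    ghost e J x + ghost e J y + ghost e J z = 0 := by
  have := pair_mul_degree e (right_ne_zero_of_mul h)
  unfold ghost
  omega

include hκ in
theorem csTensor_swap_left (x y z : I × J) :
    csTensor A κ e T y x z = koszul (ghost e J) x y * csTensor A κ e T x y z := by
  have h1 : A.pair (e.basis y.1) (e.basis x.1 * e.basis z.1) =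
      (-1) ^ (e.deg y.1 * e.deg x.1) * A.pair (e.basis x.1) (e.basis y.1 * e.basis z.1) := by
    rw [A.pair_cyclic, A.pair_cyclic, A.mul_comm_graded _ _ _ (e.mem y.1) _ (e.mem x.1), map_smul]
    rfl
  by_cases h0 : A.pair (e.basis x.1) (e.basis y.1 * e.basis z.1) = 0
  · simp [csTensor, h1, h0]
  have h2 := pair_mul_degree e h0
  have h3 : (-1 : ℝ) ^ (e.deg x.1 * (e.deg z.1 + 1) + 1 + e.deg y.1 * e.deg x.1) =
      (-1) ^ ((e.deg x.1 + 1) * (e.deg y.1 + 1) + e.deg y.1 * (e.deg z.1 + 1)) := by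
    refine neg_one_pow_eq_of_even_add ?_
    have : Even (e.deg x.1 + e.deg y.1 + e.deg z.1 + 1) := by rw [h2]; decide
    simp only [Nat.even_add, Nat.even_mul, Nat.even_add_one] at this ⊢
    tauto
  simp only [pow_add _ _ (e.deg y.1 * e.deg x.1),
    pow_succ _ (e.deg x.1 * _)] at h3
  rw [csTensor, csTensor, h1, hκ.lie_left (T y.2), koszul_ghost]
  linear_combination κ (T x.2) ⁅T y.2, T z.2⁆ *
    A.pair (e.basis x.1) (e.basis y.1 * e.basis z.1) * h3

theorem csTensor_swap_right (x y z : I × J) :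
    csTensor A κ e T x z y = koszul (ghost e J) y z * csTensor A κ e T x y z := by
  have h1 : A.pair (e.basis x.1) (e.basis z.1 * e.basis y.1) =
      (-1) ^ (e.deg z.1 * e.deg y.1) * A.pair (e.basis x.1) (e.basis y.1 * e.basis z.1) := by
    rw [A.mul_comm_graded _ _ _ (e.mem z.1) _ (e.mem y.1), map_smul]
    rfl
  have h3 : (-1 : ℝ) ^ (e.deg z.1 * (e.deg y.1 + 1) + 1 + e.deg z.1 * e.deg y.1) =
      (-1) ^ ((e.deg y.1 + 1) * (e.deg z.1 + 1) + e.deg y.1 * (e.deg z.1 + 1)) := by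
    refine neg_one_pow_eq_of_even_add ?_
    simp only [Nat.even_add, Nat.even_mul, Nat.even_add_one]
    tauto
  simp only [pow_add _ _ (e.deg y.1 * _), pow_add _ _ (e.deg z.1 * e.deg y.1),
    pow_succ _ (e.deg z.1 * _)] at h3
  rw [csTensor, csTensor, h1, ← lie_skew, map_neg, koszul_ghost]
  linear_combination κ (T x.2) ⁅T y.2, T z.2⁆ *
    A.pair (e.basis x.1) (e.basis y.1 * e.basis z.1) * h3

end ChernSimons

/-! ### The identities of the Chern-Simons cubic -/

section ChernSimonsIdentities

theorem inv_gram_transpose {V K : Type*} [AddCommGroup V] [Module ℝ V] [Fintype K] [DecidableEq K]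
    {κ : LinearMap.BilinForm ℝ V} (hκ : ∀ v w, κ v w = κ w v) (b : K → V) :
    (gram κ b)⁻¹.transpose = (gram κ b)⁻¹ := by
  rw [Matrix.transpose_nonsing_inv]
  congr 1
  ext i j
  exact hκ _ _

/-- Contraction with the inverse of a symmetric form. -/
theorem sum_inv_gram {V K : Type*} [AddCommGroup V] [Module ℝ V] [Fintype K] [DecidableEq K]
    {κ : LinearMap.BilinForm ℝ V} (hκ : ∀ v w, κ v w = κ w v) (hn : κ.Nondegenerate)
    (b : Module.Basis K ℝ V) (v w : V) :
    ∑ x, ∑ y, (gram κ b)⁻¹ x y * κ (b x) v * κ (b y) w = κ v w := by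
  have hu := isUnit_det_gram hn b
  have h1 : (fun x => κ (b x) v) = Matrix.mulVec (gram κ b) (b.repr v) := by
    ext x
    refine (apply_eq_sum_right κ b LinearMap.id _ _).trans ?_
    rfl
  have hT : (gram κ b).transpose = gram κ b := by
    ext i j
    exact hκ _ _
  have h2 : Matrix.vecMul (fun x => κ (b x) v) (gram κ b)⁻¹ = b.repr v := by
    rw [h1, ← Matrix.vecMul_transpose, Matrix.vecMul_vecMul, hT, Matrix.mul_nonsing_inv _ hu,
      Matrix.vecMul_one]
  rw [Finset.sum_comm, apply_eq_sum_left κ b v w]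
  refine Finset.sum_congr rfl fun y _ => ?_
  rw [← congrFun h2 y, Matrix.vecMul, dotProduct, Finset.sum_mul]
  exact Finset.sum_congr rfl fun x _ => by ring

theorem sum_eq_zero_of_antisymm {K : Type*} [Fintype K] {F : K → K → ℝ}
    (h : ∀ a b, F a b = -F b a) : ∑ a, ∑ b, F a b = 0 := by
  have : ∑ a, ∑ b, F a b = -∑ a, ∑ b, F a b := by
    conv_rhs => rw [Finset.sum_comm]
    simp only [← Finset.sum_neg_distrib]
    exact Finset.sum_congr rfl fun a _ => Finset.sum_congr rfl fun b _ => h a b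
  linarith

variable {C : Type*} [Ring C] [Algebra ℝ C] {𝒞 : ℕ → Submodule ℝ C} [GradedAlgebra 𝒞]
  {𝔤 : Type*} [LieRing 𝔤] [LieAlgebra ℝ 𝔤] {I J : Type*} [Fintype I] [DecidableEq I] [Fintype J]
  [DecidableEq J] {A : DGFrobenius 𝒞 3} {κ : LinearMap.BilinForm ℝ 𝔤} (hκ : IsQuadratic κ)
  (e : HomBasis I 𝒞) (T : Module.Basis J ℝ 𝔤)

theorem propagator_id_apply (x y : I × J) : propagator A κ e T LinearMap.id x y =
    (gram A.pair e.basis)⁻¹ x.1 y.1 * (gram κ T)⁻¹ x.2 y.2 := by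
  rw [propagator_eq, LinearMap.toMatrix_id, Matrix.one_mul]; rfl

include hκ in
theorem propagator_id_symm : (propagator A κ e T LinearMap.id).IsSymm := by
  refine Matrix.ext fun x y => ?_
  rw [Matrix.transpose_apply, propagator_id_apply, propagator_id_apply]
  exact congrArg₂ (· * ·)
    (congrFun (congrFun (inv_gram_transpose (DGFrobenius.pair_comm e) e.basis) x.1) y.1)
    (congrFun (congrFun (inv_gram_transpose hκ.symm.eq T) x.2) y.2)

theorem propagator_id_ghost {x y : I × J} (h : propagator A κ e T LinearMap.id x y ≠ 0) :
    ghost e J x + ghost e J y = -1 := by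
  refine propagator_ghost (s := 0) e κ T (fun i m him => ?_) h
  rw [LinearMap.toMatrix_id, Matrix.one_apply] at him
  have : i = m := by by_contra hc; exact him (if_neg hc)
  rw [this, add_zero]

include hκ in
/-- The structure constants of a quadratic Lie algebra are traceless. -/
theorem contract_csTensor (z : I × J) :
    ∑ x, ∑ y, propagator A κ e T LinearMap.id x y * csTensor A κ e T y x z = 0 := by
  simp only [Fintype.sum_prod_type, propagator_id_apply]
  refine Finset.sum_eq_zero fun i _ => ?_
  rw [Finset.sum_comm]
  refine Finset.sum_eq_zero fun j _ => sum_eq_zero_of_antisymm fun a b => ?_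
  have h1 : (gram κ T)⁻¹ a b = (gram κ T)⁻¹ b a :=
    congrFun (congrFun (inv_gram_transpose hκ.symm.eq T) b) a
  simp only [csTensor]
  rw [h1, hκ.lie_left (T b)]
  ring

include hκ in
theorem contract_csTensor_csTensor (a b d f : I × J) :
    ∑ x, ∑ y, propagator A κ e T LinearMap.id x y * csTensor A κ e T x a b *
      csTensor A κ e T y d f =
    (-1 : ℝ) ^ (e.deg a.1 * (e.deg b.1 + 1)) * (-1 : ℝ) ^ (e.deg d.1 * (e.deg f.1 + 1)) *
      κ ⁅T a.2, T b.2⁆ ⁅T d.2, T f.2⁆ *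
      A.pair (e.basis a.1 * e.basis b.1) (e.basis d.1 * e.basis f.1) := by
  rw [← sum_inv_gram hκ.symm.eq hκ.nondegenerate T ⁅T a.2, T b.2⁆,
    ← sum_inv_gram (DGFrobenius.pair_comm e) A.pair_nondegenerate e.basis (e.basis a.1 * _)]
  simp only [Fintype.sum_prod_type, propagator_id_apply, Finset.mul_sum, Finset.sum_mul]
  refine Finset.sum_congr rfl fun i _ => ?_
  rw [Finset.sum_comm]
  refine Finset.sum_congr rfl fun j _ => Finset.sum_congr rfl fun α _ =>
    Finset.sum_congr rfl fun β _ => ?_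
  simp only [csTensor]
  ring

theorem diffMatrix_mul_csTensor (z a b : I × J) :
    ∑ y, diffMatrix A e J z y * csTensor A κ e T y a b =
    (-1 : ℝ) ^ e.deg z.1 * (-1 : ℝ) ^ (e.deg a.1 * (e.deg b.1 + 1)) *
      κ (T z.2) ⁅T a.2, T b.2⁆ * A.pair (A.d (e.basis z.1)) (e.basis a.1 * e.basis b.1) := by
  rw [apply_eq_sum_left A.pair e.basis (A.d (e.basis z.1)), Fintype.sum_prod_type, Finset.mul_sum]
  refine Finset.sum_congr rfl fun i _ => ?_
  rw [Finset.sum_eq_single z.2]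
  · simp only [diffMatrix, csTensor, Matrix.of_apply, if_true, LinearMap.toMatrix_apply]
    ring
  · intro j _ hj
    simp [diffMatrix, Ne.symm hj]
  · simp

variable {S : Type*} [Ring S] [Algebra ℝ S] (c : SuperCalculus (ghost e J) S)

include hκ in
theorem sec_csTensor : c.sec (propagator A κ e T LinearMap.id) (c.cubic (csTensor A κ e T)) = 0 :=
  c.sec_cubic (csTensor_swap_left hκ e T) (csTensor_swap_right e T) (contract_csTensor hκ e T)

/-- A degree count turns the sign of a rotation of three coordinates into one that is quadratic
in the degrees. -/
theorem koszul_ghost_mul (x y z : I × J) :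
    koszul (ghost e J) x y * koszul (ghost e J) x z =
      (-1 : ℝ) ^ ((e.deg x.1 + 1) * (e.deg y.1 + e.deg z.1)) := by
  rw [koszul_ghost, koszul_ghost, ← pow_add]
  refine neg_one_pow_eq_of_even_add ?_
  simp only [Nat.even_add, Nat.even_mul, Nat.even_add_one]
  tauto

/-- In a contraction of two cubic vertices, the factor that does not involve the Lie algebra is
invariant under rotations of the legs `x, y, z`. -/
theorem vertex_pair_rotate (a x y z : I × J) :
    ((-1 : ℝ) ^ (e.deg a.1 * (e.deg y.1 + 1)) * (-1 : ℝ) ^ (e.deg z.1 * (e.deg x.1 + 1)) *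
      A.pair (e.basis a.1 * e.basis y.1) (e.basis z.1 * e.basis x.1)) •
        (c.co a * c.co y * (c.co z * c.co x)) =
    ((-1 : ℝ) ^ (e.deg a.1 * (e.deg x.1 + 1)) * (-1 : ℝ) ^ (e.deg y.1 * (e.deg z.1 + 1)) *
      A.pair (e.basis a.1 * e.basis x.1) (e.basis y.1 * e.basis z.1)) •
        (c.co a * c.co x * (c.co y * c.co z)) := by
  have h1 : A.pair (e.basis a.1 * e.basis y.1) (e.basis z.1 * e.basis x.1) =
      (-1) ^ ((e.deg y.1 + e.deg z.1) * e.deg x.1) *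
        A.pair (e.basis a.1 * e.basis x.1) (e.basis y.1 * e.basis z.1) := by
    rw [← A.pair_cyclic, ← A.pair_cyclic, ← mul_assoc, A.mul_comm_graded _ _ _
      (SetLike.mul_mem_graded (e.mem y.1) (e.mem z.1)) _ (e.mem x.1), map_smul]
    rfl
  have h2 : c.co a * c.co y * (c.co z * c.co x) =
      ((-1 : ℝ) ^ ((e.deg x.1 + 1) * (e.deg y.1 + e.deg z.1))) •
        (c.co a * c.co x * (c.co y * c.co z)) := by
    rw [← koszul_ghost_mul, mul_assoc, ← mul_assoc (c.co y), c.co_rotate, mul_smul_comm,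
      mul_assoc (c.co x), ← mul_assoc]
  by_cases h0 : A.pair (e.basis a.1 * e.basis x.1) (e.basis y.1 * e.basis z.1) = 0
  · rw [h1, h0, mul_zero, mul_zero, mul_zero, zero_smul, zero_smul]
  have hdeg : e.deg a.1 + e.deg x.1 + (e.deg y.1 + e.deg z.1) = 3 := by
    by_contra hc
    exact h0 (A.pair_degree _ _ _ (SetLike.mul_mem_graded (e.mem _) (e.mem _)) _
      (SetLike.mul_mem_graded (e.mem _) (e.mem _)) hc)
  rw [h1, h2, smul_smul]
  congr 1
  generalize A.pair (e.basis a.1 * e.basis x.1) (e.basis y.1 * e.basis z.1) = r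
  generalize e.deg a.1 = m at *
  generalize e.deg x.1 = i at *
  generalize e.deg y.1 = j at *
  generalize e.deg z.1 = k at *
  have h3 : (-1 : ℝ) ^ (m * (j + 1) + k * (i + 1) + (j + k) * i + (i + 1) * (j + k)) =
      (-1) ^ (m * (i + 1) + j * (k + 1)) := by
    refine neg_one_pow_eq_of_even_add ?_
    have h4 : ((m + i + (j + k) : ℕ) : ZMod 2) = (3 : ℕ) := by rw [hdeg]
    rw [← ZMod.natCast_eq_zero_iff_even]
    push_cast at h4 ⊢
    revert h4
    generalize (m : ZMod 2) = m, (i : ZMod 2) = i, (j : ZMod 2) = j, (k : ZMod 2) = k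
    revert m i j k
    decide
  rw [pow_add, pow_add, pow_add, pow_add] at h3
  linear_combination r * h3

include hκ in
/-- The classical master equation for the cubic term: associativity and graded commutativity make
the contraction cyclic in three of its four legs, so that the Jacobi identity applies. -/
theorem bracket_csTensor : c.toTwisted.bracket (propagator A κ e T LinearMap.id)
    (c.cubic (csTensor A κ e T)) (c.cubic (csTensor A κ e T)) = 0 := by
  rw [c.bracket_cubic (csTensor_swap_left hκ e T) (csTensor_swap_right e T)]
  refine smul_eq_zero_of_right _ (Finset.sum_eq_zero fun a _ => ?_)
  have hterm : ∀ x y z : I × J, (∑ p, ∑ q, propagator A κ e T LinearMap.id p q *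
      csTensor A κ e T p a x * csTensor A κ e T q y z) • (c.co a * c.co x * (c.co y * c.co z)) =
      κ ⁅T a.2, T x.2⁆ ⁅T y.2, T z.2⁆ • (((-1 : ℝ) ^ (e.deg a.1 * (e.deg x.1 + 1)) *
        (-1 : ℝ) ^ (e.deg y.1 * (e.deg z.1 + 1)) *
        A.pair (e.basis a.1 * e.basis x.1) (e.basis y.1 * e.basis z.1)) •
        (c.co a * c.co x * (c.co y * c.co z))) := by
    intro x y z
    rw [contract_csTensor_csTensor hκ, smul_smul]
    congr 1; ring
  have jac : ∀ x y z : I × J, κ ⁅T a.2, T x.2⁆ ⁅T y.2, T z.2⁆ + κ ⁅T a.2, T y.2⁆ ⁅T z.2, T x.2⁆ +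
      κ ⁅T a.2, T z.2⁆ ⁅T x.2, T y.2⁆ = 0 := by
    intro x y z
    rw [hκ.invariant, hκ.invariant, hκ.invariant, ← map_add, ← map_add, lie_jacobi, map_zero]
  refine sum_eq_zero_of_cyclic _ fun x y z => ?_
  rw [hterm x y z, hterm y z x, hterm z x y, vertex_pair_rotate e c a x y z,
    ← vertex_pair_rotate e c a z x y, ← add_smul, ← add_smul, jac, zero_smul]

/-- The differential is a derivation of the cyclic product, hence preserves the cubic term. -/
theorem pair_d_cyclic (x y z : I) :
    A.pair (A.d (e.basis x)) (e.basis y * e.basis z) +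
      (-1) ^ (e.deg x + e.deg x * (e.deg y + 1) + e.deg x * e.deg z) *
        A.pair (A.d (e.basis y)) (e.basis z * e.basis x) +
      (-1) ^ (e.deg x + e.deg y) * A.pair (A.d (e.basis z)) (e.basis x * e.basis y) = 0 := by
  have h1 := A.pair_d _ _ (e.mem x) (e.basis y * e.basis z)
  have h2 : A.pair (e.basis x) (A.d (e.basis y) * e.basis z) =
      (-1) ^ (e.deg x * (e.deg y + 1)) * (-1) ^ (e.deg x * e.deg z) *
        A.pair (A.d (e.basis y)) (e.basis z * e.basis x) := by
    rw [A.pair_cyclic, A.mul_comm_graded _ _ _ (e.mem x) _ (A.d_degree _ _ (e.mem y)), map_smul,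
      LinearMap.smul_apply, ← A.pair_cyclic, A.mul_comm_graded _ _ _ (e.mem x) _ (e.mem z),
      map_smul, smul_smul, smul_eq_mul]
  have h3 : A.pair (e.basis x) (e.basis y * A.d (e.basis z)) =
      A.pair (A.d (e.basis z)) (e.basis x * e.basis y) := by
    rw [A.pair_cyclic, DGFrobenius.pair_comm e]
  rw [A.leibniz _ _ (e.mem y), map_add, map_smul, h2, h3, smul_eq_mul] at h1
  rw [pow_add, pow_add, pow_add]
  linear_combination h1

include hκ in
theorem linVec_csTensor : c.linVec (diffMatrix A e J) (c.cubic (csTensor A κ e T)) = 0 := by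
  rw [c.linVec_cubic (csTensor_swap_left hκ e T) (csTensor_swap_right e T)]
  refine smul_eq_zero_of_right _ (sum_eq_zero_of_cyclic _ fun x y z => ?_)
  have hr : ∀ x y z : I × J, c.co y * (c.co z * c.co x) =
      ((-1 : ℝ) ^ ((e.deg x.1 + 1) * (e.deg y.1 + e.deg z.1))) • (c.co x * (c.co y * c.co z)) := by
    intro x y z
    rw [← koszul_ghost_mul, ← mul_assoc, c.co_rotate, mul_assoc]
  have hr' : c.co z * (c.co x * c.co y) =
      ((-1 : ℝ) ^ ((e.deg z.1 + 1) * (e.deg x.1 + e.deg y.1))) • (c.co x * (c.co y * c.co z)) := by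
    rw [hr z x y, smul_smul, ← mul_pow, neg_one_mul, neg_neg, one_pow, one_smul]
  have hE := pair_d_cyclic (A := A) e x.1 y.1 z.1
  have hdeg : ∀ x y z : I, e.deg x + e.deg y + e.deg z ≠ 2 →
      A.pair (A.d (e.basis x)) (e.basis y * e.basis z) = 0 := fun x y z hc =>
    A.pair_degree _ _ _ (A.d_degree _ _ (e.mem x)) _
      (SetLike.mul_mem_graded (e.mem y) (e.mem z)) (by omega)
  rw [diffMatrix_mul_csTensor, diffMatrix_mul_csTensor, diffMatrix_mul_csTensor, hr x y z, hr',
    smul_smul, smul_smul, ← add_smul, ← add_smul, ← hκ.lie_rotate (T x.2), hκ.lie_rotate (T z.2)]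
  refine smul_eq_zero_of_left ?_ _
  by_cases h2 : e.deg x.1 + e.deg y.1 + e.deg z.1 = 2
  swap
  · rw [hdeg _ _ _ h2, hdeg y.1 z.1 x.1 (by omega), hdeg z.1 x.1 y.1 (by omega)]
    ring
  generalize A.pair (A.d (e.basis x.1)) (e.basis y.1 * e.basis z.1) = r₁ at *
  generalize A.pair (A.d (e.basis y.1)) (e.basis z.1 * e.basis x.1) = r₂ at *
  generalize A.pair (A.d (e.basis z.1)) (e.basis x.1 * e.basis y.1) = r₃ at *
  generalize κ (T x.2) ⁅T y.2, T z.2⁆ = s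
  generalize e.deg x.1 = i at *
  generalize e.deg y.1 = j at *
  generalize e.deg z.1 = k at *
  have hev : ((i + j + k : ℕ) : ZMod 2) = (2 : ℕ) := by rw [h2]
  push_cast at hev
  have h3 : (-1 : ℝ) ^ (j + k * (i + 1) + (i + 1) * (j + k)) =
      (-1) ^ (i + j * (k + 1) + (i + i * (j + 1) + i * k)) := by
    refine neg_one_pow_eq_of_even_add ?_
    rw [← ZMod.natCast_eq_zero_iff_even]
    push_cast
    revert hev
    generalize (i : ZMod 2) = i, (j : ZMod 2) = j, (k : ZMod 2) = k
    revert i j k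
    decide
  have h4 : (-1 : ℝ) ^ (k + i * (j + 1) + (k + 1) * (i + j)) =
      (-1) ^ (i + j * (k + 1) + (i + j)) := by
    refine neg_one_pow_eq_of_even_add ?_
    rw [← ZMod.natCast_eq_zero_iff_even]
    push_cast
    revert hev
    generalize (i : ZMod 2) = i, (j : ZMod 2) = j, (k : ZMod 2) = k
    revert i j k
    decide
  rw [pow_add, pow_add, pow_add _ (i + j * (k + 1)), pow_add _ i (j * _)] at h3 h4
  linear_combination s * r₂ * h3 + s * r₃ * h4 + s * (-1) ^ i * (-1) ^ (j * (k + 1)) * hE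

end ChernSimonsIdentities

/-! ### The master equation and the flow equation, diagram by diagram -/

section Flow

theorem apply_iterate {S : Type*} [AddCommGroup S] [Module ℝ S] {D P Δ ΔQ : S →ₗ[ℝ] S}
    (hcomm : ∀ f, D (P f) = P (D f) - Δ f + ΔQ f) (hΔ : ∀ f, Δ (P f) = P (Δ f))
    (hQ : ∀ f, ΔQ (P f) = P (ΔQ f)) {v : S} (hDv : D v = 0) (hΔv : Δ v = 0) (j : ℕ) :
    D ((P ^ j) v) = (j : ℝ) • ΔQ ((P ^ (j - 1)) v) := by
  have h1 : ∀ j : ℕ, Δ ((P ^ j) v) = 0 := by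
    intro j
    induction j with
    | zero => simpa using hΔv
    | succ j ih => rw [pow_succ', Module.End.mul_apply, hΔ, ih, map_zero]
  induction j with
  | zero => simpa using hDv
  | succ j ih =>
    rw [pow_succ', Module.End.mul_apply, hcomm, ih, h1, map_smul, ← hQ, Nat.add_sub_cancel]
    cases j with
    | zero => simp
    | succ j =>
      rw [Nat.add_sub_cancel, ← Module.End.mul_apply P, ← pow_succ']
      push_cast
      module

/-- The data that make the effective action of the propagators `A₀ + t A₁` a solution of the
quantum master equation, and its derivative in `t` an infinitesimal canonical transformation; here
`r` is the restriction to the zero-modes, and `u` is the interaction. The fields `master` and `flow`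
say, for each number `j` of edges and `k` of vertices, that `Δ' Z = 0` and `dZ/dt = ½ h² Δ' (r Λ V)`
with `Z = r V` and `V = exp (h P_t) exp (μ u)`, where `P_t` is the operator of `A₀ + t A₁`, and
`Δ'` is half the operator of `B`. -/
structure EffectiveFlow {X Y S S' : Type*} [DecidableEq X] [Fintype X] [DecidableEq Y] [Fintype Y]
    {gh : X → ℤ} {gh' : Y → ℤ} [Ring S] [Algebra ℝ S] [Ring S'] [Algebra ℝ S']
    (c : SuperCalculus gh S) (c' : SuperCalculus gh' S') (r : S →ₐ[ℝ] S')
    (A₀ A₁ Λ : Matrix X X ℝ) (B : Matrix Y Y ℝ) (u : S) : Prop where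
  map_hom : ∀ n g f, f ∈ c.hom n g → r f ∈ c'.hom n g
  ghost₀ : ∀ x y, A₀ x y ≠ 0 → gh x + gh y = 0
  ghost₁ : ∀ x y, A₁ x y ≠ 0 → gh x + gh y = 0
  ghost_generator : ∀ x y, Λ x y ≠ 0 → gh x + gh y = 1
  ghost_poisson : ∀ x y, B x y ≠ 0 → gh' x + gh' y = -1
  symm : B.IsSymm
  interaction : u ∈ c.hom 3 0
  master : ∀ (t : ℝ) (j k : ℕ), c'.sec B (r ((c.sec (A₀ + t • A₁) ^ j) (u ^ k))) = 0
  flow : ∀ (t : ℝ) (j k : ℕ), r (c.sec A₁ ((c.sec (A₀ + t • A₁) ^ j) (u ^ k))) =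
    ((j : ℝ) / 4) • c'.sec B (r (c.sec Λ ((c.sec (A₀ + t • A₁) ^ (j - 1)) (u ^ k))))

variable {C : Type*} [Ring C] [Algebra ℝ C] {𝒞 : ℕ → Submodule ℝ C} [GradedAlgebra 𝒞]
  {𝔤 : Type*} [LieRing 𝔤] [LieAlgebra ℝ 𝔤] {I J P : Type*} [Fintype I] [DecidableEq I] [Fintype J]
  [DecidableEq J] [Fintype P] [DecidableEq P] {A : DGFrobenius 𝒞 3} {κ : LinearMap.BilinForm ℝ 𝔤}
  (hκ : IsQuadratic κ) (e : HomBasis I 𝒞) (T : Module.Basis J ℝ 𝔤)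
  (h : HomBasis P A.cohomologyDeg) {ι : A.Cohomology →ₗ[ℝ] C}

theorem toMatrix_lower {K : C →ₗ[ℝ] C} (h1 : ∀ i : ℕ, ∀ a ∈ 𝒞 (i + 1), K a ∈ 𝒞 i)
    (h0 : ∀ a ∈ 𝒞 0, K a = 0) {i m : I} (him : LinearMap.toMatrix e.basis e.basis K i m ≠ 0) :
    (e.deg i : ℤ) + 1 = e.deg m := by
  rw [LinearMap.toMatrix_apply] at him
  have hm := e.mem m
  cases hd : e.deg m with
  | zero =>
    rw [hd] at hm
    rw [h0 _ hm] at him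
    simp at him
  | succ n =>
    rw [hd] at hm
    rw [e.deg_of_repr_ne_zero (h1 _ _ hm) him]
    push_cast; rfl

theorem toMatrix_lower_two {K : C →ₗ[ℝ] C} (h1 : ∀ i : ℕ, ∀ a ∈ 𝒞 (i + 1), K a ∈ 𝒞 i)
    (h0 : ∀ a ∈ 𝒞 0, K a = 0) {i m : I}
    (him : LinearMap.toMatrix e.basis e.basis (K ∘ₗ K ∘ₗ K ∘ₗ A.d) i m ≠ 0) :
    (e.deg i : ℤ) + 2 = e.deg m := by
  rw [LinearMap.toMatrix_apply] at him
  simp only [LinearMap.comp_apply] at him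
  have hm := h1 _ _ (A.d_degree _ _ (e.mem m))
  match hd : e.deg m with
  | 0 =>
    rw [hd] at hm
    rw [h0 _ hm] at him
    simp at him
  | 1 =>
    rw [hd] at hm
    rw [h0 _ (h1 _ _ hm)] at him
    simp at him
  | n + 2 =>
    rw [hd] at hm
    rw [e.deg_of_repr_ne_zero (h1 _ _ (h1 _ _ hm)) him]
    push_cast; rfl

variable {S S' : Type*} [Ring S] [Algebra ℝ S] [Ring S'] [Algebra ℝ S']
  (c : SuperCalculus (ghost e J) S) (c' : SuperCalculus (ghost h J) S')

/-- The operator of a homotopy from the identity to the projection, commuted with the vector field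
of the differential. -/
theorem linVec_sec_propagator {K Q : C →ₗ[ℝ] C} (h1 : ∀ i : ℕ, ∀ a ∈ 𝒞 (i + 1), K a ∈ 𝒞 i)
    (h0 : ∀ a ∈ 𝒞 0, K a = 0) (hKd : ∀ a, A.d (K a) + K (A.d a) = a - Q a) (f : S) :
    c.linVec (diffMatrix A e J) (c.sec ((-1 / 2 : ℝ) • propagator A κ e T K) f) =
      c.sec ((-1 / 2 : ℝ) • propagator A κ e T K) (c.linVec (diffMatrix A e J) f) -
        c.sec ((1 / 2 : ℝ) • propagator A κ e T LinearMap.id) f +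
        c.sec ((1 / 2 : ℝ) • propagator A κ e T Q) f := by
  have hgh : ∀ x y, propagator A κ e T K x y ≠ 0 →
      ghSign (ghost e J) x * ghSign (ghost e J) y = 1 := fun x y hxy => by
    have := propagator_ghost e κ T (fun i m => toMatrix_lower e h1 h0) hxy
    exact ghSign_mul_of_even _ (by rw [this]; decide)
  have h2 := c.sec_linVec (M := diffMatrix A e J) (fun z y => diffMatrix_odd e) 1 hgh f
  have h3 : LinearMap.id = (K ∘ₗ A.d + (1 : ℝ) • A.d ∘ₗ K) + Q := by
    ext a
    have := hKd a
    simp only [LinearMap.id_apply, LinearMap.add_apply, LinearMap.smul_apply, one_smul,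
      LinearMap.comp_apply]
    rw [add_comm (K _), this, sub_add_cancel]
  rw [propagator_mul_diffMatrix e κ T hgh, one_smul, c.sec_neg, LinearMap.neg_apply] at h2
  rw [h3, propagator_add]
  simp only [c.sec_smul, c.sec_add, smul_add, LinearMap.smul_apply, LinearMap.add_apply, map_smul]
  rw [h2]
  module

theorem linVec_sec_generator {K : C →ₗ[ℝ] C} (h1 : ∀ i : ℕ, ∀ a ∈ 𝒞 (i + 1), K a ∈ 𝒞 i)
    (h0 : ∀ a ∈ 𝒞 0, K a = 0)
    (hKd : ∀ a, A.d (K (K (K (A.d a)))) = K a - K (A.d (K a))) (f : S) :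
    c.sec (propagator A κ e T (K + (-1 : ℝ) • (K ∘ₗ A.d ∘ₗ K))) f =
      c.sec (propagator A κ e T (K ∘ₗ K ∘ₗ K ∘ₗ A.d)) (c.linVec (diffMatrix A e J) f) +
      c.linVec (diffMatrix A e J) (c.sec (propagator A κ e T (K ∘ₗ K ∘ₗ K ∘ₗ A.d)) f) := by
  have hgh : ∀ x y, propagator A κ e T (K ∘ₗ K ∘ₗ K ∘ₗ A.d) x y ≠ 0 →
      ghSign (ghost e J) x * ghSign (ghost e J) y = -1 := fun x y hxy => by
    have := propagator_ghost e κ T (fun i m => toMatrix_lower_two e h1 h0) hxy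
    exact ghSign_mul_of_odd _ (by rw [this]; decide)
  have h2 := c.sec_linVec (M := diffMatrix A e J) (fun z y => diffMatrix_odd e) (-1) hgh f
  have h3 : K + (-1 : ℝ) • (K ∘ₗ A.d ∘ₗ K) = (-1 : ℝ) • ((K ∘ₗ K ∘ₗ K ∘ₗ A.d) ∘ₗ A.d +
      (-1 : ℝ) • A.d ∘ₗ (K ∘ₗ K ∘ₗ K ∘ₗ A.d)) := by
    ext a
    have := hKd a
    simp only [LinearMap.add_apply, LinearMap.smul_apply, LinearMap.comp_apply, A.d_d, map_zero,
      this]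
    module
  rw [propagator_mul_diffMatrix e κ T hgh, c.sec_neg, LinearMap.neg_apply] at h2
  rw [h2, h3, propagator_smul, c.sec_smul, LinearMap.smul_apply]
  module

/-- The vector field of the differential vanishes on the zero-modes. -/
theorem restrict_linVec (hι : A.IsEmbedding ι) {r : S →ₐ[ℝ] S'}
    (hr : ∀ x, r (c.co x) = ∑ y : P × J,
      (if x.2 = y.2 then e.basis.repr (ι (h.basis y.1)) x.1 else 0) • c'.co y) (f : S) :
    r (c.linVec (diffMatrix A e J) f) = 0 := by
  have h1 : ∀ (y : I × J) (p : P × J), ∑ z : I × J, diffMatrix A e J z y *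
      (if z.2 = p.2 then e.basis.repr (ι (h.basis p.1)) z.1 else 0) = 0 := by
    intro y p
    have h2 := congrArg (fun v => e.basis.repr v y.1) (hι.d_apply (h.basis p.1))
    simp only [map_zero, Finsupp.zero_apply] at h2
    rw [← e.basis.sum_repr (ι (h.basis p.1)), map_sum, map_sum, Finsupp.finsetSum_apply] at h2
    rw [Fintype.sum_prod_type]
    by_cases hyp : y.2 = p.2
    swap
    · refine Finset.sum_eq_zero fun i _ => Finset.sum_eq_zero fun a _ => ?_
      by_cases ha : a = p.2
      · simp [diffMatrix, ha, Ne.symm hyp]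
      · simp [ha]
    · have hd : ∀ i, e.basis.repr (ι (h.basis p.1)) i ≠ 0 → e.deg i = h.deg p.1 := fun i =>
        e.deg_of_repr_ne_zero (hι.degree _ _ (h.mem _))
      have h3 : ∀ i : I, ∑ a : J, diffMatrix A e J (i, a) y *
          (if a = p.2 then e.basis.repr (ι (h.basis p.1)) i else 0) =
          (-1) ^ h.deg p.1 * (e.basis.repr (A.d (e.basis.repr (ι (h.basis p.1)) i • e.basis i))) y.1
          := by
        intro i
        rw [Finset.sum_eq_single p.2]
        · simp only [if_true, diffMatrix, Matrix.of_apply, hyp, LinearMap.toMatrix_apply, map_smul,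
            Finsupp.smul_apply, smul_eq_mul]
          by_cases h0 : e.basis.repr (ι (h.basis p.1)) i = 0
          · simp [h0]
          · rw [hd i h0]; ring
        · intro a _ ha; simp [ha]
        · simp
      rw [Finset.sum_congr rfl fun i _ => h3 i, ← Finset.mul_sum, h2, mul_zero]
  rw [SuperCalculus.linVec_apply]
  simp only [map_sum, map_smul, map_mul, hr, Finset.sum_mul, Finset.smul_sum, smul_mul_assoc,
    smul_smul]
  rw [Finset.sum_comm]
  refine Finset.sum_eq_zero fun y _ => ?_
  rw [Finset.sum_comm]
  refine Finset.sum_eq_zero fun p _ => ?_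
  rw [← Finset.sum_smul, h1, zero_smul]

include hκ in
theorem effectiveFlow (hι : A.IsEmbedding ι) {K : C →ₗ[ℝ] C} (hK : A.IsChainHomotopy ι K)
    {r : S →ₐ[ℝ] S'} (hr : ∀ x, r (c.co x) = ∑ y : P × J,
      (if x.2 = y.2 then e.basis.repr (ι (h.basis y.1)) x.1 else 0) • c'.co y) :
    EffectiveFlow c c' r ((-1 / 2 : ℝ) • propagator A κ e T (K ∘ₗ A.d ∘ₗ K))
      ((-1 / 2 : ℝ) • propagator A κ e T (K + (-1 : ℝ) • (K ∘ₗ A.d ∘ₗ K)))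
      (propagator A κ e T (K ∘ₗ K ∘ₗ K ∘ₗ A.d)) (cohomologyPoisson A κ T h ι)
      (c.cubic (csTensor A κ e T)) := by
  obtain ⟨Q, hQ, hKd⟩ := hK.homotopy
  have hid := hK.identities e hι hQ hKd
  have hK' := hK.strict hQ hid
  set u := c.cubic (csTensor A κ e T) with hu
  set D := c.linVec (diffMatrix A e J) with hD
  set Kd : ℝ → C →ₗ[ℝ] C := fun t => K ∘ₗ A.d ∘ₗ K + t • (K + (-1 : ℝ) • (K ∘ₗ A.d ∘ₗ K)) with hKt
  have hpath : ∀ t : ℝ, (-1 / 2 : ℝ) • propagator A κ e T (K ∘ₗ A.d ∘ₗ K) +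
      t • ((-1 / 2 : ℝ) • propagator A κ e T (K + (-1 : ℝ) • (K ∘ₗ A.d ∘ₗ K))) =
      (-1 / 2 : ℝ) • propagator A κ e T (Kd t) := fun t => by
    simp only [hKt, propagator_add, propagator_smul]
    module
  have low : ∀ t : ℝ, ∀ i : ℕ, ∀ a ∈ 𝒞 (i + 1), Kd t a ∈ 𝒞 i := fun t i a ha =>
    add_mem (hK'.degree i a ha) (Submodule.smul_mem _ _ (add_mem (hK.degree i a ha)
      (Submodule.smul_mem _ _ (hK'.degree i a ha))))
  have low0 : ∀ t : ℝ, ∀ a ∈ 𝒞 0, Kd t a = 0 := fun t a ha => by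
    simp [hKt, hK.degree_zero a ha]
  have hKtd : ∀ t a, A.d (Kd t a) + Kd t (A.d a) = a - Q a := fun t a => by
    simp only [hKt, LinearMap.add_apply, LinearMap.smul_apply, LinearMap.comp_apply, map_add,
      map_smul]
    rw [hid.dKdK, hid.KdKd, ← hid.homotopy a]
    module
  have ghost_half : ∀ {L : C →ₗ[ℝ] C}, (∀ i : ℕ, ∀ a ∈ 𝒞 (i + 1), L a ∈ 𝒞 i) →
      (∀ a ∈ 𝒞 0, L a = 0) → ∀ x y, ((-1 / 2 : ℝ) • propagator A κ e T L) x y ≠ 0 →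
      ghost e J x + ghost e J y = 0 := fun l1 l0 x y hxy =>
    propagator_ghost (s := 1) e κ T (fun i m => toMatrix_lower e l1 l0) (right_ne_zero_of_mul hxy)
  have even_t : ∀ t x y, ((-1 / 2 : ℝ) • propagator A κ e T (Kd t)) x y ≠ 0 →
      Even (ghost e J x + ghost e J y) := fun t x y hxy => by
    rw [ghost_half (low t) (low0 t) x y hxy]; decide
  have ghostΛ : ∀ x y, propagator A κ e T (K ∘ₗ K ∘ₗ K ∘ₗ A.d) x y ≠ 0 →
      ghost e J x + ghost e J y = 1 := fun x y hxy =>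
    propagator_ghost (s := 2) e κ T (fun i m => toMatrix_lower_two e hK.degree hK.degree_zero) hxy
  have hJ : ∀ (x : I × J) (y : P × J), (Matrix.of fun (x : I × J) (y : P × J) =>
      if x.2 = y.2 then e.basis.repr (ι (h.basis y.1)) x.1 else 0) x y ≠ 0 →
      ghost e J x = ghost h J y := by
    intro x y hxy
    rw [Matrix.of_apply] at hxy
    split_ifs at hxy
    · unfold ghost
      rw [e.deg_of_repr_ne_zero (hι.degree _ _ (h.mem _)) hxy]
    · exact absurd rfl hxy
  have hsec : ∀ f, c'.sec (cohomologyPoisson A κ T h ι) (r f) =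
      r (c.sec (propagator A κ e T Q) f) := fun f => by
    rw [c.sec_pullback c' hJ hr, embedding_cohomologyPoisson e h hι hK hQ κ T rfl]
  -- the bivector of the projection is that of the cohomology, hence of ghost number `-1`
  have ghostQ : ∀ x y, propagator A κ e T Q x y ≠ 0 → Odd (ghost e J x + ghost e J y) := by
    intro x y hxy
    rw [← embedding_cohomologyPoisson e h hι hK hQ κ T rfl, Matrix.mul_apply] at hxy
    obtain ⟨q, -, hq⟩ := Finset.exists_ne_zero_of_sum_ne_zero hxy
    have hq1 := left_ne_zero_of_mul hq
    rw [Matrix.mul_apply] at hq1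
    obtain ⟨p, -, hp⟩ := Finset.exists_ne_zero_of_sum_ne_zero hq1
    rw [hJ x p (left_ne_zero_of_mul hp), hJ y q (right_ne_zero_of_mul hq),
      cohomologyPoisson_ghost e h hι hK κ T (right_ne_zero_of_mul hp)]
    decide
  have hu3 : u ∈ c.hom 3 0 := c.cubic_mem_hom fun x y z => csTensor_ghost e T
  have htw := c.twist_ghost_zero hu3
  have hDu : ∀ k, D (u ^ k) = 0 := c.linVec_pow_eq_zero _ htw (linVec_csTensor hκ e T c)
  have hΔu : ∀ k, c.sec ((1 / 2 : ℝ) • propagator A κ e T LinearMap.id) (u ^ k) = 0 := fun k => by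
    rw [c.sec_smul, LinearMap.smul_apply, c.sec_pow_eq_zero (propagator_id_symm hκ e T)
      (fun x y hxy => by rw [propagator_id_ghost e T hxy]; decide) htw (sec_csTensor hκ e T c)
      (bracket_csTensor hκ e T c), smul_zero]
  have hiter : ∀ t (j k : ℕ), D ((c.sec ((-1 / 2 : ℝ) • propagator A κ e T (Kd t)) ^ j) (u ^ k)) =
      (j : ℝ) • c.sec ((1 / 2 : ℝ) • propagator A κ e T Q)
        ((c.sec ((-1 / 2 : ℝ) • propagator A κ e T (Kd t)) ^ (j - 1)) (u ^ k)) := fun t j k =>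
    apply_iterate (linVec_sec_propagator e T c (low t) (low0 t) (hKtd t))
      (c.sec_comm_of_even (even_t t) _) (c.sec_comm_of_even (even_t t) _) (hDu k) (hΔu k) j
  refine ⟨fun n g f hf => c.pullback_mem_hom c' hJ hr hf, ghost_half hK'.degree hK'.degree_zero,
    ghost_half (fun i a ha => add_mem (hK.degree i a ha)
      (Submodule.smul_mem _ _ (hK'.degree i a ha)))
      (fun a ha => by simp [hK.degree_zero a ha]), ghostΛ,
    fun x y hxy => cohomologyPoisson_ghost e h hι hK κ T hxy,
    cohomologyPoisson_symm e h κ hκ.symm T, hu3, fun t j k => ?_, fun t j k => ?_⟩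
  · rw [hpath, hsec]
    have h1 := congrArg r (hiter t (j + 1) k)
    rw [hD, restrict_linVec e h c c' hι hr, map_smul, c.sec_smul, LinearMap.smul_apply, map_smul,
      Nat.add_sub_cancel, smul_smul] at h1
    exact (smul_eq_zero.1 h1.symm).resolve_left (by positivity)
  · rw [hpath, hsec, c.sec_smul, LinearMap.smul_apply,
      linVec_sec_generator e T c hK.degree hK.degree_zero hid.sub_eq, map_smul, map_add, ← hD,
      restrict_linVec e h c c' hι hr, add_zero, hiter, map_smul, map_smul, c.sec_smul (1 / 2 : ℝ),
      LinearMap.smul_apply, map_smul, map_smul, c.sec_anticomm_of_odd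
      (fun x y hxy => by rw [ghostΛ x y hxy]; decide) ghostQ, map_neg]
    module

end Flow

/-! ### Polynomial paths -/

section PolynomialPaths

open Polynomial

variable {S S' : Type*} [Ring S] [Algebra ℝ S] [Ring S'] [Algebra ℝ S']

theorem coeff_sum_monomial (f : S →ₗ[ℝ] S') (n : ℕ) (p : S[X]) :
    (∑ m ∈ p.support, monomial m (f (p.coeff m))).coeff n = f (p.coeff n) := by
  simp only [finsetSum_coeff, coeff_monomial, Finset.sum_ite_eq']
  split_ifs with h
  · rfl
  · rw [notMem_support_iff.1 h, map_zero]

/-- A linear map acting on the coefficients of polynomials. -/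
def polyLift (f : S →ₗ[ℝ] S') : S[X] →ₗ[ℝ] S'[X] where
  toFun p := ∑ n ∈ p.support, monomial n (f (p.coeff n))
  map_add' p q := by
    ext n
    rw [coeff_add, coeff_sum_monomial, coeff_sum_monomial, coeff_sum_monomial, coeff_add, map_add]
  map_smul' x p := by
    ext n
    rw [RingHom.id_apply, coeff_smul, coeff_sum_monomial, coeff_sum_monomial, coeff_smul, map_smul]

@[simp] theorem coeff_polyLift (f : S →ₗ[ℝ] S') (n : ℕ) (p : S[X]) :
    (polyLift f p).coeff n = f (p.coeff n) := coeff_sum_monomial f n p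

theorem polyLift_monomial (f : S →ₗ[ℝ] S') (n : ℕ) (a : S) :
    polyLift f (monomial n a) = monomial n (f a) := by
  ext m
  rw [coeff_polyLift, coeff_monomial, coeff_monomial]
  split_ifs <;> simp

/-- The value at a real number. -/
def polyEval (t : ℝ) : S[X] →+* S :=
  eval₂RingHom' (RingHom.id S) (algebraMap ℝ S t) fun a => (Algebra.commutes t a).symm

theorem polyEval_monomial (t : ℝ) (n : ℕ) (a : S) : polyEval t (monomial n a) = t ^ n • a := by
  change eval₂ (RingHom.id S) (algebraMap ℝ S t) (monomial n a) = _
  rw [eval₂_monomial, RingHom.id_apply, ← map_pow, ← Algebra.commutes, Algebra.smul_def]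

theorem polyEval_C (t : ℝ) (a : S) : polyEval t (C a) = a := by
  rw [← monomial_zero_left, polyEval_monomial, pow_zero, one_smul]

theorem polyEval_X (t : ℝ) : polyEval t (X : S[X]) = algebraMap ℝ S t := by
  rw [← monomial_one_one_eq_X, polyEval_monomial, pow_one, Algebra.smul_def, mul_one]

theorem polyEval_polyLift (f : S →ₗ[ℝ] S') (t : ℝ) (p : S[X]) :
    polyEval t (polyLift f p) = f (polyEval t p) := by
  induction p using Polynomial.induction_on' with
  | add p q hp hq => rw [map_add, map_add, map_add, map_add, hp, hq]
  | monomial n a => rw [polyLift_monomial, polyEval_monomial, polyEval_monomial, map_smul]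

theorem polyEval_smul (x t : ℝ) (p : S[X]) : polyEval t (x • p) = x • polyEval t p := by
  have h : x • p = polyLift (x • LinearMap.id) p := by
    ext n; simp
  rw [h, polyEval_polyLift]; rfl

theorem polyEval_mapRingHom (r : S →ₐ[ℝ] S') (t : ℝ) (p : S[X]) :
    polyEval t (mapRingHom (r : S →+* S') p) = r (polyEval t p) := by
  induction p using Polynomial.induction_on' with
  | add p q hp hq => rw [map_add, map_add, map_add, map_add, hp, hq]
  | monomial n a =>
    rw [coe_mapRingHom, map_monomial, polyEval_monomial, polyEval_monomial, map_smul]; rfl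

/-- The formal derivative, as a map over the reals. -/
def polyDeriv : S[X] →ₗ[ℝ] S[X] where
  toFun := derivative
  map_add' _ _ := derivative_add
  map_smul' x p := derivative_smul x p

theorem polyDeriv_apply (p : S[X]) : polyDeriv p = derivative p := rfl

theorem polyDeriv_mapRingHom (r : S →ₐ[ℝ] S') (p : S[X]) :
    polyDeriv (mapRingHom (r : S →+* S') p) = mapRingHom (r : S →+* S') (polyDeriv p) :=
  derivative_map p _

theorem hasDerivAt_polyEval (φ : S →ₗ[ℝ] ℝ) (p : S[X]) (t : ℝ) :
    HasDerivAt (fun s => φ (polyEval s p)) (φ (polyEval t (polyDeriv p))) t := by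
  induction p using Polynomial.induction_on' with
  | add p q hp hq =>
    simp only [map_add]
    exact hp.add hq
  | monomial n a =>
    rw [polyDeriv_apply, derivative_monomial, polyEval_monomial]
    simp only [polyEval_monomial, map_smul, smul_eq_mul]
    have h := (hasDerivAt_pow n t).mul_const (φ a)
    have e : a * (n : S) = (n : ℝ) • a := by
      rw [← Nat.cast_comm, ← nsmul_eq_mul, Nat.cast_smul_eq_nsmul]
    rw [e, map_smul, smul_eq_mul]
    exact h.congr_deriv (by ring)

theorem central_of_coeff_poly {p : S[X]} (h : ∀ n b, p.coeff n * b = b * p.coeff n) (q : S[X]) :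
    p * q = q * p := by
  ext n
  rw [coeff_mul, coeff_mul, ← Finset.Nat.sum_antidiagonal_swap]
  exact Finset.sum_congr rfl fun x _ => h _ _

/-- A path whose points are the values of a polynomial. -/
def IsPolyPath (f : ℝ → S) : Prop := ∃ p : S[X], ∀ t, f t = polyEval t p

namespace IsPolyPath

theorem map {f : ℝ → S} (hf : IsPolyPath f) (g : S →ₗ[ℝ] S') : IsPolyPath fun t => g (f t) := by
  obtain ⟨p, hp⟩ := hf
  exact ⟨polyLift g p, fun t => by simp only [hp, polyEval_polyLift]⟩

theorem mul {f g : ℝ → S} (hf : IsPolyPath f) (hg : IsPolyPath g) :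
    IsPolyPath fun t => f t * g t := by
  obtain ⟨p, hp⟩ := hf
  obtain ⟨q, hq⟩ := hg
  exact ⟨p * q, fun t => by simp only [hp, hq, map_mul]⟩

theorem add {f g : ℝ → S} (hf : IsPolyPath f) (hg : IsPolyPath g) :
    IsPolyPath fun t => f t + g t := by
  obtain ⟨p, hp⟩ := hf
  obtain ⟨q, hq⟩ := hg
  exact ⟨p + q, fun t => by simp only [hp, hq, map_add]⟩

theorem smul {f : ℝ → S} (hf : IsPolyPath f) (x : ℝ) : IsPolyPath fun t => x • f t :=
  hf.map (x • LinearMap.id)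

theorem zero : IsPolyPath fun _ => (0 : S) := ⟨0, fun t => by rw [map_zero]⟩

theorem sum {α : Type*} {s : Finset α} {f : α → ℝ → S} (hf : ∀ a ∈ s, IsPolyPath (f a)) :
    IsPolyPath fun t => ∑ a ∈ s, f a t := by
  classical
  induction s using Finset.induction_on with
  | empty => simpa using zero
  | insert a s ha ih =>
    simp only [Finset.sum_insert ha]
    exact (hf a (Finset.mem_insert_self a s)).add
      (ih fun b hb => hf b (Finset.mem_insert_of_mem hb))

theorem contDiff {f : ℝ → S} (hf : IsPolyPath f) (φ : S →ₗ[ℝ] ℝ) :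
    ContDiff ℝ ∞ fun t => φ (f t) := by
  obtain ⟨p, hp⟩ := hf
  simp only [hp]
  clear hp
  induction p using Polynomial.induction_on' with
  | add p q hp hq =>
    simp only [map_add]
    exact hp.add hq
  | monomial n a =>
    simp only [polyEval_monomial, map_smul, smul_eq_mul]
    exact (contDiff_id.pow n).mul contDiff_const

end IsPolyPath

end PolynomialPaths

/-! ### Power series in two variables -/

section DoubleSeries

variable {S S' : Type*} [Ring S] [Algebra ℝ S] [Ring S'] [Algebra ℝ S']

theorem liftPS_derivation {δ : S →ₗ[ℝ] S} (h : ∀ a b, δ (a * b) = δ a * b + a * δ b)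
    (a b : PowerSeries S) : liftPS δ (a * b) = liftPS δ a * b + a * liftPS δ b := by
  have h1 := liftPS_mul δ LinearMap.id h a b
  have h2 : liftPS (LinearMap.id : S →ₗ[ℝ] S) a = a := by ext n; simp
  rwa [h2] at h1

/-- A ring homomorphism acting on the coefficients of series in two variables. -/
def mapPS (φ : S →+* S') : PowerSeries (PowerSeries S) →+* PowerSeries (PowerSeries S') :=
  PowerSeries.map (PowerSeries.map φ)

@[simp] theorem coeff_mapPS (φ : S →+* S') (f : PowerSeries (PowerSeries S)) (k j : ℕ) :
    PowerSeries.coeff j (PowerSeries.coeff k (mapPS φ f)) =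
      φ (PowerSeries.coeff j (PowerSeries.coeff k f)) := by
  rw [mapPS, PowerSeries.coeff_map, PowerSeries.coeff_map]

theorem logSeries_mapPS (φ : S →+* S') (hφ : ∀ (x : ℝ) a, φ (x • a) = x • φ a)
    (Z : PowerSeries (PowerSeries S)) : logSeries (mapPS φ Z) = mapPS φ (logSeries Z) :=
  logSeries_map _ (fun x a => by
    ext n
    rw [PowerSeries.coeff_map, coeff_real_smul, hφ, coeff_real_smul, PowerSeries.coeff_map]) Z

theorem coeff_zero_mapPS {φ : S →+* S'} {Z : PowerSeries (PowerSeries S)}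
    (hZ : PowerSeries.coeff 0 Z = 1) : PowerSeries.coeff 0 (mapPS φ Z) = 1 := by
  rw [mapPS, PowerSeries.coeff_map, hZ, map_one]

theorem ext_coeff_coeff {f g : PowerSeries (PowerSeries S)}
    (h : ∀ k j, PowerSeries.coeff j (PowerSeries.coeff k f) =
      PowerSeries.coeff j (PowerSeries.coeff k g)) : f = g := by
  ext k j; exact h k j

theorem coeff_coeff_smul (x : ℝ) (f : PowerSeries (PowerSeries S)) (k j : ℕ) :
    PowerSeries.coeff j (PowerSeries.coeff k (x • f)) =
      x • PowerSeries.coeff j (PowerSeries.coeff k f) := by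
  rw [coeff_real_smul, coeff_real_smul]

namespace TwistedDerivations

variable {X : Type*} [Fintype X] (T : TwistedDerivations X S)

theorem coeff_coeff_der (x : X) (f : PowerSeries (PowerSeries S)) (k j : ℕ) :
    PowerSeries.coeff j (PowerSeries.coeff k (T.powerSeries.powerSeries.der x f)) =
      T.der x (PowerSeries.coeff j (PowerSeries.coeff k f)) := by
  simp only [powerSeries, coeff_liftPS]

theorem coeff_coeff_tw (x : X) (f : PowerSeries (PowerSeries S)) (k j : ℕ) :
    PowerSeries.coeff j (PowerSeries.coeff k (T.powerSeries.powerSeries.tw x f)) =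
      T.tw x (PowerSeries.coeff j (PowerSeries.coeff k f)) := by
  simp only [powerSeries, coeff_liftPS]

theorem sec_hVar_mul (B : Matrix X X ℝ) (f : PowerSeries (PowerSeries S)) :
    T.powerSeries.powerSeries.sec B (hVar S * f) =
      hVar S * T.powerSeries.powerSeries.sec B f := by
  refine ext_coeff_coeff fun k j => ?_
  rw [coeff_coeff_sec]
  cases j with
  | zero => rw [coeff_zero_hVar_mul, coeff_zero_hVar_mul, map_zero]
  | succ j => rw [coeff_succ_hVar_mul, coeff_succ_hVar_mul, coeff_coeff_sec]

theorem bil_eq_bracket {B : Matrix X X ℝ} (hB : B.IsSymm) {w : S}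
    (hw : ∀ x y, B x y ≠ 0 → T.tw x (T.der y w) = T.der y w) : T.bil B w w = T.bracket B w w := by
  rw [bil, bracket, Finset.sum_comm]
  refine Finset.sum_congr rfl fun y _ => Finset.sum_congr rfl fun x _ => ?_
  by_cases h : B x y = 0
  · rw [h, ← hB.apply, h, zero_smul, zero_smul]
  · rw [hw x y h, hB.apply]

end TwistedDerivations

end DoubleSeries

theorem SuperCalculus.mem_hom_congr {X : Type*} [DecidableEq X] {gh : X → ℤ} {S : Type*} [Ring S]
    [Algebra ℝ S] (c : SuperCalculus gh S) {n m g k : ℤ} (h1 : n = m) (h2 : g = k) {f : S}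
    (hf : f ∈ c.hom n g) : f ∈ c.hom m k := h1 ▸ h2 ▸ hf

/-! ### The partition series along a path of propagators -/

namespace EffectiveFlow

variable {X Y S S' : Type*} [DecidableEq X] [Fintype X] [DecidableEq Y] [Fintype Y]
  {gh : X → ℤ} {gh' : Y → ℤ} [Ring S] [Algebra ℝ S] [Ring S'] [Algebra ℝ S']
  {c : SuperCalculus gh S} {c' : SuperCalculus gh' S'} {r : S →ₐ[ℝ] S'}
  {A₀ A₁ Λ : Matrix X X ℝ} {B : Matrix Y Y ℝ} {u : S}

/-- The operator of the propagator `A₀ + X A₁`, where `X` is the variable of the polynomials. -/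
def pathOp (c : SuperCalculus gh S) (A₀ A₁ : Matrix X X ℝ) :
    Module.End ℝ (Polynomial S) :=
  polyLift (c.sec A₀) + LinearMap.mulLeft ℝ Polynomial.X ∘ₗ polyLift (c.sec A₁)

theorem pathOp_apply (p : Polynomial S) :
    pathOp c A₀ A₁ p = polyLift (c.sec A₀) p + Polynomial.X * polyLift (c.sec A₁) p := rfl

theorem polyEval_pathOp (t : ℝ) (p : Polynomial S) :
    polyEval t (pathOp c A₀ A₁ p) = c.sec (A₀ + t • A₁) (polyEval t p) := by
  rw [pathOp_apply, map_add, map_mul, polyEval_X, polyEval_polyLift, polyEval_polyLift,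
    c.sec_add, c.sec_smul, LinearMap.add_apply, LinearMap.smul_apply, Algebra.smul_def]

theorem polyEval_pathOp_pow (t : ℝ) (j : ℕ) (p : Polynomial S) :
    polyEval t ((pathOp c A₀ A₁ ^ j) p) = (c.sec (A₀ + t • A₁) ^ j) (polyEval t p) := by
  induction j with
  | zero => rfl
  | succ j ih =>
    rw [pow_succ', pow_succ', Module.End.mul_apply, Module.End.mul_apply, polyEval_pathOp, ih]

theorem polyDeriv_pathOp (p : Polynomial S) : polyDeriv (pathOp c A₀ A₁ p) =
    pathOp c A₀ A₁ (polyDeriv p) + polyLift (c.sec A₁) p := by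
  have h : ∀ (f : S →ₗ[ℝ] S) p, polyDeriv (polyLift f p) = polyLift f (polyDeriv p) := by
    intro f p
    ext n
    rw [polyDeriv_apply, polyDeriv_apply, Polynomial.coeff_derivative, coeff_polyLift,
      coeff_polyLift, Polynomial.coeff_derivative, ← Nat.cast_succ, ← Nat.cast_comm,
      ← Nat.cast_comm, ← nsmul_eq_mul, ← nsmul_eq_mul, map_nsmul]
  rw [pathOp_apply, pathOp_apply, map_add, h, ← h (c.sec A₁)]
  rw [polyDeriv_apply (_ * _), Polynomial.derivative_mul, Polynomial.derivative_X, one_mul,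
    ← polyDeriv_apply]
  abel

variable (H : EffectiveFlow c c' r A₀ A₁ Λ B u)
include H

theorem ghost_path (t : ℝ) (x y : X) (h : (A₀ + t • A₁) x y ≠ 0) : gh x + gh y = 0 := by
  by_contra hc
  have h0 : A₀ x y = 0 := by by_contra h0; exact hc (H.ghost₀ x y h0)
  have h1 : A₁ x y = 0 := by by_contra h1; exact hc (H.ghost₁ x y h1)
  exact h (by rw [Matrix.add_apply, Matrix.smul_apply, h0, h1, smul_zero, add_zero])

theorem polyDeriv_pathOp_pow (j : ℕ) (v : S) :
    polyDeriv ((pathOp c A₀ A₁ ^ j) (Polynomial.C v)) =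
      (j : ℝ) • polyLift (c.sec A₁) ((pathOp c A₀ A₁ ^ (j - 1)) (Polynomial.C v)) := by
  refine apply_iterate (Δ := 0) (fun f => ?_) (fun f => ?_) (fun f => ?_) ?_ ?_ j
  · rw [polyDeriv_pathOp, LinearMap.zero_apply, sub_zero]
  · rw [LinearMap.zero_apply, LinearMap.zero_apply, map_zero]
  · have hX : ∀ f p, polyLift (c.sec f) (Polynomial.X * p) =
        Polynomial.X * polyLift (c.sec f) p := by
      intro f p
      ext n
      rw [coeff_polyLift]
      cases n with
      | zero => rw [Polynomial.coeff_X_mul_zero, Polynomial.coeff_X_mul_zero, map_zero]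
      | succ n => rw [Polynomial.coeff_X_mul, Polynomial.coeff_X_mul, coeff_polyLift]
    rw [pathOp_apply, pathOp_apply, map_add, hX]
    congr 1
    ext n
    simp only [coeff_polyLift]
    exact c.sec_comm_of_even (fun x y h => by rw [H.ghost₀ x y h]; decide) _ _
  · rw [polyDeriv_apply, Polynomial.derivative_C]
  · rfl

theorem coeff_pathOp_pow_mem (j k n : ℕ) :
    ((pathOp c A₀ A₁ ^ j) (Polynomial.C u ^ k)).coeff n ∈ c.hom (3 * k - 2 * j) 0 := by
  induction j generalizing n with
  | zero =>
    rw [pow_zero, Module.End.one_apply, ← map_pow, Polynomial.coeff_C]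
    split_ifs
    · have := c.pow_mem_hom H.interaction k
      convert this using 2
      push_cast; ring
    · exact zero_mem _
  | succ j ih =>
    have h0 := fun n => c.sec_mem_hom H.ghost₀ (ih n)
    have h1 := fun n => c.sec_mem_hom H.ghost₁ (ih n)
    have e : (3 * (k : ℤ) - 2 * (j : ℕ) - 2) = 3 * k - 2 * ((j + 1 : ℕ) : ℤ) := by push_cast; ring
    simp only [e, sub_self] at h0 h1
    rw [pow_succ', Module.End.mul_apply, pathOp_apply, Polynomial.coeff_add, coeff_polyLift]
    refine add_mem (h0 n) ?_
    cases n with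
    | zero => rw [Polynomial.coeff_X_mul_zero]; exact zero_mem _
    | succ n => rw [Polynomial.coeff_X_mul, coeff_polyLift]; exact h1 n

omit H

/-- The series `exp (h P) exp (μ u)` of the propagator `A₀ + t A₁`. -/
def fullSeries (c : SuperCalculus gh S) (A₀ A₁ : Matrix X X ℝ) (u : S) (t : ℝ) :
    PowerSeries (PowerSeries S) := expSeries (c.sec (A₀ + t • A₁)) u

/-- The same series, with polynomials in `t` as coefficients. -/
def polySeries (c : SuperCalculus gh S) (A₀ A₁ : Matrix X X ℝ) (u : S) :
    PowerSeries (PowerSeries (Polynomial S)) := expSeries (pathOp c A₀ A₁) (Polynomial.C u)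

theorem mapPS_polyEval (t : ℝ) :
    mapPS (polyEval t) (polySeries c A₀ A₁ u) = fullSeries c A₀ A₁ u t := by
  refine ext_coeff_coeff fun k j => ?_
  rw [coeff_mapPS, polySeries, fullSeries, coeff_expSeries, coeff_expSeries, polyEval_smul,
    polyEval_pathOp_pow, map_pow, polyEval_C]

theorem logSeries_fullSeries (t : ℝ) : logSeries (fullSeries c A₀ A₁ u t) =
    mapPS (polyEval t) (logSeries (polySeries c A₀ A₁ u)) := by
  rw [← mapPS_polyEval, logSeries_mapPS _ (fun x a => polyEval_smul x t a)]

/-- The restriction of the series to the zero-modes. -/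
def series (r : S →ₐ[ℝ] S') (c : SuperCalculus gh S) (A₀ A₁ : Matrix X X ℝ) (u : S) (t : ℝ) :
    PowerSeries (PowerSeries S') := mapPS (r : S →+* S') (fullSeries c A₀ A₁ u t)

theorem logSeries_series (t : ℝ) : logSeries (series r c A₀ A₁ u t) =
    mapPS (r : S →+* S') (logSeries (fullSeries c A₀ A₁ u t)) :=
  logSeries_mapPS _ (fun x a => map_smul r x a) _

/-- The generator `½ h r (∑ Λ (∂∂w + ∂w ∂w))`, where `w` is the logarithm of the full series. -/
def generator (r : S →ₐ[ℝ] S') (c : SuperCalculus gh S) (A₀ A₁ Λ : Matrix X X ℝ) (u : S) (t : ℝ) :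
    PowerSeries (PowerSeries S') :=
  (1 / 2 : ℝ) • (hVar S' * mapPS (r : S →+* S')
    (c.toTwisted.powerSeries.powerSeries.sec Λ (logSeries (fullSeries c A₀ A₁ u t)) +
      c.toTwisted.powerSeries.powerSeries.bil Λ (logSeries (fullSeries c A₀ A₁ u t))
        (logSeries (fullSeries c A₀ A₁ u t))))

theorem coeff_zero_fullSeries (t : ℝ) : PowerSeries.coeff 0 (fullSeries c A₀ A₁ u t) = 1 :=
  expSeries_zero (c.sec_one _) u

theorem coeff_zero_series (t : ℝ) : PowerSeries.coeff 0 (series r c A₀ A₁ u t) = 1 :=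
  coeff_zero_mapPS (coeff_zero_fullSeries t)

include H

theorem coeff_fullSeries_mem (t : ℝ) (k j : ℕ) :
    PowerSeries.coeff j (PowerSeries.coeff k (fullSeries c A₀ A₁ u t)) ∈
      c.hom (3 * k - 2 * j) 0 :=
  c.coeff_expSeries_mem_hom (H.ghost_path t) H.interaction k j

theorem coeff_log_fullSeries_mem (t : ℝ) (k j : ℕ) :
    PowerSeries.coeff j (PowerSeries.coeff k (logSeries (fullSeries c A₀ A₁ u t))) ∈
      c.hom (3 * k - 2 * j) 0 :=
  c.coeff_log_mem_hom (H.coeff_fullSeries_mem t) k j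

theorem coeff_series_mem (t : ℝ) (k j : ℕ) :
    PowerSeries.coeff j (PowerSeries.coeff k (series r c A₀ A₁ u t)) ∈
      c'.hom (3 * k - 2 * j) 0 := by
  rw [series, coeff_mapPS]
  exact H.map_hom _ _ _ (H.coeff_fullSeries_mem t k j)

theorem coeff_log_series_mem (t : ℝ) (k j : ℕ) :
    PowerSeries.coeff j (PowerSeries.coeff k (logSeries (series r c A₀ A₁ u t))) ∈
      c'.hom (3 * k - 2 * j) 0 :=
  c'.coeff_log_mem_hom (H.coeff_series_mem t) k j

theorem coeff_log_fullSeries_eq_zero (t : ℝ) {k j : ℕ} (hjk : j + 1 < k) :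
    PowerSeries.coeff j (PowerSeries.coeff k (logSeries (fullSeries c A₀ A₁ u t))) = 0 :=
  c.toTwisted.coeff_log_expSeries_eq_zero (c.sec_one _)
    (fun k j x => c.twist_ghost_zero (H.coeff_fullSeries_mem t k j) x)
    (fun x => c.twist_ghost_zero H.interaction x) hjk

theorem coeff_log_series_eq_zero (t : ℝ) {k j : ℕ} (hjk : j + 1 < k) :
    PowerSeries.coeff j (PowerSeries.coeff k (logSeries (series r c A₀ A₁ u t))) = 0 := by
  rw [logSeries_series, coeff_mapPS, H.coeff_log_fullSeries_eq_zero t hjk, map_zero]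

theorem coeff_generator_mem (t : ℝ) (k j : ℕ) :
    PowerSeries.coeff j (PowerSeries.coeff k (generator r c A₀ A₁ Λ u t)) ∈
      c'.hom (3 * k - 2 * j) (-1) := by
  rw [generator, coeff_coeff_smul]
  refine Submodule.smul_mem _ _ ?_
  cases j with
  | zero => rw [coeff_zero_hVar_mul]; exact zero_mem _
  | succ j =>
    rw [coeff_succ_hVar_mul, coeff_mapPS]
    refine H.map_hom _ _ _ ?_
    rw [map_add, map_add, TwistedDerivations.coeff_coeff_sec, TwistedDerivations.coeff_coeff_bil]
    refine add_mem ?_ (Submodule.sum_mem _ fun p hp => Submodule.sum_mem _ fun q hq => ?_)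
    · exact c.mem_hom_congr (by push_cast; ring) (by norm_num)
        (c.sec_mem_hom H.ghost_generator (H.coeff_log_fullSeries_mem t k j))
    · rw [Finset.HasAntidiagonal.mem_antidiagonal] at hp hq
      refine Submodule.sum_mem _ fun x _ => Submodule.sum_mem _ fun y _ => ?_
      by_cases hxy : Λ x y = 0
      · rw [hxy, zero_smul]; exact zero_mem _
      refine Submodule.smul_mem _ _ ?_
      have h1 := c.der_mem_hom y (H.coeff_log_fullSeries_mem t p.1 q.1)
      have h2 := c.der_mem_hom x (H.coeff_log_fullSeries_mem t p.2 q.2)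
      have h3 : c.tw x (c.der y
          (PowerSeries.coeff q.1 (PowerSeries.coeff p.1 (logSeries (fullSeries c A₀ A₁ u t))))) =
          c.der y
          (PowerSeries.coeff q.1 (PowerSeries.coeff p.1 (logSeries (fullSeries c A₀ A₁ u t)))) := by
        rw [c.tw_der, c.twist_ghost_zero (H.coeff_log_fullSeries_mem t p.1 q.1), koszul_eq_one,
          one_smul]
        rw [H.ghost_generator x y hxy]; decide
      have h4 := c.mul_mem_hom h1 h2
      rw [← h3] at h4
      refine c.mem_hom_congr ?_ ?_ h4
      · rw [← hp, ← hq]; push_cast; ring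
      · have := H.ghost_generator x y hxy
        omega

theorem coeff_generator_eq_zero (t : ℝ) {k j : ℕ} (hjk : j + 1 < k) :
    PowerSeries.coeff j (PowerSeries.coeff k (generator r c A₀ A₁ Λ u t)) = 0 := by
  rw [generator, coeff_coeff_smul]
  cases j with
  | zero => rw [coeff_zero_hVar_mul, smul_zero]
  | succ j =>
    rw [coeff_succ_hVar_mul, coeff_mapPS, map_add, map_add, TwistedDerivations.coeff_coeff_sec,
      TwistedDerivations.coeff_coeff_bil, H.coeff_log_fullSeries_eq_zero t (by omega), map_zero,
      zero_add, Finset.sum_eq_zero, map_zero, smul_zero]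
    intro p hp
    refine Finset.sum_eq_zero fun q hq => ?_
    rw [Finset.HasAntidiagonal.mem_antidiagonal] at hp hq
    by_cases hc : q.1 + 1 < p.1
    · rw [H.coeff_log_fullSeries_eq_zero t hc, TwistedDerivations.bil_zero_left]
    · rw [H.coeff_log_fullSeries_eq_zero t (show q.2 + 1 < p.2 by omega),
        TwistedDerivations.bil_zero_right]

omit H

theorem coeff_zero_generator (t : ℝ) :
    PowerSeries.coeff 0 (generator r c A₀ A₁ Λ u t) = 0 := by
  ext j
  rw [generator, coeff_coeff_smul, map_zero]
  cases j with
  | zero => rw [coeff_zero_hVar_mul, smul_zero]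
  | succ j =>
    rw [coeff_succ_hVar_mul, coeff_mapPS, map_add, map_add, TwistedDerivations.coeff_coeff_sec,
      TwistedDerivations.coeff_coeff_bil, coeff_zero_logSeries, map_zero, map_zero, zero_add,
      Finset.sum_eq_zero, map_zero, smul_zero]
    intro p hp
    refine Finset.sum_eq_zero fun q _ => ?_
    rw [Finset.HasAntidiagonal.mem_antidiagonal, add_eq_zero] at hp
    rw [hp.1, coeff_zero_logSeries, map_zero, TwistedDerivations.bil_zero_left]

theorem isPolyPath_log_fullSeries (k j : ℕ) : IsPolyPath fun t =>
    PowerSeries.coeff j (PowerSeries.coeff k (logSeries (fullSeries c A₀ A₁ u t))) :=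
  ⟨PowerSeries.coeff j (PowerSeries.coeff k (logSeries (polySeries c A₀ A₁ u))), fun t => by
    simp only [logSeries_fullSeries, coeff_mapPS]⟩

theorem isPolyPath_generator (k j : ℕ) : IsPolyPath fun t =>
    PowerSeries.coeff j (PowerSeries.coeff k (generator r c A₀ A₁ Λ u t)) := by
  simp only [generator, coeff_coeff_smul]
  refine IsPolyPath.smul ?_ _
  cases j with
  | zero => simp only [coeff_zero_hVar_mul]; exact IsPolyPath.zero
  | succ j =>
    simp only [coeff_succ_hVar_mul, coeff_mapPS, map_add, TwistedDerivations.coeff_coeff_sec,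
      TwistedDerivations.coeff_coeff_bil]
    refine IsPolyPath.add (((isPolyPath_log_fullSeries k j).map _).map r.toLinearMap) ?_
    refine IsPolyPath.map (IsPolyPath.sum fun p _ => IsPolyPath.sum fun q _ => ?_) r.toLinearMap
    exact IsPolyPath.sum fun x _ => IsPolyPath.sum fun y _ => IsPolyPath.smul (IsPolyPath.mul
      (((isPolyPath_log_fullSeries p.1 q.1).map _).map _)
      ((isPolyPath_log_fullSeries p.2 q.2).map _)) _

theorem isPolyPath_log_series (k j : ℕ) : IsPolyPath fun t =>
    PowerSeries.coeff j (PowerSeries.coeff k (logSeries (series r c A₀ A₁ u t))) := by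
  simp only [logSeries_series, coeff_mapPS]
  exact (isPolyPath_log_fullSeries k j).map r.toLinearMap

end EffectiveFlow

/-! ### The quantum master equation and the flow equation -/

namespace EffectiveFlow

variable {X Y S S' : Type*} [DecidableEq X] [Fintype X] [DecidableEq Y] [Fintype Y]
  {gh : X → ℤ} {gh' : Y → ℤ} [Ring S] [Algebra ℝ S] [Ring S'] [Algebra ℝ S']
  {c : SuperCalculus gh S} {c' : SuperCalculus gh' S'} {r : S →ₐ[ℝ] S'}
  {A₀ A₁ Λ : Matrix X X ℝ} {B : Matrix Y Y ℝ} {u : S}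
  (H : EffectiveFlow c c' r A₀ A₁ Λ B u)
include H

theorem odd_poisson (x y : Y) (h : B x y ≠ 0) : Odd (gh' x + gh' y) := by
  rw [H.ghost_poisson x y h]; decide

theorem even_series (t : ℝ) (x : Y) :
    c'.toTwisted.powerSeries.powerSeries.tw x (series r c A₀ A₁ u t) = series r c A₀ A₁ u t :=
  c'.toTwisted.tw_tw_of_coeff (fun k j x => c'.twist_ghost_zero (H.coeff_series_mem t k j) x) x

theorem der_log_series_mul (t : ℝ) (x : Y) :
    c'.toTwisted.powerSeries.powerSeries.der x (logSeries (series r c A₀ A₁ u t)) *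
      series r c A₀ A₁ u t =
      c'.toTwisted.powerSeries.powerSeries.der x (series r c A₀ A₁ u t) :=
  c'.toTwisted.powerSeries.der_logSeries_mul (coeff_zero_series t) (H.even_series t) x

/-- An odd bivector does not see the twist of a first derivative of an even function. -/
theorem tw_der_of_even {f : PowerSeries (PowerSeries S')}
    (hf : ∀ k j : ℕ, PowerSeries.coeff j (PowerSeries.coeff k f) ∈ c'.hom (3 * k - 2 * j) 0)
    (x y : Y) (hxy : B x y ≠ 0) : c'.toTwisted.powerSeries.powerSeries.tw x
      (c'.toTwisted.powerSeries.powerSeries.der y f) =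
      c'.toTwisted.powerSeries.powerSeries.der y f := by
  refine ext_coeff_coeff fun k j => ?_
  rw [TwistedDerivations.coeff_coeff_tw, TwistedDerivations.coeff_coeff_der]
  change c'.tw x (c'.der y _) = c'.der y _
  rw [c'.tw_der, c'.twist_ghost_zero (hf k j), koszul_eq_one _ (H.odd_poisson x y hxy), one_smul]

theorem sec_series (t : ℝ) :
    c'.toTwisted.powerSeries.powerSeries.sec B (series r c A₀ A₁ u t) = 0 := by
  refine ext_coeff_coeff fun k j => ?_
  rw [TwistedDerivations.coeff_coeff_sec, series, coeff_mapPS, fullSeries, coeff_expSeries]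
  have := H.master t j k
  rw [RingHom.coe_coe, map_smul, map_smul]
  exact smul_eq_zero_of_right _ this

/-- The quantum master equation. -/
theorem quantum_master (t : ℝ) :
    c'.toTwisted.powerSeries.powerSeries.sec B (logSeries (series r c A₀ A₁ u t)) +
      c'.toTwisted.powerSeries.powerSeries.bracket B (logSeries (series r c A₀ A₁ u t))
        (logSeries (series r c A₀ A₁ u t)) = 0 := by
  have h := c'.toTwisted.powerSeries.powerSeries.sec_of_der_eq (H.der_log_series_mul t) B
  rw [H.sec_series t, TwistedDerivations.bil_eq_bracket _ H.symm
    (H.tw_der_of_even (H.coeff_log_series_mem t))] at h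
  exact mul_right_cancel_series (coeff_zero_series t) (by rw [← h, zero_mul])

theorem generator_mul_series (t : ℝ) : generator r c A₀ A₁ Λ u t * series r c A₀ A₁ u t =
    (1 / 2 : ℝ) • (hVar S' * mapPS (r : S →+* S')
      (c.toTwisted.powerSeries.powerSeries.sec Λ (fullSeries c A₀ A₁ u t))) := by
  have h := c.toTwisted.powerSeries.powerSeries.sec_of_der_eq
    (c.toTwisted.powerSeries.der_logSeries_mul (coeff_zero_fullSeries t)
      (c.toTwisted.tw_tw_of_coeff fun k j x =>
        c.twist_ghost_zero (H.coeff_fullSeries_mem t k j) x)) Λ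
  rw [h, map_mul, generator, smul_mul_assoc, mul_assoc]
  rfl

/-- The derivative in `t` of the restricted series. -/
theorem polyEval_deriv_polySeries (t : ℝ) :
    mapPS (polyEval t) (liftPS (liftPS polyDeriv)
      (mapPS (Polynomial.mapRingHom (r : S →+* S')) (polySeries c A₀ A₁ u))) =
    (1 / 4 : ℝ) • (hVar S' * (hVar S' * c'.toTwisted.powerSeries.powerSeries.sec B
      (mapPS (r : S →+* S')
        (c.toTwisted.powerSeries.powerSeries.sec Λ (fullSeries c A₀ A₁ u t))))) := by
  refine ext_coeff_coeff fun k j => ?_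
  have h1 : PowerSeries.coeff j (PowerSeries.coeff k (mapPS (polyEval t) (liftPS (liftPS polyDeriv)
      (mapPS (Polynomial.mapRingHom (r : S →+* S')) (polySeries c A₀ A₁ u))))) =
      (1 / ((j.factorial : ℝ) * (k.factorial : ℝ)) * j) •
        r (c.sec A₁ ((c.sec (A₀ + t • A₁) ^ (j - 1)) (u ^ k))) := by
    rw [coeff_mapPS, coeff_liftPS, coeff_liftPS, coeff_mapPS, polyDeriv_mapRingHom,
      polyEval_mapRingHom, polySeries, coeff_expSeries, map_smul, ← map_pow,
      H.polyDeriv_pathOp_pow, polyEval_smul, polyEval_smul, polyEval_polyLift,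
      polyEval_pathOp_pow, polyEval_C, smul_smul, map_smul]
  rw [h1, H.flow, coeff_coeff_smul]
  match j with
  | 0 => rw [coeff_zero_hVar_mul]; simp
  | 1 => rw [coeff_succ_hVar_mul, coeff_zero_hVar_mul]; simp
  | j + 2 =>
    rw [coeff_succ_hVar_mul, coeff_succ_hVar_mul, TwistedDerivations.coeff_coeff_sec, coeff_mapPS,
      TwistedDerivations.coeff_coeff_sec, fullSeries, coeff_expSeries, map_smul, RingHom.coe_coe,
      map_smul, map_smul, smul_smul, smul_smul]
    change _ • c'.sec B _ = _ • c'.sec B _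
    congr 1
    rw [Nat.factorial_succ (j + 1), Nat.factorial_succ j]
    have := Nat.factorial_ne_zero j
    have := Nat.factorial_ne_zero k
    push_cast
    field_simp
    ring

/-- The derivative in `t` of the logarithm of the restricted series is the infinitesimal canonical
transformation by the generator. -/
theorem deriv_log_series (t : ℝ) :
    mapPS (polyEval t) (liftPS (liftPS polyDeriv) (logSeries
      (mapPS (Polynomial.mapRingHom (r : S →+* S')) (polySeries c A₀ A₁ u)))) =
    hVar S' * ((1 / 2 : ℝ) • c'.toTwisted.powerSeries.powerSeries.sec B (generator r c A₀ A₁ Λ u t) +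
      c'.toTwisted.powerSeries.powerSeries.bracket B (logSeries (series r c A₀ A₁ u t))
        (generator r c A₀ A₁ Λ u t)) := by
  set T := c'.toTwisted.powerSeries.powerSeries with hT
  set b := generator r c A₀ A₁ Λ u t with hb
  set Z := series r c A₀ A₁ u t with hZ
  set V := mapPS (Polynomial.mapRingHom (r : S →+* S')) (polySeries c A₀ A₁ u) with hV
  have hV0 : PowerSeries.coeff 0 V = 1 := by
    refine coeff_zero_mapPS (expSeries_zero (u := Polynomial.C u) ?_)
    have hone : ∀ A, polyLift (c.sec A) 1 = 0 := fun A => by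
      rw [← Polynomial.monomial_zero_one, polyLift_monomial, c.sec_one, map_zero]
    rw [pathOp_apply, hone, hone, mul_zero, add_zero]
  have hVc : ∀ f, V * f = f * V := by
    refine central_of_coeff fun k f => central_of_coeff (fun j q => central_of_coeff_poly
      (fun n a => ?_) q) f
    refine c'.commute_of_tw_eq (c'.twist_ghost_zero (n := 3 * k - 2 * j) ?_) a
    rw [hV, coeff_mapPS, Polynomial.coe_mapRingHom, Polynomial.coeff_map]
    refine H.map_hom _ _ _ ?_
    rw [polySeries, coeff_expSeries, Polynomial.coeff_smul]
    exact Submodule.smul_mem _ _ (H.coeff_pathOp_pow_mem j k n)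
  have hVZ : mapPS (polyEval t) V = Z := by
    refine ext_coeff_coeff fun k j => ?_
    rw [hZ, series, ← mapPS_polyEval, hV]
    simp only [coeff_mapPS]
    exact polyEval_mapRingHom r t _
  have hZc : ∀ f, Z * f = f * Z := T.central Z (H.even_series t)
  have hd : ∀ p q : Polynomial S', polyDeriv (p * q) = polyDeriv p * q + p * polyDeriv q :=
    fun p q => Polynomial.derivative_mul
  have hlog := derivation_logSeries_mul hV0 hVc (liftPS (liftPS polyDeriv)) (liftPS_order _)
    (fun f => liftPS_derivation (liftPS_derivation hd) V f)
  have h1 := congrArg (mapPS (polyEval t)) hlog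
  rw [map_mul, hVZ, H.polyEval_deriv_polySeries] at h1
  refine mul_right_cancel_series (coeff_zero_series (r := r) (c := c) (A₀ := A₀) (A₁ := A₁)
    (u := u) t) (h1.trans ?_)
  -- `h² L V` is `2 h b Z`, and the Laplacian of `Z b` is `Z (Δ b + {w, b})`
  have h2 : (1 / 4 : ℝ) • (hVar S' * (hVar S' * T.sec B (mapPS (r : S →+* S')
      (c.toTwisted.powerSeries.powerSeries.sec Λ (fullSeries c A₀ A₁ u t))))) =
      (1 / 2 : ℝ) • (hVar S' * T.sec B (Z * b)) := by
    rw [hZc, hb, hZ, H.generator_mul_series, map_smul, mul_smul_comm, smul_smul, hT,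
      TwistedDerivations.sec_hVar_mul]
    norm_num
  have h3 := T.sec_mul H.symm (b := b) (H.even_series t)
    (H.tw_der_of_even (H.coeff_series_mem t))
  have h4 : T.bracket B Z b = T.bracket B (logSeries Z) b * Z := by
    simp only [TwistedDerivations.bracket, Finset.sum_mul]
    refine Finset.sum_congr rfl fun x _ => Finset.sum_congr rfl fun y _ => ?_
    rw [← H.der_log_series_mul t x, smul_mul_assoc, mul_assoc, hZc, mul_assoc]
  rw [h2, h3, H.sec_series t, zero_mul, zero_add, h4, hZc, ← smul_mul_assoc (2 : ℝ) _ Z, ← add_mul,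
    ← mul_assoc, ← smul_mul_assoc, ← mul_smul_comm]
  congr 2
  module

theorem hasDerivAt_log_series (φ : S' →ₗ[ℝ] ℝ) (k j : ℕ) (t : ℝ) :
    HasDerivAt (fun s => φ (PowerSeries.coeff j (PowerSeries.coeff k
      (logSeries (series r c A₀ A₁ u s)))))
      (φ (PowerSeries.coeff j (PowerSeries.coeff k (hVar S' *
        ((1 / 2 : ℝ) • c'.toTwisted.powerSeries.powerSeries.sec B (generator r c A₀ A₁ Λ u t) +
        c'.toTwisted.powerSeries.powerSeries.bracket B (logSeries (series r c A₀ A₁ u t))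
          (generator r c A₀ A₁ Λ u t)))))) t := by
  rw [← H.deriv_log_series]
  have h : ∀ s, logSeries (series r c A₀ A₁ u s) = mapPS (polyEval s) (logSeries
      (mapPS (Polynomial.mapRingHom (r : S →+* S')) (polySeries c A₀ A₁ u))) := fun s => by
    rw [← logSeries_mapPS _ (fun x a => polyEval_smul x s a)]
    congr 1
    rw [series, ← mapPS_polyEval]
    refine ext_coeff_coeff fun k j => ?_
    simp only [coeff_mapPS]
    exact (polyEval_mapRingHom r s _).symm
  simp only [h, coeff_mapPS, coeff_liftPS]
  exact hasDerivAt_polyEval φ _ t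

end EffectiveFlow

/-! ### From series in the number of vertices to formal functions -/

section Formal

/-- A series in `μ` and `h` of connected diagrams: the coefficient of `μ^k h^j` has polynomial
degree `3 k - 2 j`, and `j ≥ k - 1`. -/
structure IsConnectedSeries {X S : Type*} [DecidableEq X] {gh : X → ℤ} [Ring S] [Algebra ℝ S]
    (c : SuperCalculus gh S) (g : ℤ) (a : PowerSeries (PowerSeries S)) : Prop where
  mem : ∀ k j : ℕ, PowerSeries.coeff j (PowerSeries.coeff k a) ∈ c.hom (3 * k - 2 * j) g
  vanish : ∀ k j : ℕ, j + 1 < k → PowerSeries.coeff j (PowerSeries.coeff k a) = 0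
  zero : PowerSeries.coeff 0 a = 0

theorem IsConnectedSeries.bounds {X S : Type*} [DecidableEq X] {gh : X → ℤ} [Ring S] [Algebra ℝ S]
    {c : SuperCalculus gh S} {g : ℤ} {a : PowerSeries (PowerSeries S)}
    (ha : IsConnectedSeries c g a) {k j : ℕ} (h : PowerSeries.coeff j (PowerSeries.coeff k a) ≠ 0) :
    k ≠ 0 ∧ k ≤ j + 1 ∧ 2 * j ≤ 3 * k := by
  refine ⟨?_, ?_, ?_⟩
  · rintro rfl
    exact h (by rw [ha.zero, map_zero])
  · by_contra hc
    exact h (ha.vanish k j (by omega))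
  · by_contra hc
    exact h (c.hom_eq_zero (by omega) (ha.mem k j))

variable {X : Type*} [DecidableEq X] [Fintype X] {gh : X → ℤ}

/-- The formal function `ħ a(1/ħ, ħ)` of a series `a(μ, h)` of connected diagrams. Its part of order
`ħ^l` and degree `n` is the coefficient of `μ^k h^{l+k-1}`, where `k = n + 2 l - 2` is the number of
vertices and `l + k - 1` the number of edges. It is `0` where there would be no vertex, which
includes the case `n + 2 l < 2` of the truncated subtraction. -/
def toFormal (a : PowerSeries (PowerSeries (SFun gh))) : FormalFun gh := fun l n =>
  if n + 2 * l - 2 = 0 then 0 else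
    PowerSeries.coeff (l + (n + 2 * l - 2) - 1) (PowerSeries.coeff (n + 2 * l - 2) a)

theorem toFormal_add (a b : PowerSeries (PowerSeries (SFun gh))) (l n : ℕ) :
    toFormal (a + b) l n = toFormal a l n + toFormal b l n := by
  unfold toFormal
  split_ifs
  · rw [add_zero]
  · rw [map_add, map_add]

theorem toFormal_smul (x : ℝ) (a : PowerSeries (PowerSeries (SFun gh))) (l n : ℕ) :
    toFormal (x • a) l n = x • toFormal a l n := by
  unfold toFormal
  split_ifs
  · rw [smul_zero]
  · rw [coeff_coeff_smul]

theorem toFormal_zero (l n : ℕ) : toFormal (0 : PowerSeries (PowerSeries (SFun gh))) l n = 0 := by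
  unfold toFormal
  split_ifs
  · rfl
  · rw [map_zero, map_zero]

theorem isOfGhost_toFormal {g : ℤ} {a : PowerSeries (PowerSeries (SFun gh))}
    (ha : IsConnectedSeries (sfunCalculus gh) g a) : IsOfGhost gh g (toFormal a) := by
  intro l n
  rw [mem_homogeneous_iff]
  unfold toFormal
  split_ifs with h
  · exact zero_mem _
  · exact (sfunCalculus gh).mem_hom_congr (by omega) rfl (ha.mem _ _)

theorem antiBracket_eq (B : Matrix X X ℝ) {f : SFun gh}
    (hf : ∀ x, (sfunCalculus gh).tw x f = f) (g : SFun gh) :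
    antiBracket gh B f g = (sfunCalculus gh).toTwisted.bracket B f g := by
  refine Finset.sum_congr rfl fun x _ => Finset.sum_congr rfl fun y _ => ?_
  have h1 : rightDeriv gh x f = (-1 : ℝ) ^ gh x • leftDeriv gh x f := by
    rw [rightDeriv_eq]
    have h2 := (sfunCalculus gh).tw_der x x f
    rw [hf] at h2
    refine h2.trans ?_
    congr 1
    unfold koszul
    split_ifs with h
    · rw [or_self] at h; rw [h.neg_one_zpow]
    · rw [or_self, Int.not_even_iff_odd] at h; rw [h.neg_one_zpow]
  rw [h1]
  have h3 : (((-1 : ℝ) ^ gh x * B x y) * (-1 : ℝ) ^ gh x) = B x y := by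
    rcases Int.even_or_odd (gh x) with h | h
    · rw [h.neg_one_zpow]; ring
    · rw [h.neg_one_zpow]; ring
  have h4 : ((-1 : ℝ) ^ gh x • leftDeriv gh x f) * leftDeriv gh y g =
    (-1 : ℝ) ^ gh x • (leftDeriv gh x f * leftDeriv gh y g) := smul_mul_assoc _ _ _
  rw [h4, smul_smul, h3]
  rfl

theorem antiBracket_zero_left (B : Matrix X X ℝ) (g : SFun gh) : antiBracket gh B 0 g = 0 := by
  rw [antiBracket_eq B (fun x => map_zero _), TwistedDerivations.bracket_zero_left]

theorem antiBracket_zero_right (B : Matrix X X ℝ) (f : SFun gh) : antiBracket gh B f 0 = 0 := by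
  simp [antiBracket]

/-- The anti-bracket joins two diagrams by an edge. -/
theorem formalBracket_toFormal (B : Matrix X X ℝ) {g : ℤ}
    {a b : PowerSeries (PowerSeries (SFun gh))} (ha : IsConnectedSeries (sfunCalculus gh) 0 a)
    (hb : IsConnectedSeries (sfunCalculus gh) g b) (l n : ℕ) :
    formalBracket gh B (toFormal a) (toFormal b) l n = toFormal (hVar (SFun gh) *
      (sfunCalculus gh).toTwisted.powerSeries.powerSeries.bracket B a b) l n := by
  have hterm : ∀ l₁ n₁ l₂ n₂, antiBracket gh B (toFormal a l₁ n₁) (toFormal b l₂ n₂) ≠ 0 →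
      3 ≤ n₁ + 2 * l₁ ∧ 3 ≤ n₂ + 2 * l₂ := by
    intro l₁ n₁ l₂ n₂ h
    constructor
    · by_contra hc
      refine h ?_
      rw [toFormal, if_pos (by omega), antiBracket_zero_left]
    · by_contra hc
      refine h ?_
      rw [toFormal.eq_def b, if_pos (by omega), antiBracket_zero_right]
  by_cases hk : n + 2 * l - 2 = 0 ∨ l + (n + 2 * l - 2) < 2
  · have hl : formalBracket gh B (toFormal a) (toFormal b) l n = 0 := by
      refine Finset.sum_eq_zero fun p hp => Finset.sum_eq_zero fun q hq => ?_
      rw [Finset.HasAntidiagonal.mem_antidiagonal] at hp hq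
      by_contra hc
      have := hterm _ _ _ _ hc
      omega
    rw [hl, toFormal]
    split_ifs with h0
    · rfl
    · rw [show l + (n + 2 * l - 2) - 1 = 0 by omega, coeff_zero_hVar_mul]
  · rw [toFormal, if_neg (by omega), show l + (n + 2 * l - 2) - 1 = l + (n + 2 * l - 2) - 2 + 1 by
      omega, coeff_succ_hVar_mul, TwistedDerivations.coeff_coeff_bracket, formalBracket]
    rw [← Finset.sum_product', ← Finset.sum_product']
    refine Finset.sum_bij_ne_zero (fun x _ _ => ((x.2.1 + 2 * x.1.1 - 2, x.2.2 + 2 * x.1.2 - 2),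
      (x.1.1 + (x.2.1 + 2 * x.1.1 - 2) - 1, x.1.2 + (x.2.2 + 2 * x.1.2 - 2) - 1))) ?_ ?_ ?_ ?_
    · rintro ⟨⟨l₁, l₂⟩, n₁, n₂⟩ hx h0
      have := hterm _ _ _ _ h0
      simp only [Finset.mem_product, Finset.HasAntidiagonal.mem_antidiagonal] at hx this ⊢
      omega
    · rintro ⟨⟨l₁, l₂⟩, n₁, n₂⟩ hx h0 ⟨⟨l₁', l₂'⟩, n₁', n₂'⟩ hx' h0' heq
      have h1 := hterm _ _ _ _ h0
      have h2 := hterm _ _ _ _ h0'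
      simp only [Prod.mk.injEq] at heq h1 h2 ⊢
      omega
    · rintro ⟨⟨k₁, k₂⟩, j₁, j₂⟩ hx h0
      have h1 : PowerSeries.coeff j₁ (PowerSeries.coeff k₁ a) ≠ 0 := fun h => h0 (by
        simp only [h, TwistedDerivations.bracket_zero_left])
      have h2 : PowerSeries.coeff j₂ (PowerSeries.coeff k₂ b) ≠ 0 := fun h => h0 (by
        simp only [h, TwistedDerivations.bracket_zero_right])
      have b1 := ha.bounds h1
      have b2 := hb.bounds h2
      simp only [Finset.mem_product, Finset.HasAntidiagonal.mem_antidiagonal] at hx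
      have e1 : 3 * k₁ - 2 * j₁ + 2 * (j₁ + 1 - k₁) - 2 = k₁ := by omega
      have e2 : 3 * k₂ - 2 * j₂ + 2 * (j₂ + 1 - k₂) - 2 = k₂ := by omega
      have e3 : j₁ + 1 - k₁ + k₁ - 1 = j₁ := by omega
      have e4 : j₂ + 1 - k₂ + k₂ - 1 = j₂ := by omega
      refine ⟨((j₁ + 1 - k₁, j₂ + 1 - k₂), (3 * k₁ - 2 * j₁, 3 * k₂ - 2 * j₂)), ?_, ?_, ?_⟩
      · simp only [Finset.mem_product, Finset.HasAntidiagonal.mem_antidiagonal]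
        omega
      · simp only [toFormal, e1, e2, e3, e4, b1.1, b2.1, if_false]
        rw [antiBracket_eq B (fun x => (sfunCalculus gh).twist_ghost_zero (ha.mem k₁ j₁) x)]
        exact h0
      · simp only [e1, e2, e3, e4]
    · rintro ⟨⟨l₁, l₂⟩, n₁, n₂⟩ hx h0
      have := hterm _ _ _ _ h0
      simp only at this
      simp only [toFormal, show n₁ + 2 * l₁ - 2 ≠ 0 by omega, show n₂ + 2 * l₂ - 2 ≠ 0 by omega,
        if_false]
      exact antiBracket_eq B (fun x => (sfunCalculus gh).twist_ghost_zero (ha.mem _ _) x) _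

/-- The Laplacian joins two legs of a diagram by an edge, and so adds a loop. -/
theorem hbarLaplacian_toFormal (B : Matrix X X ℝ) {g : ℤ}
    {b : PowerSeries (PowerSeries (SFun gh))} (hb : IsConnectedSeries (sfunCalculus gh) g b)
    (l n : ℕ) : hbarLaplacian gh B (toFormal b) l n = toFormal (hVar (SFun gh) *
      ((1 / 2 : ℝ) • (sfunCalculus gh).toTwisted.powerSeries.powerSeries.sec B b)) l n := by
  have h1 : ∀ f, bvLaplacian gh B f = (1 / 2 : ℝ) • (sfunCalculus gh).toTwisted.sec B f :=
    fun f => rfl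
  cases l with
  | zero =>
    change (0 : SFun gh) = _
    rw [toFormal]
    split_ifs with h0
    · rfl
    · match n with
      | 0 => omega
      | 1 => omega
      | 2 => omega
      | 3 => exact (coeff_zero_hVar_mul _ _).symm
      | n + 4 =>
        rw [show 0 + (n + 4 + 2 * 0 - 2) - 1 = n + 1 by omega, coeff_succ_hVar_mul,
          coeff_coeff_smul, TwistedDerivations.coeff_coeff_sec, hb.vanish _ _ (by omega), map_zero,
          smul_zero]
  | succ l =>
    change bvLaplacian gh B (toFormal b l (n + 2)) = _
    rw [h1, toFormal, toFormal, show n + 2 + 2 * l - 2 = n + 2 * l by omega,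
      show n + 2 * (l + 1) - 2 = n + 2 * l by omega]
    split_ifs with h0
    · rw [map_zero, smul_zero]
    · rw [show l + 1 + (n + 2 * l) - 1 = l + (n + 2 * l) - 1 + 1 by omega, coeff_succ_hVar_mul,
        coeff_coeff_smul, TwistedDerivations.coeff_coeff_sec]

end Formal

/-! ### The substitution that turns vertices and edges into powers of `ħ` -/

section Laurent

variable {S : Type*} [Ring S]

theorem single_mul_comm (i : ℤ) (f : LaurentSeries S) :
    HahnSeries.single i (1 : S) * f = f * HahnSeries.single i (1 : S) := by
  ext n
  rw [← sub_add_cancel n i, HahnSeries.coeff_single_mul_add, HahnSeries.coeff_mul_single_add,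
    one_mul, mul_one]

/-- The substitution `μ ↦ λ / ħ`, `h ↦ ħ`. -/
def toLaurent : PowerSeries (PowerSeries S) →+* PowerSeries (LaurentSeries S) where
  toFun a := PowerSeries.mk fun k => HahnSeries.single (-(k : ℤ)) (1 : S) *
    HahnSeries.ofPowerSeries ℤ S (PowerSeries.coeff k a)
  map_one' := by
    ext1 k
    rw [PowerSeries.coeff_mk, PowerSeries.coeff_one, PowerSeries.coeff_one]
    split_ifs with h
    · subst h; simp
    · rw [map_zero, mul_zero]
  map_mul' a b := by
    ext1 k
    rw [PowerSeries.coeff_mk, PowerSeries.coeff_mul, PowerSeries.coeff_mul, map_sum, Finset.mul_sum]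
    refine Finset.sum_congr rfl fun p hp => ?_
    rw [Finset.HasAntidiagonal.mem_antidiagonal] at hp
    rw [PowerSeries.coeff_mk, PowerSeries.coeff_mk, map_mul, mul_assoc, ← mul_assoc _
      (HahnSeries.single (-(p.2 : ℤ)) (1 : S)), ← single_mul_comm, ← mul_assoc, ← mul_assoc,
      ← mul_assoc, HahnSeries.single_mul_single, one_mul]
    congr 4
    rw [← hp]; push_cast; ring
  map_zero' := by
    ext1 k
    rw [PowerSeries.coeff_mk, map_zero, map_zero, map_zero, mul_zero]
  map_add' a b := by
    ext1 k
    rw [PowerSeries.coeff_mk, map_add, map_add, map_add, mul_add, PowerSeries.coeff_mk,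
      PowerSeries.coeff_mk]

theorem toLaurent_apply (a : PowerSeries (PowerSeries S)) : toLaurent a = PowerSeries.mk fun k : ℕ =>
    HahnSeries.single (-(k : ℤ)) (1 : S) *
      HahnSeries.ofPowerSeries ℤ S (PowerSeries.coeff k a) := rfl

theorem coeff_toLaurent (a : PowerSeries (PowerSeries S)) (k m : ℕ) (i : ℤ) (hi : i + k = m) :
    HahnSeries.coeff (PowerSeries.coeff k (toLaurent a)) i =
      PowerSeries.coeff m (PowerSeries.coeff k a) := by
  rw [toLaurent_apply, PowerSeries.coeff_mk, show i = (m : ℤ) + -(k : ℤ) by omega,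
    HahnSeries.coeff_single_mul_add, one_mul, HahnSeries.ofPowerSeries_apply_coeff]

theorem coeff_log_toLaurent [Algebra ℝ S] (Z : PowerSeries (PowerSeries S)) (k m : ℕ) (i : ℤ)
    (hi : i + k = m) : HahnSeries.coeff (PowerSeries.coeff k (logSeries (toLaurent Z))) i =
      PowerSeries.coeff m (PowerSeries.coeff k (logSeries Z)) := by
  rw [logSeries, logSeries, PowerSeries.coeff_mk, PowerSeries.coeff_mk, HahnSeries.coeff_sum,
    map_sum]
  refine Finset.sum_congr rfl fun j _ => ?_
  have h : (toLaurent Z - 1) ^ j = toLaurent ((Z - 1) ^ j) := by rw [map_pow, map_sub, map_one]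
  rw [HahnSeries.coeff_smul, coeff_real_smul, ← coeff_toLaurent _ _ _ _ hi, h]

end Laurent

/-! ### The effective action as a series of diagrams -/

section EffectiveAction

/-- The coefficients of the partition series, in terms of the full series. -/
theorem coeff_mapPS_expSeries {X S S' : Type*} [DecidableEq X] [Fintype X] {gh : X → ℤ} [Ring S]
    [Algebra ℝ S] [Ring S'] [Algebra ℝ S'] (c : SuperCalculus gh S) (r : S →ₐ[ℝ] S')
    (B : Matrix X X ℝ) (u : S) (k j : ℕ) :
    PowerSeries.coeff j (PowerSeries.coeff k (mapPS (r : S →+* S')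
      (expSeries (c.sec ((-1 / 2 : ℝ) • B)) u))) =
      ((-1 / 2 : ℝ) ^ j / ((j.factorial : ℝ) * (k.factorial : ℝ))) •
        r ((c.sec B ^ j) (u ^ k)) := by
  rw [coeff_mapPS, coeff_expSeries, RingHom.coe_coe, map_smul, c.sec_smul, smul_pow,
    LinearMap.smul_apply, map_smul, smul_smul]
  congr 1
  ring

variable {C : Type*} [Ring C] [Algebra ℝ C] {𝒞 : ℕ → Submodule ℝ C} [GradedAlgebra 𝒞]
  {𝔤 : Type*} [LieRing 𝔤] [LieAlgebra ℝ 𝔤] {I J P : Type*} [Fintype I] [DecidableEq I] [Fintype J]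
  [DecidableEq J] [Fintype P] [DecidableEq P] {A : DGFrobenius 𝒞 3} {κ : LinearMap.BilinForm ℝ 𝔤}
  (e : HomBasis I 𝒞) (T : Module.Basis J ℝ 𝔤)
  (h : HomBasis P A.cohomologyDeg) {ι : A.Cohomology →ₗ[ℝ] C}

theorem csAction_sub_freeAction : csAction A κ e T - freeAction A κ e T =
    (sfunCalculus (ghost e J)).cubic (csTensor A κ e T) :=
  add_sub_cancel_left _ _

theorem restrictZeroModes_co (hι : A.IsEmbedding ι) (x : I × J) :
    restrictZeroModes A e J h ι ((sfunCalculus (ghost e J)).co x) = ∑ y : P × J,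
      (if x.2 = y.2 then e.basis.repr (ι (h.basis y.1)) x.1 else 0) •
        (sfunCalculus (ghost h J)).co y := by
  refine pullback_coord (ghost e J) (ghost h J) (fun x y hxy => ?_) x
  rw [Matrix.of_apply] at hxy
  split_ifs at hxy
  · unfold ghost
    rw [e.deg_of_repr_ne_zero (hι.degree _ _ (h.mem _)) hxy]
  · exact absurd rfl hxy

/-- The Laurent series of the effective action, in terms of vertices and edges. -/
theorem effectiveAction_eq (K : C →ₗ[ℝ] C) : effectiveAction A κ e T h ι K =
    toFormal (logSeries (mapPS (restrictZeroModes A e J h ι : _ →+* _) (expSeries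
      ((sfunCalculus (ghost e J)).sec ((-1 / 2 : ℝ) • propagator A κ e T K))
      ((sfunCalculus (ghost e J)).cubic (csTensor A κ e T))))) := by
  set Z := mapPS (restrictZeroModes A e J h ι : SFun (ghost e J) →+* SFun (ghost h J)) (expSeries
      ((sfunCalculus (ghost e J)).sec ((-1 / 2 : ℝ) • propagator A κ e T K))
      ((sfunCalculus (ghost e J)).cubic (csTensor A κ e T))) with hZ
  have hpart : partitionSeries A κ e T h ι K = toLaurent Z := by
    rw [partitionSeries, toLaurent_apply]
    refine congrArg PowerSeries.mk (funext fun k => ?_)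
    refine congrArg (fun f => HahnSeries.single (-(k : ℤ)) (1 : SFun (ghost h J)) *
      HahnSeries.ofPowerSeries ℤ (SFun (ghost h J)) f) (PowerSeries.ext fun j => ?_)
    rw [hZ, coeff_mapPS_expSeries, PowerSeries.coeff_mk, csAction_sub_freeAction, secondOrder_eq]
  funext l n
  rw [effectiveAction, hpart, toFormal]
  split_ifs with h0
  · rw [h0]
    exact congrArg (fun f => HahnSeries.coeff f _) (coeff_zero_logSeries (toLaurent Z))
  · exact coeff_log_toLaurent Z _ _ _ (by omega)

end EffectiveAction

end CSEffective

end

theorem proposition8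
    {C : Type*} [Ring C] [Algebra ℝ C] (𝒞 : ℕ → Submodule ℝ C) [GradedAlgebra 𝒞]
    (A : CSEffective.DGFrobenius 𝒞 3)
    {𝔤 : Type*} [LieRing 𝔤] [LieAlgebra ℝ 𝔤] (κ : LinearMap.BilinForm ℝ 𝔤)
    (hκ : CSEffective.IsQuadratic κ)
    {I J P : Type*} [Fintype I] [DecidableEq I] [Fintype J] [DecidableEq J]
    [Fintype P] [DecidableEq P]
    (e : CSEffective.HomBasis I 𝒞) (T : Module.Basis J ℝ 𝔤)
    (h : CSEffective.HomBasis P A.cohomologyDeg)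
    (ι : A.Cohomology →ₗ[ℝ] C) (hι : A.IsEmbedding ι)
    (Khat : C →ₗ[ℝ] C) (hK : A.IsChainHomotopy ι Khat) :
    (A.IsChainHomotopy ι (Khat ∘ₗ A.d ∘ₗ Khat) ∧
      (Khat ∘ₗ A.d ∘ₗ Khat) ∘ₗ (Khat ∘ₗ A.d ∘ₗ Khat) = 0) ∧
    CSEffective.CanonicallyEquivalent (CSEffective.ghost h J)
      (CSEffective.cohomologyPoisson A κ T h ι)
      (CSEffective.effectiveAction A κ e T h ι (Khat ∘ₗ A.d ∘ₗ Khat))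
      (CSEffective.effectiveAction A κ e T h ι Khat) := by
  open CSEffective in
  obtain ⟨Q, hQ, hKd⟩ := hK.homotopy
  have hid := hK.identities e hι hQ hKd
  refine ⟨⟨hK.strict hQ hid, LinearMap.ext hid.square_zero⟩, ?_⟩
  set B := cohomologyPoisson A κ T h ι with hB
  have H := effectiveFlow hκ e T h (sfunCalculus (ghost e J)) (sfunCalculus (ghost h J)) hι hK
    (restrictZeroModes_co e h hι)
  set c := sfunCalculus (ghost e J)
  set c' := sfunCalculus (ghost h J)
  set r := restrictZeroModes A e J h ι
  set u := c.cubic (csTensor A κ e T)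
  set K := Khat ∘ₗ A.d ∘ₗ Khat with hKdef
  set A₀ := (-1 / 2 : ℝ) • propagator A κ e T K with hA₀
  set A₁ := (-1 / 2 : ℝ) • propagator A κ e T (Khat + (-1 : ℝ) • K) with hA₁
  set Λ := propagator A κ e T (Khat ∘ₗ Khat ∘ₗ Khat ∘ₗ A.d)
  have hW : ∀ t, IsConnectedSeries c' 0 (logSeries (EffectiveFlow.series r c A₀ A₁ u t)) :=
    fun t => ⟨H.coeff_log_series_mem t, fun k j => H.coeff_log_series_eq_zero t,
      coeff_zero_logSeries _⟩
  have hR : ∀ t, IsConnectedSeries c' (-1) (EffectiveFlow.generator r c A₀ A₁ Λ u t) :=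
    fun t => ⟨H.coeff_generator_mem t, fun k j => H.coeff_generator_eq_zero t,
      EffectiveFlow.coeff_zero_generator t⟩
  refine ⟨fun t => toFormal (logSeries (EffectiveFlow.series r c A₀ A₁ u t)),
    fun t => toFormal (EffectiveFlow.generator r c A₀ A₁ Λ u t),
    ⟨fun l n φ => ?_, fun l n φ => ?_, fun t _ => isOfGhost_toFormal (hW t),
      fun t _ => isOfGhost_toFormal (hR t), fun t _ l n => ?_, fun t _ l n φ => ?_⟩, ?_, ?_⟩
  · unfold toFormal
    split_ifs
    · exact contDiffOn_const
    · exact ((EffectiveFlow.isPolyPath_log_series _ _).contDiff φ).contDiffOn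
  · unfold toFormal
    split_ifs
    · exact contDiffOn_const
    · exact ((EffectiveFlow.isPolyPath_generator _ _).contDiff φ).contDiffOn
  · rw [formalBracket_toFormal B (hW t) (hW t), hbarLaplacian_toFormal B (hW t), ← toFormal_smul,
      ← toFormal_add, ← mul_smul_comm, ← mul_add, ← smul_add, add_comm, H.quantum_master t,
      smul_zero, mul_zero, toFormal_zero]
  · rw [formalBracket_toFormal B (hW t) (hR t), hbarLaplacian_toFormal B (hR t), ← toFormal_add,
      ← mul_add, add_comm]
    unfold toFormal
    split_ifs
    · simpa using hasDerivWithinAt_const _ _ _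
    · exact (H.hasDerivAt_log_series φ _ _ t).hasDerivWithinAt
  · rw [effectiveAction_eq]
    simp only [EffectiveFlow.series, EffectiveFlow.fullSeries, zero_smul, add_zero]
    rfl
  · have h1 : A₀ + (1 : ℝ) • A₁ = (-1 / 2 : ℝ) • propagator A κ e T Khat := by
      rw [hA₀, hA₁, propagator_add, propagator_smul]
      module
    rw [effectiveAction_eq]
    simp only [EffectiveFlow.series, EffectiveFlow.fullSeries, h1]
    rfl
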